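/- Graphs are finite and may have loops and multiple edges; a loop contributes $2$ to the degree of its vertex. A factor of a graph $G$ is a spanning subgraph of $G$. A graph is $m$-tree-connected if it contains $m$ pairwise edge-disjoint spanning trees, and it is modulo $k$-regular if all its vertex degrees are positive and divisible by $k$. Let $k\ge 2$ be an integer and let $G$ be a graph with at least two vertices. (i) If $G$ is $(4k-4)$-tree-connected, then $G$ has a bipartite modulo $k$-regular factor. (ii) If $G$ is bipartite and $(2k-2)$-tree-connected, then $G$ has a (necessarily bipartite) modulo $k$-regular factor. -/

import Mathlib

namespace Graph

variable {α β : Type*}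

/-- The degree of a vertex: the number of edges incident with it, each loop counted twice. -/
noncomputable def deg (G : Graph α β) (v : α) : ℕ :=
  (G.incidenceSet v).ncard + (G.loopSet v).ncard

/-- A multigraph is a tree if it has neither loops nor parallel edges and the resulting simple
graph is a tree (connected and acyclic). -/
def IsTreeGraph (T : Graph α β) : Prop :=
  T.Simple ∧ T.toSimpleGraph.IsTree

/-- `G` is `m`-tree-connected: it contains `m` pairwise edge-disjoint spanning trees. -/
def TreeConnected (G : Graph α β) (m : ℕ) : Prop :=
  ∃ T : Fin m → Graph α β,
    (∀ i, T i ≤s G ∧ (T i).IsTreeGraph) ∧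
    ∀ i j, i ≠ j → Disjoint (T i).edgeSet (T j).edgeSet

/-- `G` is bipartite: its vertex set is the disjoint union of two sets `X`, `Y` such that every
edge has one end in `X` and the other end in `Y`. -/
def IsBipartiteGraph (G : Graph α β) : Prop :=
  ∃ X Y : Set α, X ∪ Y = G.vertexSet ∧ Disjoint X Y ∧
    ∀ e x y, G.IsLink e x y → (x ∈ X ∧ y ∈ Y) ∨ (x ∈ Y ∧ y ∈ X)

/-- `G` is modulo `k`-regular: all its degrees are positive and divisible by `k`. -/
def ModuloRegular (G : Graph α β) (k : ℕ) : Prop :=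
  ∀ v ∈ G.vertexSet, 0 < G.deg v ∧ k ∣ G.deg v

/-- `G` admits a bipartite modulo `k`-regular factor (a factor is a spanning subgraph). -/
def HasBipartiteModuloRegularFactor (G : Graph α β) (k : ℕ) : Prop :=
  ∃ H : Graph α β, H ≤s G ∧ H.IsBipartiteGraph ∧ H.ModuloRegular k

end Graph

/-! Let the graph be bipartite with side `X`, and direct every edge into `X`. If `σ` is any other
orientation, the edges on which the two disagree form a subgraph `H` whose degree at `v` is, up to
sign, half the difference of the net out-degrees at `v`. So `H` has all degrees divisible by `k`
once the net out-degrees agree modulo `2 * k`, and it has no isolated vertex once `σ` has neither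
sources nor sinks. For `k ≥ 3`, (ii) is therefore a case of `Colored.orients`: with `2 * k - 2`
edge-disjoint connected spanning subgraphs, any demand of the right parity and total is met modulo
`2 * k` without sources and sinks. For `k = 2`, two connected spanning subgraphs suffice by a parity
correction (`exists_factor_two`).

`Colored.orients` is proved by induction on the number of vertices. A vertex whose degree plus
demand norm is at most `4 * (k - 1)` is removed by lifting pairs of its edges while all colour
classes stay connected (`Star.good`). Otherwise all degrees are at least `2 * k`. If moreover every
cut has at least `2 * (k - 1)` edges plus the norm of its demand, the orientation theorem of Lovász,
Thomassen, Wu and Zhang (`Rooted.Adm.solvable`) applies; its additional bound of `2 * k - 1` on the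
excesses excludes sources and sinks. If some set violates this cut condition, a minimal one is
contracted, the contraction is oriented by induction, and the inside is oriented by the same
theorem, with the outside as a root whose arcs are already directed. The violated inequality is
exactly the degree bound required of the root.

`Rooted.Adm.solvable` is an induction over instances with a root. Tight sets are contracted. Without
tight sets, parity gives every set of at least two vertices, other than the whole vertex set, slack
two, which pays for local changes: directing and deleting an edge from positive to negative demand,
trading arcs at the root, or splitting off edges at a vertex of zero demand.

For (i), a maximum cut keeps at least half of the edges between the parts of any partition. By the
theorem of Nash-Williams and Tutte (`exists_connecting`, from matroid union for vectors) it still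
contains `2 * k - 2` disjoint connected spanning subgraphs, so the argument for (ii) applies to it.
-/

namespace ModOrient

/-- The distance from `x` to the nearest multiple of `2 * k`. -/
def nrm (k x : ℤ) : ℤ := min (x % (2 * k)) (2 * k - x % (2 * k))

lemma dvd_of_dvd_eq {d a b : ℤ} (h : d ∣ a) (e : a = b) : d ∣ b := e ▸ h

/-! ### Distance to the multiples of `2 * k`. -/

section Nrm
variable {k : ℤ}

lemma nrm_nonneg (hk : 2 ≤ k) (x : ℤ) : 0 ≤ nrm k x := by
  have h1 := Int.emod_nonneg x (show (2 * k) ≠ 0 by omega)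
  have h2 := Int.emod_lt_of_pos x (show 0 < 2 * k by omega)
  unfold nrm; omega

lemma nrm_le (hk : 2 ≤ k) (x : ℤ) : nrm k x ≤ k := by
  have h1 := Int.emod_nonneg x (show (2 * k) ≠ 0 by omega)
  have h2 := Int.emod_lt_of_pos x (show 0 < 2 * k by omega)
  unfold nrm; omega

lemma nrm_congr {x y : ℤ} (h : 2 * k ∣ x - y) : nrm k x = nrm k y := by
  have : x % (2 * k) = y % (2 * k) := Int.emod_eq_emod_iff_emod_sub_eq_zero.2
    (Int.emod_eq_zero_of_dvd h)
  unfold nrm; rw [this]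

/-- The representative of least absolute value; through it the symmetry and subadditivity of the
norm follow from those of the absolute value. -/
lemma exists_nrm (hk : 2 ≤ k) (x : ℤ) : ∃ r, 2 * k ∣ x - r ∧ |r| = nrm k x := by
  have h1 := Int.emod_nonneg x (show (2 * k) ≠ 0 by omega)
  have h2 := Int.emod_lt_of_pos x (show 0 < 2 * k by omega)
  have h3 := Int.mul_ediv_add_emod x (2 * k)
  by_cases h : x % (2 * k) ≤ k
  · refine ⟨x % (2 * k), ⟨x / (2 * k), by linarith⟩, ?_⟩
    rw [abs_of_nonneg h1]; unfold nrm; omega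
  · refine ⟨x % (2 * k) - 2 * k, ⟨x / (2 * k) + 1, by linarith⟩, ?_⟩
    rw [abs_of_nonpos (by omega)]; unfold nrm; omega

lemma nrm_le_abs (hk : 2 ≤ k) (x : ℤ) : nrm k x ≤ |x| := by
  have h1 := Int.emod_nonneg x (show (2 * k) ≠ 0 by omega)
  have h2 := Int.emod_lt_of_pos x (show 0 < 2 * k by omega)
  have h3 := Int.mul_ediv_add_emod x (2 * k)
  unfold nrm
  rcases lt_trichotomy (x / (2 * k)) (-1) with h | h | h
  · have : 2 * k * (x / (2 * k)) ≤ 2 * k * (-2) := mul_le_mul_of_nonneg_left (by omega) (by omega)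
    rw [abs_of_nonpos (by omega)]; omega
  · rw [h] at h3; rw [abs_of_nonpos (by omega)]; omega
  · have : 0 ≤ 2 * k * (x / (2 * k)) := mul_nonneg (by omega) (by omega)
    rw [abs_of_nonneg (by omega)]; omega

lemma nrm_le_abs_of_dvd (hk : 2 ≤ k) {x r : ℤ} (h : 2 * k ∣ x - r) : nrm k x ≤ |r| := by
  rw [nrm_congr h]; exact nrm_le_abs hk r

lemma nrm_neg (hk : 2 ≤ k) (x : ℤ) : nrm k (-x) = nrm k x := by
  apply le_antisymm
  · obtain ⟨r, h, h'⟩ := exists_nrm hk x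
    rw [← h', ← abs_neg]
    exact nrm_le_abs_of_dvd hk (dvd_of_dvd_eq ((dvd_neg).2 h) (by ring))
  · obtain ⟨r, h, h'⟩ := exists_nrm hk (-x)
    rw [← h', ← abs_neg]
    exact nrm_le_abs_of_dvd hk (dvd_of_dvd_eq ((dvd_neg).2 h) (by ring))

lemma nrm_add_le (hk : 2 ≤ k) (x y : ℤ) : nrm k (x + y) ≤ nrm k x + nrm k y := by
  obtain ⟨r, h, h'⟩ := exists_nrm hk x
  obtain ⟨u, g, g'⟩ := exists_nrm hk y
  rw [← h', ← g']
  refine (nrm_le_abs_of_dvd hk (r := r + u) ?_).trans (abs_add_le _ _)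
  exact dvd_of_dvd_eq (dvd_add h g) (by ring)

lemma nrm_add_le_abs (hk : 2 ≤ k) (x y : ℤ) : nrm k (x + y) ≤ nrm k x + |y| :=
  (nrm_add_le hk x y).trans (by linarith [nrm_le_abs hk y])

/-- The modulus is even, so passing to the norm keeps parity. This is what gives cuts that are not
tight a slack of two. -/
lemma nrm_parity (k x : ℤ) : 2 ∣ x - nrm k x := by
  have h3 := Int.mul_ediv_add_emod x (2 * k)
  have h4 : (2 : ℤ) ∣ 2 * k * (x / (2 * k)) := ⟨k * (x / (2 * k)), by ring⟩
  unfold nrm; omega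

lemma emod_of_dvd_sub {x r : ℤ} (h : 2 * k ∣ x - r) (h0 : 0 ≤ r) (h1 : r < 2 * k) :
    x % (2 * k) = r := by
  obtain ⟨j, hj⟩ := h
  have : x = r + 2 * k * j := by linarith
  rw [this, Int.add_mul_emod_self_left, Int.emod_eq_of_lt h0 h1]

lemma dvd_sub_emod (k x : ℤ) : 2 * k ∣ x - x % (2 * k) := Int.dvd_self_sub_emod

/-- Residues up to `k` count as positive demand, and a step down brings them closer to zero;
`nrm_add_one` is the mirror image for the other half. -/
lemma nrm_sub_one (hk : 2 ≤ k) {x : ℤ} (h1 : 1 ≤ x % (2 * k)) (h2 : x % (2 * k) ≤ k) :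
    nrm k (x - 1) = nrm k x - 1 := by
  have : (x - 1) % (2 * k) = x % (2 * k) - 1 :=
    emod_of_dvd_sub (dvd_of_dvd_eq (dvd_sub_emod k x) (by ring)) (by omega) (by omega)
  unfold nrm; rw [this]; omega

lemma nrm_add_one (hk : 2 ≤ k) {x : ℤ} (h1 : k ≤ x % (2 * k)) :
    nrm k (x + 1) = nrm k x - 1 := by
  have h2 := Int.emod_lt_of_pos x (show 0 < 2 * k by omega)
  by_cases h3 : x % (2 * k) = 2 * k - 1
  · have : (x + 1) % (2 * k) = 0 := by
      apply Int.emod_eq_zero_of_dvd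
      have := dvd_sub_emod k x
      rw [h3] at this
      exact dvd_of_dvd_eq (dvd_add this (dvd_refl (2 * k))) (by ring)
    unfold nrm; rw [this]; omega
  · have : (x + 1) % (2 * k) = x % (2 * k) + 1 :=
      emod_of_dvd_sub (dvd_of_dvd_eq (dvd_sub_emod k x) (by ring)) (by omega) (by omega)
    unfold nrm; rw [this]; omega

/-- The values of absolute value less than `2 * k` in a residue class modulo `2 * k`. -/
lemma eq_or_eq_of_abs_lt (hk : 2 ≤ k) {x n : ℤ} (h : 2 * k ∣ n - x) (hn : |n| ≤ 2 * k - 1) :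
    n = x % (2 * k) ∨ n = x % (2 * k) - 2 * k := by
  have h1 := Int.emod_nonneg x (show (2 * k) ≠ 0 by omega)
  have h2 := Int.emod_lt_of_pos x (show 0 < 2 * k by omega)
  rw [abs_le] at hn
  obtain ⟨j, hj⟩ : 2 * k ∣ n - x % (2 * k) := by
    exact dvd_of_dvd_eq (dvd_add h (dvd_sub_emod k x)) (by ring)
  have : j = 0 ∨ j = -1 := by
    have a1 : -2 < j := by by_contra hc; nlinarith
    have a2 : j < 1 := by by_contra hc; nlinarith
    omega
  rcases this with rfl | rfl
  · left; linarith
  · right; linarith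

end Nrm

/-! ### Cuts and net out-degrees. -/

section Cut
variable {α ι : Type*} [DecidableEq α]

/-- The indicator of the edge `e` crossing the vertex set `A`. -/
def crosses (s t : ι → α) (A : Finset α) (e : ι) : ℤ := if (s e ∈ A ↔ t e ∈ A) then 0 else 1

/-- The incidence of the edge `e` at the vertex `v`, where `e` is directed from `s e` to `t e`. -/
def inc (s t : ι → α) (e : ι) (v : α) : ℤ :=
  (if s e = v then 1 else 0) - (if t e = v then 1 else 0)

/-- The number of edges in `E` that cross `A`. -/
def cutE (E : Finset ι) (s t : ι → α) (A : Finset α) : ℤ := ∑ e ∈ E, crosses s t A e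

/-- Out-degree minus in-degree at `v`, where `σ e = 1` means that `e` is directed from `s e`
to `t e` and `σ e = -1` the opposite. -/
def net (E : Finset ι) (s t : ι → α) (σ : ι → ℤ) (v : α) : ℤ := ∑ e ∈ E, σ e * inc s t e v

/-- A vector of signs. -/
def IsSign (σ : ι → ℤ) : Prop := ∀ e, σ e = 1 ∨ σ e = -1

lemma crosses_nonneg (s t : ι → α) (A : Finset α) (e : ι) : 0 ≤ crosses s t A e := by
  unfold crosses; split_ifs <;> omega

lemma cutE_nonneg (E : Finset ι) (s t : ι → α) (A : Finset α) : 0 ≤ cutE E s t A :=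
  Finset.sum_nonneg fun e _ => crosses_nonneg s t A e

lemma crosses_eq_one {s t : ι → α} {A : Finset α} {e : ι} :
    crosses s t A e = 1 ↔ ¬ (s e ∈ A ↔ t e ∈ A) := by
  unfold crosses; split_ifs with h <;> simp [h]

lemma crosses_eq_zero {s t : ι → α} {A : Finset α} {e : ι} :
    crosses s t A e = 0 ↔ (s e ∈ A ↔ t e ∈ A) := by
  unfold crosses; split_ifs with h <;> simp [h]

lemma crosses_singleton {s t : ι → α} {v : α} {e : ι} :
    crosses s t {v} e = |inc s t e v| := by
  unfold crosses inc
  by_cases h1 : s e = v <;> by_cases h2 : t e = v <;> simp [h1, h2]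

lemma sum_inc (s t : ι → α) (A : Finset α) (e : ι) :
    ∑ v ∈ A, inc s t e v = (if s e ∈ A then 1 else 0) - (if t e ∈ A then 1 else 0) := by
  simp [inc, Finset.sum_sub_distrib]

lemma sum_net (E : Finset ι) (s t : ι → α) (σ : ι → ℤ) (A : Finset α) :
    ∑ v ∈ A, net E s t σ v =
      ∑ e ∈ E, σ e * ((if s e ∈ A then 1 else 0) - (if t e ∈ A then 1 else 0)) := by
  unfold net
  rw [Finset.sum_comm]
  refine Finset.sum_congr rfl fun e _ => ?_
  rw [← Finset.mul_sum, sum_inc]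

lemma sum_net_eq_zero {E : Finset ι} {s t : ι → α} {W : Finset α}
    (h : ∀ e ∈ E, s e ∈ W ∧ t e ∈ W) (σ : ι → ℤ) : ∑ v ∈ W, net E s t σ v = 0 := by
  rw [sum_net]
  exact Finset.sum_eq_zero fun e he => by simp [(h e he).1, (h e he).2]

lemma IsSign.abs_eq {σ : ι → ℤ} (h : IsSign σ) (e : ι) : |σ e| = 1 := by
  rcases h e with h | h <;> simp [h]

lemma abs_net_le (E : Finset ι) (s t : ι → α) {σ : ι → ℤ} (h : IsSign σ) (v : α) :
    |net E s t σ v| ≤ cutE E s t {v} := by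
  unfold net cutE
  refine (Finset.abs_sum_le_sum_abs _ _).trans (Finset.sum_le_sum fun e _ => ?_)
  rw [abs_mul, h.abs_eq, one_mul, crosses_singleton]

lemma cutE_compl {E : Finset ι} {s t : ι → α} {W : Finset α}
    (h : ∀ e ∈ E, s e ∈ W ∧ t e ∈ W) (A : Finset α) : cutE E s t (W \ A) = cutE E s t A := by
  refine Finset.sum_congr rfl fun e he => ?_
  unfold crosses
  simp only [Finset.mem_sdiff, (h e he).1, (h e he).2, true_and, not_iff_not]

lemma cutE_univ {E : Finset ι} {s t : ι → α} {W : Finset α}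
    (h : ∀ e ∈ E, s e ∈ W ∧ t e ∈ W) : cutE E s t W = 0 :=
  Finset.sum_eq_zero fun e he => crosses_eq_zero.2 (by simp [(h e he).1, (h e he).2])

lemma exists_crosses_of_cutE_pos {E : Finset ι} {s t : ι → α} {A : Finset α}
    (h : 0 < cutE E s t A) : ∃ e ∈ E, ¬ (s e ∈ A ↔ t e ∈ A) := by
  by_contra hc
  push Not at hc
  exact h.ne' (Finset.sum_eq_zero fun e he => crosses_eq_zero.2 (hc e he))

lemma cutE_erase [DecidableEq ι] {E : Finset ι} {s t : ι → α} {A : Finset α} {e : ι} (he : e ∈ E) :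
    cutE (E.erase e) s t A = cutE E s t A - crosses s t A e := by
  unfold cutE; rw [← Finset.add_sum_erase E _ he]; ring

lemma net_erase [DecidableEq ι] {E : Finset ι} {s t : ι → α} {σ : ι → ℤ} {v : α} {e : ι} (he : e ∈ E) :
    net (E.erase e) s t σ v = net E s t σ v - σ e * inc s t e v := by
  unfold net; rw [← Finset.add_sum_erase E _ he]; ring

end Cut

/-! ### Contracting a vertex set, and gluing orientations. -/

section Contract
variable {α ι : Type*} [DecidableEq α]

/-- The map sending all of `A` to `a` and fixing every other vertex. -/
def collapse (A : Finset α) (a v : α) : α := if v ∈ A then a else v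

/-- The preimage of `B` under `collapse A a`. -/
def expand (A : Finset α) (a : α) (B : Finset α) : Finset α := if a ∈ B then B ∪ A else B

lemma collapse_of_mem {A : Finset α} {a v : α} (h : v ∈ A) : collapse A a v = a := if_pos h

lemma collapse_of_notMem {A : Finset α} {a v : α} (h : v ∉ A) : collapse A a v = v := if_neg h

lemma collapse_mem_insert {W A : Finset α} {a v : α} (h : v ∈ W) :
    collapse A a v ∈ insert a (W \ A) := by
  unfold collapse; split_ifs with h' <;> simp [h, h']

variable {W A B : Finset α} {a : α}

/-- Sets of the contracted graph correspond to sets that do not split `A`. Every condition on a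
contraction is read off through this correspondence. -/
lemma collapse_mem_iff (hB : B ⊆ insert a (W \ A)) (v : α) :
    collapse A a v ∈ B ↔ v ∈ expand A a B := by
  unfold collapse expand
  by_cases hv : v ∈ A
  · by_cases hb : a ∈ B
    · simp [hv, hb]
    · simp only [hv, hb, if_true, if_false, false_iff]
      intro hvB
      rcases Finset.mem_insert.1 (hB hvB) with rfl | h
      · exact hb hvB
      · exact (Finset.mem_sdiff.1 h).2 hv
  · by_cases hb : a ∈ B <;> simp [hv, hb]

lemma expand_subset (hA : A ⊆ W) (ha : a ∈ A) (hB : B ⊆ insert a (W \ A)) :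
    expand A a B ⊆ W := by
  intro v hv
  by_cases h : v ∈ A
  · exact hA h
  · rw [← collapse_mem_iff hB, collapse_of_notMem h] at hv
    rcases Finset.mem_insert.1 (hB hv) with rfl | h'
    · exact absurd ha h
    · exact (Finset.mem_sdiff.1 h').1

lemma expand_nonempty (hB : B.Nonempty) : (expand A a B).Nonempty := by
  obtain ⟨v, hv⟩ := hB
  refine ⟨v, ?_⟩
  unfold expand; split_ifs <;> simp [hv]

lemma expand_ne (hA : A ⊆ W) (ha : a ∈ A) (hB : B ⊆ insert a (W \ A))
    (hne : B ≠ insert a (W \ A)) : expand A a B ≠ W := by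
  intro h
  apply hne
  refine Finset.Subset.antisymm hB fun v hv => ?_
  rcases Finset.mem_insert.1 hv with rfl | hv
  · have := (collapse_mem_iff hB v).2 (h ▸ hA ha)
    rwa [collapse_of_mem ha] at this
  · rw [Finset.mem_sdiff] at hv
    have := (collapse_mem_iff hB v).2 (h ▸ hv.1)
    rwa [collapse_of_notMem hv.2] at this

lemma expand_insert (hA : A ⊆ W) (ha : a ∈ A) : expand A a (insert a (W \ A)) = W := by
  unfold expand
  rw [if_pos (Finset.mem_insert_self _ _), Finset.insert_union, Finset.sdiff_union_of_subset hA,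
    Finset.insert_eq_self.2 (hA ha)]

lemma sum_update_expand (ha : a ∈ A) (hB : B ⊆ insert a (W \ A)) (f : α → ℤ) :
    ∑ v ∈ B, Function.update f a (∑ v ∈ A, f v) v = ∑ v ∈ expand A a B, f v := by
  by_cases hb : a ∈ B
  · have hd : Disjoint A (B.erase a) := by
      rw [Finset.disjoint_left]
      intro v hv hvB
      rw [Finset.mem_erase] at hvB
      rcases Finset.mem_insert.1 (hB hvB.2) with h | h
      · exact hvB.1 h
      · exact (Finset.mem_sdiff.1 h).2 hv
    have h1 : expand A a B = A ∪ B.erase a := by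
      unfold expand; rw [if_pos hb]
      ext v
      by_cases hva : v = a
      · subst hva; simp [ha]
      · simp [hva, or_comm]
    rw [h1, Finset.sum_union hd, ← Finset.add_sum_erase B _ hb, Function.update_self]
    congr 1
    exact Finset.sum_congr rfl fun v hv => Function.update_of_ne (Finset.mem_erase.1 hv).1 _ _
  · unfold expand; rw [if_neg hb]
    refine Finset.sum_congr rfl fun v hv => Function.update_of_ne ?_ _ _
    rintro rfl; exact hb hv

variable {ι : Type*} {E : Finset ι} {s t : ι → α}

lemma crosses_collapse (hB : B ⊆ insert a (W \ A)) (e : ι) :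
    crosses (collapse A a ∘ s) (collapse A a ∘ t) B e = crosses s t (expand A a B) e := by
  unfold crosses
  simp only [Function.comp, collapse_mem_iff hB]

lemma cutE_collapse (hB : B ⊆ insert a (W \ A)) :
    cutE E (collapse A a ∘ s) (collapse A a ∘ t) B = cutE E s t (expand A a B) :=
  Finset.sum_congr rfl fun e _ => crosses_collapse hB e

lemma collapse_eq_iff (ha : a ∈ A) {v w : α} (hv : v ∉ A) : collapse A a w = v ↔ w = v := by
  unfold collapse
  split_ifs with h
  · constructor
    · rintro rfl; exact absurd ha hv
    · rintro rfl; exact absurd h hv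
  · rfl

lemma inc_collapse (ha : a ∈ A) {v : α} (hv : v ∉ A) (e : ι) :
    inc (collapse A a ∘ s) (collapse A a ∘ t) e v = inc s t e v := by
  unfold inc
  simp only [Function.comp, collapse_eq_iff ha hv]

lemma inc_eq_zero {e : ι} {v : α} (h1 : s e ≠ v) (h2 : t e ≠ v) : inc s t e v = 0 := by
  simp [inc, h1, h2]

/-- The edges with both ends in `A`. -/
def inside (E : Finset ι) (s t : ι → α) (A : Finset α) : Finset ι :=
  E.filter fun e => s e ∈ A ∧ t e ∈ A

/-- The number of arcs at `v` that cross `A` and are directed into `v`. -/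
def inArcs (E : Finset ι) (s t : ι → α) (A : Finset α) (σ : ι → ℤ) (v : α) : ℤ :=
  ∑ e ∈ E, crosses s t A e * max (-(σ e * inc s t e v)) 0

/-- The number of arcs at `v` that cross `A` and are directed out of `v`. -/
def outArcs (E : Finset ι) (s t : ι → α) (A : Finset α) (σ : ι → ℤ) (v : α) : ℤ :=
  ∑ e ∈ E, crosses s t A e * max (σ e * inc s t e v) 0

/-- Combine an orientation of the edges inside `A` with one of all other edges. -/
def glue (s t : ι → α) (A : Finset α) (σ τ : ι → ℤ) (e : ι) : ℤ :=
  if s e ∈ A ∧ t e ∈ A then τ e else σ e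

lemma IsSign.glue {σ τ : ι → ℤ} (hσ : IsSign σ) (hτ : IsSign τ) :
    IsSign (ModOrient.glue s t A σ τ) := by
  intro e; unfold ModOrient.glue; split_ifs
  · exact hτ e
  · exact hσ e

lemma inArcs_nonneg (σ : ι → ℤ) (v : α) : 0 ≤ inArcs E s t A σ v :=
  Finset.sum_nonneg fun _ _ => mul_nonneg (crosses_nonneg _ _ _ _) (le_max_right _ _)

lemma outArcs_nonneg (σ : ι → ℤ) (v : α) : 0 ≤ outArcs E s t A σ v :=
  Finset.sum_nonneg fun _ _ => mul_nonneg (crosses_nonneg _ _ _ _) (le_max_right _ _)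

lemma outArcs_sub_inArcs (σ : ι → ℤ) (v : α) :
    outArcs E s t A σ v - inArcs E s t A σ v =
      ∑ e ∈ E, crosses s t A e * (σ e * inc s t e v) := by
  unfold outArcs inArcs
  rw [← Finset.sum_sub_distrib]
  refine Finset.sum_congr rfl fun e _ => ?_
  rw [← mul_sub]
  congr 1
  rcases le_total 0 (σ e * inc s t e v) with h | h
  · rw [max_eq_left h, max_eq_right (by linarith)]; ring
  · rw [max_eq_right h, max_eq_left (by linarith)]; ring

lemma inArcs_add_outArcs {σ : ι → ℤ} (hσ : IsSign σ) (v : α) :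
    inArcs E s t A σ v + outArcs E s t A σ v =
      ∑ e ∈ E, crosses s t A e * crosses s t {v} e := by
  unfold outArcs inArcs
  rw [← Finset.sum_add_distrib]
  refine Finset.sum_congr rfl fun e _ => ?_
  rw [← mul_add, crosses_singleton]
  congr 1
  have h1 : |σ e * inc s t e v| = |inc s t e v| := by rw [abs_mul, hσ.abs_eq, one_mul]
  rw [← h1]
  rcases le_total 0 (σ e * inc s t e v) with h | h
  · rw [max_eq_left h, max_eq_right (by linarith), abs_of_nonneg h]; ring
  · rw [max_eq_right h, max_eq_left (by linarith), abs_of_nonpos h]; ring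

/-- An edge that leaves `A` is no loop and has only one end in `A`, so inside `B` it is counted at
most once. -/
lemma sum_crosses_singleton {e : ι} (hBA : B ⊆ A) (h : crosses s t A e = 1) :
    ∑ v ∈ B, crosses s t {v} e = crosses s t B e := by
  rw [crosses_eq_one] at h
  have hne : s e ≠ t e := fun h' => h (by rw [h'])
  have : ∀ v, crosses s t {v} e = (if s e = v then 1 else 0) + (if t e = v then 1 else 0) := by
    intro v
    unfold crosses
    by_cases h1 : s e = v <;> by_cases h2 : t e = v <;> simp [h1, h2]
    exact hne (h1.trans h2.symm)
  simp only [this, Finset.sum_add_distrib, Finset.sum_ite_eq]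
  unfold crosses
  by_cases h1 : s e ∈ B <;> by_cases h2 : t e ∈ B <;> simp [h1, h2]
  exact h (by simp [hBA h1, hBA h2])

/-- Replacing the edges leaving `A` by root arcs does not change the size of cuts in `A`. -/
lemma cutE_inside_add (hBA : B ⊆ A) {σ : ι → ℤ} (hσ : IsSign σ) :
    cutE (inside E s t A) s t B + ∑ v ∈ B, (inArcs E s t A σ v + outArcs E s t A σ v) =
      cutE E s t B := by
  simp only [inArcs_add_outArcs hσ]
  rw [Finset.sum_comm]
  unfold cutE inside
  rw [Finset.sum_filter, ← Finset.sum_add_distrib]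
  refine Finset.sum_congr rfl fun e _ => ?_
  rw [← Finset.mul_sum]
  by_cases h : crosses s t A e = 1
  · rw [sum_crosses_singleton hBA h, h, one_mul, if_neg, zero_add]
    rintro ⟨h1, h2⟩
    exact (crosses_eq_one.1 h) (by simp [h1, h2])
  · have h0 : crosses s t A e = 0 := by
      unfold crosses at h ⊢; split_ifs at h ⊢ <;> simp_all
    rw [h0, zero_mul, add_zero]
    split_ifs with h2
    · rfl
    · have h3 := crosses_eq_zero.1 h0
      symm; rw [crosses_eq_zero]
      have h4 : s e ∉ A := fun h4 => h2 ⟨h4, h3.1 h4⟩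
      have h5 : t e ∉ A := fun h5 => h2 ⟨h3.2 h5, h5⟩
      exact ⟨fun h => absurd (hBA h) h4, fun h => absurd (hBA h) h5⟩

lemma net_glue_of_mem {σ τ : ι → ℤ} {v : α} (hv : v ∈ A) :
    net E s t (glue s t A σ τ) v =
      net (inside E s t A) s t τ v + (outArcs E s t A σ v - inArcs E s t A σ v) := by
  rw [outArcs_sub_inArcs]
  unfold net inside
  rw [Finset.sum_filter, ← Finset.sum_add_distrib]
  refine Finset.sum_congr rfl fun e _ => ?_
  unfold glue crosses
  by_cases h1 : s e ∈ A <;> by_cases h2 : t e ∈ A <;> simp [h1, h2]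
  -- Both ends lie outside `A`, so the edge does not meet `v`.
  right
  exact inc_eq_zero (fun h => h1 (h ▸ hv)) (fun h => h2 (h ▸ hv))

lemma net_glue_of_notMem (ha : a ∈ A) {σ τ : ι → ℤ} {v : α} (hv : v ∉ A) :
    net E s t (glue s t A σ τ) v = net E (collapse A a ∘ s) (collapse A a ∘ t) σ v := by
  unfold net
  refine Finset.sum_congr rfl fun e _ => ?_
  rw [inc_collapse ha hv]
  unfold glue
  split_ifs with h
  · rw [inc_eq_zero (fun h' : s e = v => hv (h' ▸ h.1)) (fun h' : t e = v => hv (h' ▸ h.2))]; simp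
  · rfl

/-- The edges leaving `A` are those at the contracted vertex `a`, and edges inside `A` become loops
there, which contribute nothing. -/
lemma sum_outArcs_sub_inArcs (ha : a ∈ A) (σ : ι → ℤ) :
    ∑ v ∈ A, (outArcs E s t A σ v - inArcs E s t A σ v) =
      net E (collapse A a ∘ s) (collapse A a ∘ t) σ a := by
  simp only [outArcs_sub_inArcs]
  rw [Finset.sum_comm]
  unfold net
  refine Finset.sum_congr rfl fun e _ => ?_
  rw [← Finset.mul_sum, ← Finset.mul_sum, sum_inc]
  have : ∀ w, collapse A a w = a ↔ w ∈ A := by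
    intro w; unfold collapse; split_ifs with h
    · simp [h]
    · simp only [h, iff_false]; rintro rfl; exact h ha
  unfold inc crosses
  simp only [Function.comp, this]
  by_cases h1 : s e ∈ A <;> by_cases h2 : t e ∈ A <;> simp [h1, h2]

end Contract

/-! ### Rooted instances, their contractions and restrictions. -/

/-- A multigraph on the vertex set `W` with edge set `E`, together with a root outside `W` that
sends `p v` arcs to and receives `q v` arcs from the vertex `v`, and a demand `b`. -/
structure Rooted (α ι : Type*) where
  W : Finset α
  E : Finset ι
  s : ι → α
  t : ι → α
  p : α → ℤ
  q : α → ℤ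
  b : α → ℤ

namespace Rooted
variable {α ι : Type*} [DecidableEq α]

/-- The number of edges and arcs leaving `A`. -/
def cut (I : Rooted α ι) (A : Finset α) : ℤ := cutE I.E I.s I.t A + ∑ v ∈ A, (I.p v + I.q v)

/-- The total demand on `A`. -/
def dem (I : Rooted α ι) (A : Finset α) : ℤ := ∑ v ∈ A, I.b v

/-- Out-degree minus in-degree at `v`. -/
def excess (I : Rooted α ι) (σ : ι → ℤ) (v : α) : ℤ := net I.E I.s I.t σ v + I.q v - I.p v

/-- The measure for the induction. -/
def size (k : ℤ) (I : Rooted α ι) : ℤ :=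
  (k + 2) * (I.W.card + I.E.card) + ∑ v ∈ I.W, (I.p v + I.q v)

/-- There is an orientation whose excesses agree with the demand modulo `2 * k`, and are less than
`2 * k` in absolute value. -/
def Solvable (k : ℤ) (I : Rooted α ι) : Prop :=
  ∃ σ, IsSign σ ∧ ∀ v ∈ I.W, 2 * k ∣ I.excess σ v - I.b v ∧ |I.excess σ v| ≤ 2 * k - 1

/-- The conditions of Lovász, Thomassen, Wu and Zhang; the vertex `x`, if any, is exempt from the
cut condition. -/
structure Adm (k : ℤ) (I : Rooted α ι) (x : Option α) : Prop where
  nonempty : I.W.Nonempty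
  ends : ∀ e ∈ I.E, I.s e ∈ I.W ∧ I.t e ∈ I.W
  p_nonneg : ∀ v ∈ I.W, 0 ≤ I.p v
  q_nonneg : ∀ v ∈ I.W, 0 ≤ I.q v
  parity : ∀ A ⊆ I.W, 2 ∣ I.cut A - I.dem A
  total : 2 * k ∣ I.dem I.W + ∑ v ∈ I.W, I.p v - ∑ v ∈ I.W, I.q v
  root : I.cut I.W ≤ 2 * (k - 1) + nrm k (I.dem I.W)
  cuts : ∀ A ⊆ I.W, A.Nonempty → A ≠ I.W → (∀ z, x = some z → A ≠ {z}) →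
    2 * (k - 1) + nrm k (I.dem A) ≤ I.cut A
  exempt : ∀ z, x = some z → z ∈ I.W ∧ 2 * k ∣ I.b z ∧ |I.p z - I.q z| ≤ cutE I.E I.s I.t {z}

/-- Contract `A` to its vertex `a`. -/
def contract (I : Rooted α ι) (A : Finset α) (a : α) : Rooted α ι where
  W := insert a (I.W \ A)
  E := I.E
  s := collapse A a ∘ I.s
  t := collapse A a ∘ I.t
  p := Function.update I.p a (∑ v ∈ A, I.p v)
  q := Function.update I.q a (∑ v ∈ A, I.q v)
  b := Function.update I.b a (∑ v ∈ A, I.b v)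

/-- Contract the complement of `A` into the root, according to the orientation `σ`. -/
def restrict (I : Rooted α ι) (A : Finset α) (σ : ι → ℤ) : Rooted α ι where
  W := A
  E := inside I.E I.s I.t A
  s := I.s
  t := I.t
  p v := I.p v + inArcs I.E I.s I.t A σ v
  q v := I.q v + outArcs I.E I.s I.t A σ v
  b := I.b

variable {I : Rooted α ι} {A B : Finset α} {a : α} {σ τ : ι → ℤ} {k : ℤ}

lemma cut_contract (ha : a ∈ A) (hB : B ⊆ insert a (I.W \ A)) :
    (I.contract A a).cut B = I.cut (expand A a B) := by
  unfold cut contract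
  simp only [Finset.sum_add_distrib, sum_update_expand ha hB, cutE_collapse hB]

lemma dem_contract (ha : a ∈ A) (hB : B ⊆ insert a (I.W \ A)) :
    (I.contract A a).dem B = I.dem (expand A a B) :=
  sum_update_expand ha hB _

lemma cut_restrict (hB : B ⊆ A) (hσ : IsSign σ) : (I.restrict A σ).cut B = I.cut B := by
  have := cutE_inside_add (E := I.E) (s := I.s) (t := I.t) hB hσ
  unfold cut restrict
  simp only [Finset.sum_add_distrib] at this ⊢
  linarith

lemma excess_glue_of_mem {v : α} (hv : v ∈ A) :
    I.excess (glue I.s I.t A σ τ) v = (I.restrict A σ).excess τ v := by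
  unfold excess restrict
  rw [net_glue_of_mem hv]; ring

lemma excess_glue_of_notMem (ha : a ∈ A) {v : α} (hv : v ∉ A) :
    I.excess (glue I.s I.t A σ τ) v = (I.contract A a).excess σ v := by
  have hva : v ≠ a := by rintro rfl; exact hv ha
  unfold excess contract
  simp only
  rw [net_glue_of_notMem ha hv, Function.update_of_ne hva, Function.update_of_ne hva]

/-- Turns the congruence met at the contracted vertex into the condition `total` for the
restriction. -/
lemma sum_restrict (ha : a ∈ A) :
    ∑ v ∈ A, (I.restrict A σ).q v - ∑ v ∈ A, (I.restrict A σ).p v =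
      (I.contract A a).excess σ a := by
  have := sum_outArcs_sub_inArcs (E := I.E) (s := I.s) (t := I.t) ha σ
  unfold excess contract restrict
  simp only [Function.update_self, Finset.sum_add_distrib, Finset.sum_sub_distrib] at this ⊢
  linarith

lemma contract_ends (hI : ∀ e ∈ I.E, I.s e ∈ I.W ∧ I.t e ∈ I.W) :
    ∀ e ∈ (I.contract A a).E, (I.contract A a).s e ∈ (I.contract A a).W ∧
      (I.contract A a).t e ∈ (I.contract A a).W :=
  fun e he => ⟨collapse_mem_insert (hI e he).1, collapse_mem_insert (hI e he).2⟩

lemma card_contract (hA : A ⊆ I.W) (h2 : 2 ≤ A.card) :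
    (I.contract A a).W.card < I.W.card := by
  have h1 := Finset.card_sdiff_add_card_eq_card hA
  have h3 : (I.contract A a).W.card ≤ (I.W \ A).card + 1 := Finset.card_insert_le _ _
  omega

/-- Cuts of the contraction are cuts of the original, so all conditions are inherited. The exempt
vertex stays exempt unless `A` swallows it; then nothing is exempt. -/
lemma Adm.contract {x : Option α} (hI : I.Adm k x) (hA : A ⊆ I.W) (ha : a ∈ A) (h2 : 2 ≤ A.card) :
    ∃ y, (I.contract A a).Adm k y := by
  have hcutW : (I.contract A a).cut (I.contract A a).W = I.cut I.W := by
    refine (cut_contract (I := I) ha Finset.Subset.rfl).trans ?_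
    exact congrArg _ (expand_insert hA ha)
  have hsum : ∀ f : α → ℤ, ∑ v ∈ insert a (I.W \ A), Function.update f a (∑ v ∈ A, f v) v =
      ∑ v ∈ I.W, f v := fun f => by
    rw [sum_update_expand ha Finset.Subset.rfl, expand_insert hA ha]
  have hdemW : (I.contract A a).dem (I.contract A a).W = I.dem I.W := hsum _
  have hnn : ∀ f : α → ℤ, (∀ v ∈ I.W, 0 ≤ f v) → ∀ v ∈ insert a (I.W \ A),
      0 ≤ Function.update f a (∑ v ∈ A, f v) v := by
    intro f hf v hv
    by_cases hva : v = a
    · subst hva; rw [Function.update_self]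
      exact Finset.sum_nonneg fun w hw => hf w (hA hw)
    · rw [Function.update_of_ne hva]
      rcases Finset.mem_insert.1 hv with h | h
      · exact absurd h hva
      · exact hf v (Finset.mem_sdiff.1 h).1
  refine ⟨x.filter (fun z => z ∉ A), ⟨a, Finset.mem_insert_self _ _⟩, contract_ends hI.ends,
    hnn _ hI.p_nonneg, hnn _ hI.q_nonneg, ?_, ?_, ?_, ?_, ?_⟩
  · intro B hB
    rw [cut_contract ha hB, dem_contract ha hB]
    exact hI.parity _ (expand_subset hA ha hB)
  · rw [hdemW]
    have := hI.total
    rw [← hsum I.p, ← hsum I.q] at this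
    exact this
  · rw [hcutW, hdemW]; exact hI.root
  · intro B hB hBne hBW hBz
    rw [cut_contract ha hB, dem_contract ha hB]
    refine hI.cuts _ (expand_subset hA ha hB) (expand_nonempty hBne) (expand_ne hA ha hB hBW) ?_
    intro z hz hBz'
    -- If `a ∈ B`, the preimage contains `A` and is too large to be the exempt singleton.
    by_cases haB : a ∈ B
    · have : A.card ≤ 1 := by
        rw [← Finset.card_singleton z, ← hBz']
        refine Finset.card_le_card ?_
        unfold expand; rw [if_pos haB]; exact Finset.subset_union_right
      omega
    · unfold expand at hBz'; rw [if_neg haB] at hBz'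
      refine hBz z ?_ hBz'
      subst hz
      rw [Option.filter_some, if_pos]
      have hzB : z ∈ B := by rw [hBz']; exact Finset.mem_singleton_self z
      have hza : z ≠ a := by rintro rfl; exact haB hzB
      rcases Finset.mem_insert.1 (hB hzB) with h | h
      · exact absurd h hza
      · simpa using (Finset.mem_sdiff.1 h).2
  · intro z hz
    obtain ⟨hz, hzA⟩ := Option.filter_eq_some_iff.1 hz
    have hzA : z ∉ A := by simpa using hzA
    have hza : z ≠ a := by rintro rfl; exact hzA ha
    obtain ⟨h1, h2, h3⟩ := hI.exempt z hz
    have hzW : z ∈ insert a (I.W \ A) := by simp [h1, hzA]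
    refine ⟨hzW, ?_, ?_⟩
    · simpa [Rooted.contract, Function.update_of_ne hza] using h2
    · have hz' : ({z} : Finset α) ⊆ insert a (I.W \ A) := Finset.singleton_subset_iff.2 hzW
      have he : expand A a {z} = {z} := by
        unfold expand; rw [if_neg]; simpa using hza.symm
      simp only [Rooted.contract, Function.update_of_ne hza]
      rw [cutE_collapse hz', he]
      exact h3

lemma card_inside_add (E : Finset ι) (s t : ι → α) (A : Finset α) :
    ((inside E s t A).card : ℤ) + cutE E s t A ≤ E.card := by
  unfold inside cutE
  rw [Finset.card_filter, Finset.card_eq_sum_ones]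
  push_cast
  rw [← Finset.sum_add_distrib]
  refine Finset.sum_le_sum fun e _ => ?_
  unfold crosses
  by_cases h1 : s e ∈ A <;> by_cases h2 : t e ∈ A <;> simp [h1, h2]

lemma cutE_inside (E : Finset ι) (s t : ι → α) (A : Finset α) : cutE (inside E s t A) s t A = 0 :=
  cutE_univ fun _ he => (Finset.mem_filter.1 he).2

/-- Cuts within `A` do not change when the outside is merged into the root. The upper bound on the
cut of `A` becomes the root condition. -/
lemma Adm.restrict {x : Option α} (hI : I.Adm k x) (hA : A ⊆ I.W) (ha : a ∈ A)
    (h2 : 2 ≤ A.card) (hA' : I.cut A ≤ 2 * (k - 1) + nrm k (I.dem A))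
    (hσ : IsSign σ)
    (hσa : 2 * k ∣ (I.contract A a).excess σ a - (I.contract A a).b a) :
    ∃ y, (I.restrict A σ).Adm k y := by
  have hdem : ∀ B, (I.restrict A σ).dem B = I.dem B := fun B => rfl
  refine ⟨x.filter (fun z => z ∈ A), ⟨a, ha⟩, ?_, ?_, ?_, ?_, ?_, ?_, ?_, ?_⟩
  · intro e he; exact (Finset.mem_filter.1 he).2
  · intro v hv; exact add_nonneg (hI.p_nonneg v (hA hv)) (inArcs_nonneg _ _)
  · intro v hv; exact add_nonneg (hI.q_nonneg v (hA hv)) (outArcs_nonneg _ _)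
  · intro B hB
    rw [cut_restrict (I := I) (A := A) hB hσ]; exact hI.parity B (hB.trans hA)
  · have h3 : (I.contract A a).b a = I.dem A := by simp [Rooted.contract, dem]
    rw [← sum_restrict ha, h3] at hσa
    change 2 * k ∣ I.dem A + ∑ v ∈ A, _ - ∑ v ∈ A, _
    rw [← dvd_neg] at hσa
    exact dvd_of_dvd_eq hσa (by ring)
  · change (I.restrict A σ).cut A ≤ _
    rw [cut_restrict Finset.Subset.rfl hσ]; exact hA'
  · intro B hB hBne hBA hBz
    rw [cut_restrict (I := I) (A := A) hB hσ]
    refine hI.cuts B (hB.trans hA) hBne ?_ ?_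
    · rintro rfl; exact hBA (Finset.Subset.antisymm hB hA)
    · rintro z hz rfl
      refine hBz z ?_ rfl
      subst hz
      rw [Option.filter_some, if_pos]
      simpa using (show z ∈ A from hB (Finset.mem_singleton_self z))
  · intro z hz
    obtain ⟨hz, hzA⟩ := Option.filter_eq_some_iff.1 hz
    have hzA : z ∈ A := by simpa using hzA
    obtain ⟨h1, h3, -⟩ := hI.exempt z hz
    refine ⟨hzA, h3, ?_⟩
    -- As `z` has zero demand, `A` and `A.erase z` have the same norm. The lower bound for `A.erase
    -- z` against the upper bound for `A` shows that `z` has at most as many arcs as edges in the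
    -- restriction, whatever their directions.
    have hc1 := hI.cuts (A.erase z) ((Finset.erase_subset _ _).trans hA) (by
      rw [← Finset.card_pos, Finset.card_erase_of_mem hzA]; omega)
      (fun h => Finset.notMem_erase z A (h ▸ h1)) (by
        rintro w hw h
        rw [hz, Option.some_inj] at hw
        have := Finset.notMem_erase z A
        rw [h, hw] at this
        exact this (Finset.mem_singleton_self w))
    have hdz : I.dem A = I.b z + I.dem (A.erase z) := (Finset.add_sum_erase A _ hzA).symm
    have hn : nrm k (I.dem (A.erase z)) = nrm k (I.dem A) := by
      apply nrm_congr
      rw [hdz]; exact dvd_of_dvd_eq ((dvd_neg).2 h3) (by ring)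
    have hz' : ({z} : Finset α) ⊆ A := Finset.singleton_subset_iff.2 hzA
    have c1 := cut_restrict (I := I) (Finset.erase_subset z A) hσ
    have c2 := cut_restrict (I := I) (Finset.Subset.refl A) hσ
    have hin : ∀ e ∈ (I.restrict A σ).E, (I.restrict A σ).s e ∈ A ∧ (I.restrict A σ).t e ∈ A :=
      fun e he => (Finset.mem_filter.1 he).2
    have c3 := cutE_compl hin {z}
    rw [Finset.sdiff_singleton_eq_erase] at c3
    have c4 := cutE_univ hin
    have c5 := Finset.add_sum_erase A (fun v => (I.restrict A σ).p v + (I.restrict A σ).q v) hzA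
    unfold cut at c1 c2
    rw [c3] at c1
    rw [c4] at c2
    have c6 : 0 ≤ (I.restrict A σ).p z :=
      add_nonneg (hI.p_nonneg z h1) (inArcs_nonneg _ _)
    have c7 : 0 ≤ (I.restrict A σ).q z :=
      add_nonneg (hI.q_nonneg z h1) (outArcs_nonneg _ _)
    rw [hn] at hc1
    unfold cut at hc1 hA'
    rw [abs_le]
    constructor <;> linarith

lemma size_contract (hk : 2 ≤ k) (hA : A ⊆ I.W) (ha : a ∈ A) (h2 : 2 ≤ A.card) :
    (I.contract A a).size k + (k + 2) ≤ I.size k := by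
  have h := card_contract (a := a) hA h2
  have h' : ∑ v ∈ (I.contract A a).W, ((I.contract A a).p v + (I.contract A a).q v) =
      ∑ v ∈ I.W, (I.p v + I.q v) := by
    unfold contract
    simp only [Finset.sum_add_distrib]
    rw [sum_update_expand ha Finset.Subset.rfl, sum_update_expand ha Finset.Subset.rfl,
      expand_insert hA ha]
  unfold size
  rw [h']
  have h3 : (I.contract A a).E = I.E := rfl
  rw [h3]
  have h4 : ((I.contract A a).W.card : ℤ) + 1 ≤ I.W.card := by exact_mod_cast h
  nlinarith

/-- At least one vertex disappears, and each edge leaving `A`, of weight `k + 2`, is replaced by an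
arc of weight one. -/
lemma Adm.size_restrict {x : Option α} (hk : 2 ≤ k) (hI : I.Adm k x) (hA : A ⊆ I.W)
    (hne : A ≠ I.W) (hσ : IsSign σ) : (I.restrict A σ).size k + (k + 2) ≤ I.size k := by
  have h := Finset.card_lt_card (hA.ssubset_of_ne hne)
  have h1 : ((A.card : ℤ)) + 1 ≤ I.W.card := by exact_mod_cast h
  have h2 := card_inside_add I.E I.s I.t A
  have h3 := cut_restrict (I := I) (Finset.Subset.refl A) hσ
  have h4 : cutE (I.restrict A σ).E (I.restrict A σ).s (I.restrict A σ).t A = 0 :=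
    cutE_inside _ _ _ _
  have h5 : ∑ v ∈ A, (I.p v + I.q v) ≤ ∑ v ∈ I.W, (I.p v + I.q v) :=
    Finset.sum_le_sum_of_subset_of_nonneg hA
      fun v hv _ => add_nonneg (hI.p_nonneg v hv) (hI.q_nonneg v hv)
  unfold cut at h3
  unfold size
  change (k + 2) * ((A.card : ℤ) + (inside I.E I.s I.t A).card) +
    ∑ v ∈ A, ((I.restrict A σ).p v + (I.restrict A σ).q v) + (k + 2) ≤ _
  have h6 := cutE_nonneg I.E I.s I.t A
  nlinarith

/-- Contracting a tight set reduces to two smaller instances. -/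
lemma Adm.solvable_of_tight {n : ℤ} {x : Option α} (hk : 2 ≤ k)
    (IH : ∀ (J : Rooted α ι) y, J.Adm k y → J.size k < n → J.Solvable k)
    (hI : I.Adm k x) (hn : I.size k < n + (k + 2)) (hA : A ⊆ I.W) (h2 : 2 ≤ A.card)
    (hne : A ≠ I.W) (hA' : I.cut A ≤ 2 * (k - 1) + nrm k (I.dem A)) : I.Solvable k := by
  obtain ⟨a, ha⟩ := Finset.card_pos.1 (by omega : 0 < A.card)
  obtain ⟨y, hy⟩ := hI.contract hA ha h2
  obtain ⟨σ, hσ, h⟩ := IH _ y hy (by linarith [size_contract hk hA ha h2])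
  obtain ⟨y', hy'⟩ := hI.restrict hA ha h2 hA' hσ (h a (Finset.mem_insert_self _ _)).1
  obtain ⟨τ, hτ, h'⟩ := IH _ y' hy' (by linarith [hI.size_restrict hk hA hne hσ])
  refine ⟨glue I.s I.t A σ τ, hσ.glue hτ, fun v hv => ?_⟩
  by_cases hvA : v ∈ A
  · rw [excess_glue_of_mem hvA]; exact h' v hvA
  · rw [excess_glue_of_notMem ha hvA]
    have hva : v ≠ a := by rintro rfl; exact hvA ha
    have := h v (Finset.mem_insert_of_mem (Finset.mem_sdiff.2 ⟨hv, hvA⟩))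
    have hb : (I.contract A a).b v = I.b v := Function.update_of_ne hva _ _
    rwa [hb] at this

end Rooted

/-- Only `N = 2 * k - 1` could fail, and then `b` would be zero modulo `2 * k`. So the bound on the
excess survives a unit step back to a nonzero demand. -/
lemma abs_add_one_le {k N b : ℤ} (hN : |N| ≤ 2 * k - 1) (h : 2 * k ∣ N - (b - 1))
    (hb : b % (2 * k) ≠ 0) : |N + 1| ≤ 2 * k - 1 := by
  rw [abs_le] at hN ⊢
  by_contra hc
  have hN' : N = 2 * k - 1 := by omega
  apply hb
  apply Int.emod_eq_zero_of_dvd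
  subst hN'
  exact dvd_of_dvd_eq (dvd_sub (dvd_refl (2 * k)) h) (by ring)

lemma abs_sub_one_le {k N b : ℤ} (hN : |N| ≤ 2 * k - 1) (h : 2 * k ∣ N - (b + 1))
    (hb : b % (2 * k) ≠ 0) : |N - 1| ≤ 2 * k - 1 := by
  rw [abs_le] at hN ⊢
  by_contra hc
  have hN' : N = -(2 * k - 1) := by omega
  apply hb
  apply Int.emod_eq_zero_of_dvd
  subst hN'
  exact dvd_of_dvd_eq (dvd_sub ((dvd_neg).2 (dvd_refl (2 * k))) h) (by ring)

/-! ### Edges with named ends. -/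

section Joins
variable {α ι : Type*} [DecidableEq α]

/-- The edge `e` has the ends `u` and `v`. -/
def Joins (s t : ι → α) (e : ι) (u v : α) : Prop := (s e = u ∧ t e = v) ∨ (s e = v ∧ t e = u)

variable {s t : ι → α} {e : ι} {u v : α}

lemma Joins.symm (h : Joins s t e u v) : Joins s t e v u := Or.symm h

lemma Joins.crosses_eq (h : Joins s t e u v) (A : Finset α) :
    crosses s t A e = if (u ∈ A ↔ v ∈ A) then 0 else 1 := by
  rcases h with ⟨rfl, rfl⟩ | ⟨rfl, rfl⟩
  · rfl
  · unfold crosses; simp only [Iff.comm]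

/-- An edge can be directed from `u` to `v`. -/
lemma Joins.exists_sign (h : Joins s t e u v) : ∃ ε : ℤ, (ε = 1 ∨ ε = -1) ∧
    ∀ w, ε * inc s t e w = (if w = u then 1 else 0) - (if w = v then 1 else 0) := by
  rcases h with ⟨rfl, rfl⟩ | ⟨rfl, rfl⟩
  · exact ⟨1, Or.inl rfl, fun w => by unfold inc; simp only [eq_comm, one_mul]⟩
  · exact ⟨-1, Or.inr rfl, fun w => by unfold inc; simp only [eq_comm (a := w)]; ring⟩

lemma joins_of_crosses {A : Finset α} (h : ¬ (s e ∈ A ↔ t e ∈ A)) :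
    ∃ u v, Joins s t e u v ∧ u ∈ A ∧ v ∉ A := by
  by_cases h1 : s e ∈ A
  · exact ⟨_, _, Or.inl ⟨rfl, rfl⟩, h1, fun h2 => h (by simp [h1, h2])⟩
  · exact ⟨_, _, Or.inr ⟨rfl, rfl⟩, by_contra fun h2 => h (by simp [h1, h2]), h1⟩

lemma Joins.mem {E : Finset ι} {W : Finset α} (h : Joins s t e u v)
    (hE : ∀ e ∈ E, s e ∈ W ∧ t e ∈ W) (he : e ∈ E) : u ∈ W ∧ v ∈ W := by
  rcases h with ⟨rfl, rfl⟩ | ⟨rfl, rfl⟩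
  · exact hE e he
  · exact (hE e he).symm

lemma net_update [DecidableEq ι] {E : Finset ι} (he : e ∈ E) (σ : ι → ℤ) (c : ℤ) (w : α) :
    net E s t (Function.update σ e c) w = net (E.erase e) s t σ w + c * inc s t e w := by
  unfold net
  rw [← Finset.sum_erase_add E _ he, Function.update_self]
  congr 1
  exact Finset.sum_congr rfl fun f hf => by rw [Function.update_of_ne (Finset.ne_of_mem_erase hf)]

lemma IsSign.update [DecidableEq ι] {σ : ι → ℤ} (hσ : IsSign σ) {c : ℤ} (hc : c = 1 ∨ c = -1) :
    IsSign (Function.update σ e c) := by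
  intro f
  by_cases h : f = e
  · subst h; rw [Function.update_self]; exact hc
  · rw [Function.update_of_ne h]; exact hσ f

end Joins

/-! ### Reductions when no vertex is exempt. -/

namespace Rooted
variable {α ι : Type*} [DecidableEq α] {I J : Rooted α ι} {k : ℤ} {x y : Option α}

/-- No proper set of at least two vertices is tight. -/
def Slack (k : ℤ) (I : Rooted α ι) : Prop :=
  ∀ A ⊆ I.W, 2 ≤ A.card → A ≠ I.W → 2 * (k - 1) + nrm k (I.dem A) + 2 ≤ I.cut A

/-- The gap between a cut and its bound is even, so a positive gap is at least two. -/
lemma Adm.slack (hI : I.Adm k x)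
    (h : ¬ ∃ A ⊆ I.W, 2 ≤ A.card ∧ A ≠ I.W ∧ I.cut A ≤ 2 * (k - 1) + nrm k (I.dem A)) :
    I.Slack k := by
  intro A hA h2 hne
  push Not at h
  have h3 := h A hA h2 hne
  have h4 := hI.parity A hA
  have h5 := nrm_parity k (I.dem A)
  omega

/-- A change that costs each cut at most its slack preserves the cut conditions. -/
lemma Adm.modify (hk : 2 ≤ k) (hI : I.Adm k x) (hS : I.Slack k) (hW : J.W = I.W)
    (ends : ∀ e ∈ J.E, J.s e ∈ J.W ∧ J.t e ∈ J.W)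
    (p_nonneg : ∀ v ∈ J.W, 0 ≤ J.p v) (q_nonneg : ∀ v ∈ J.W, 0 ≤ J.q v)
    (hpar : ∀ A ⊆ I.W, 2 ∣ (J.cut A - I.cut A) - (J.dem A - I.dem A))
    (total : 2 * k ∣ J.dem J.W + ∑ v ∈ J.W, J.p v - ∑ v ∈ J.W, J.q v)
    (root : J.cut J.W ≤ 2 * (k - 1) + nrm k (J.dem J.W))
    (hcut : ∀ A ⊆ I.W, 2 ≤ A.card → A ≠ I.W → |J.dem A - I.dem A| ≤ J.cut A - I.cut A + 2)
    (hsingle : ∀ v ∈ I.W, I.W ≠ {v} → y ≠ some v →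
      2 * (k - 1) + nrm k (J.dem {v}) ≤ J.cut {v})
    (hex : ∀ z, y = some z → z ∈ J.W ∧ 2 * k ∣ J.b z ∧
      |J.p z - J.q z| ≤ cutE J.E J.s J.t {z}) :
    J.Adm k y where
  nonempty := hW ▸ hI.nonempty
  ends := ends
  p_nonneg := p_nonneg
  q_nonneg := q_nonneg
  parity A hA := by
    rw [hW] at hA
    exact dvd_of_dvd_eq (dvd_add (hpar A hA) (hI.parity A hA)) (by ring)
  total := total
  root := root
  cuts A hA hne hAW hz := by
    rw [hW] at hA hAW
    by_cases h2 : 2 ≤ A.card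
    · have h3 := hS A hA h2 hAW
      have h4 := hcut A hA h2 hAW
      have h5 := nrm_add_le_abs hk (I.dem A) (J.dem A - I.dem A)
      rw [add_sub_cancel] at h5
      linarith
    · obtain ⟨v, rfl⟩ := Finset.card_eq_one.1 (by have := hne.card_pos; omega : A.card = 1)
      exact hsingle v (hA (Finset.mem_singleton_self v)) (fun h => hAW h.symm)
        (fun h => hz v h rfl)
  exempt := hex

@[simp] lemma dem_singleton (v : α) : I.dem {v} = I.b v := Finset.sum_singleton _ _

lemma cut_singleton (v : α) : I.cut {v} = cutE I.E I.s I.t {v} + (I.p v + I.q v) := by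
  unfold cut; rw [Finset.sum_singleton]

lemma Adm.cut_singleton_ge (hI : I.Adm k x) {v : α} (hv : v ∈ I.W) (hW : I.W ≠ {v})
    (hx : x ≠ some v) : 2 * (k - 1) + nrm k (I.b v) ≤ I.cut {v} := by
  rw [← dem_singleton]
  refine hI.cuts _ (Finset.singleton_subset_iff.2 hv) (Finset.singleton_nonempty v)
    (fun h => hW h.symm) ?_
  rintro z hz h
  rw [Finset.singleton_inj.1 h] at hx
  exact hx hz

lemma Adm.cut_univ (hI : I.Adm k x) : I.cut I.W = ∑ v ∈ I.W, (I.p v + I.q v) := by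
  unfold cut; rw [cutE_univ hI.ends, zero_add]

/-- If no vertex is exempt then the graph without the root is connected. -/
lemma Adm.exists_edge (hk : 2 ≤ k) (hI : I.Adm k none) {A : Finset α} (hA : A ⊆ I.W)
    (hne : A.Nonempty) (hAW : A ≠ I.W) :
    ∃ e ∈ I.E, ∃ u v, Joins I.s I.t e u v ∧ u ∈ A ∧ v ∈ I.W ∧ v ∉ A := by
  have hpos : 0 < cutE I.E I.s I.t A := by
    -- The cuts of `A` and its complement add up to the cut of `W` plus twice the edges between
    -- them. Subadditivity of the norm and the root condition leave at least `k - 1` such edges.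
    have h1 := hI.cuts A hA hne hAW (by simp)
    have hc : (I.W \ A).Nonempty := Finset.sdiff_nonempty.2 fun h => hAW (hA.antisymm h)
    have h2 := hI.cuts (I.W \ A) Finset.sdiff_subset hc (by
      intro h
      obtain ⟨a, ha⟩ := hne
      have : a ∈ I.W \ A := by rw [h]; exact hA ha
      exact (Finset.mem_sdiff.1 this).2 ha) (by simp)
    have h3 := hI.root
    rw [hI.cut_univ] at h3
    unfold cut at h1 h2
    rw [cutE_compl hI.ends] at h2
    have h4 := Finset.sum_sdiff (f := fun v => I.p v + I.q v) hA
    have h5 : I.dem I.W = I.dem (I.W \ A) + I.dem A := (Finset.sum_sdiff hA).symm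
    have h6 := nrm_add_le hk (I.dem (I.W \ A)) (I.dem A)
    rw [h5] at h3
    linarith
  obtain ⟨e, he, h⟩ := exists_crosses_of_cutE_pos hpos
  obtain ⟨u, v, hj, hu, hv⟩ := joins_of_crosses h
  exact ⟨e, he, u, v, hj, hu, (hj.mem hI.ends he).2, hv⟩

lemma cut_eq (A : Finset α) :
    I.cut A = cutE I.E I.s I.t A + (∑ v ∈ A, I.p v + ∑ v ∈ A, I.q v) := by
  unfold cut; rw [Finset.sum_add_distrib]

lemma sum_bump (A : Finset α) (f : α → ℤ) (v : α) (c : ℤ) :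
    ∑ w ∈ A, (f w + if w = v then c else 0) = ∑ w ∈ A, f w + if v ∈ A then c else 0 := by
  rw [Finset.sum_add_distrib, Finset.sum_ite_eq']

/-- Only loops remain, so the excess is `q - p`, with residue fixed by `total`. If its absolute
value were at least `2 * k`, moving it by `2 * k` towards zero would bound the norm so well that the
root condition fails. -/
lemma Adm.solvable_of_card_one (hk : 2 ≤ k) (hI : I.Adm k x) {v : α} (hW : I.W = {v}) :
    I.Solvable k := by
  refine ⟨fun _ => 1, fun _ => Or.inl rfl, fun w hw => ?_⟩
  have hwv : w = v := by simpa [hW] using hw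
  subst hwv
  have h0 := sum_net_eq_zero hI.ends (fun _ => 1)
  have h1 := hI.total
  have h2 := hI.root
  have h3 := hI.p_nonneg w hw
  have h4 := hI.q_nonneg w hw
  rw [hI.cut_univ] at h2
  simp only [hW, Finset.sum_singleton, dem_singleton] at h0 h1 h2
  unfold excess
  rw [h0]
  refine ⟨?_, ?_⟩
  · rw [← dvd_neg]; exact dvd_of_dvd_eq h1 (by ring)
  · have h5 : nrm k (I.b w) = nrm k (I.q w - I.p w) :=
      nrm_congr (dvd_of_dvd_eq h1 (by ring))
    rw [h5] at h2
    by_contra hc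
    rcases abs_cases (0 + I.q w - I.p w) with ⟨h6, h7⟩ | ⟨h6, h7⟩
    · have h8 := nrm_le_abs_of_dvd hk (x := I.q w - I.p w) (r := I.q w - I.p w - 2 * k) ⟨1, by ring⟩
      rw [abs_of_nonneg (by linarith)] at h8
      linarith
    · have h8 := nrm_le_abs_of_dvd hk (x := I.q w - I.p w) (r := I.q w - I.p w + 2 * k)
        ⟨-1, by ring⟩
      rw [abs_of_nonpos (by linarith)] at h8
      linarith

variable [DecidableEq ι]

/-- Direct an edge from a vertex of small positive demand to one of negative demand, and delete
it. -/
lemma Adm.solvable_of_edge {n : ℤ} (hk : 2 ≤ k)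
    (IH : ∀ (J : Rooted α ι) y, J.Adm k y → J.size k < n → J.Solvable k)
    (hI : I.Adm k none) (hS : I.Slack k) (hn : I.size k < n + (k + 2)) {e : ι} {u v : α}
    (he : e ∈ I.E) (hj : Joins I.s I.t e u v) (hu1 : 1 ≤ I.b u % (2 * k))
    (hu2 : I.b u % (2 * k) ≤ k) (hv : k + 1 ≤ I.b v % (2 * k)) : I.Solvable k := by
  have huv : u ≠ v := by rintro rfl; omega
  have huW := (hj.mem hI.ends he).1
  have hvW := (hj.mem hI.ends he).2
  let J : Rooted α ι := { I with
    E := I.E.erase e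
    b := fun w => (I.b w + if w = u then -1 else 0) + if w = v then 1 else 0 }
  have hcut : ∀ A, J.cut A = I.cut A - if (u ∈ A ↔ v ∈ A) then 0 else 1 := by
    intro A
    rw [← hj.crosses_eq A]
    have := cutE_erase (s := I.s) (t := I.t) (A := A) he
    simp only [cut, J]; linarith
  have hdem : ∀ A, J.dem A = I.dem A + (if u ∈ A then -1 else 0) + if v ∈ A then 1 else 0 := by
    intro A
    simp only [dem, J, sum_bump]
  have hJ : J.Adm k none := by
    refine hI.modify hk hS rfl (fun f hf => hI.ends f (Finset.mem_of_mem_erase hf))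
      hI.p_nonneg hI.q_nonneg ?_ ?_ ?_ ?_ ?_ (by simp)
    · intro A _
      rw [hcut, hdem]
      by_cases h1 : u ∈ A <;> by_cases h2 : v ∈ A <;> simp [h1, h2]
    · have := hI.total
      change 2 * k ∣ J.dem I.W + ∑ v ∈ I.W, I.p v - ∑ v ∈ I.W, I.q v
      rw [hdem]; simpa [huW, hvW] using this
    · have := hI.root
      change J.cut I.W ≤ 2 * (k - 1) + nrm k (J.dem I.W)
      rw [hdem, hcut]; simpa [huW, hvW] using this
    · intro A _ _ _
      rw [hcut, hdem]
      by_cases h1 : u ∈ A <;> by_cases h2 : v ∈ A <;> simp [h1, h2]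
    -- Singletons have no slack to spend, but at `u` and at `v` degree and norm both drop by one.
    · intro w hw hWw _
      have h1 := hI.cut_singleton_ge hw hWw (by simp)
      rw [hcut, hdem, dem_singleton]
      have h3 := nrm_sub_one hk hu1 hu2
      have h4 := nrm_add_one hk (show k ≤ I.b v % (2 * k) by omega)
      by_cases hwu : w = u
      · subst hwu
        simp only [Finset.mem_singleton, huv.symm, if_true, if_false, iff_false,
          not_true_eq_false, add_zero]
        rw [← sub_eq_add_neg, h3]; linarith
      · by_cases hwv : w = v
        · subst hwv
          simp only [Finset.mem_singleton, huv, if_true, if_false, false_iff,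
            not_true_eq_false, add_zero]
          rw [h4]; linarith
        · simpa [Ne.symm hwu, Ne.symm hwv] using h1
  have hsz : J.size k < n := by
    have h1 : ((I.E.erase e).card : ℤ) + 1 = I.E.card := by
      exact_mod_cast Finset.card_erase_add_one he
    simp only [size, J] at hn ⊢
    rw [← h1] at hn
    nlinarith
  obtain ⟨σ, hσ, h⟩ := IH J none hJ hsz
  obtain ⟨ε, hε, hε'⟩ := hj.exists_sign
  refine ⟨Function.update σ e ε, hσ.update hε, fun w hw => ?_⟩
  have hex : I.excess (Function.update σ e ε) w =
      J.excess σ w + ((if w = u then 1 else 0) - (if w = v then 1 else 0)) := by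
    simp only [excess, J]; rw [net_update he, hε']; ring
  obtain ⟨h1, h2⟩ := h w hw
  rw [hex]
  have hb : J.b w = (I.b w + if w = u then -1 else 0) + if w = v then 1 else 0 := rfl
  rw [hb] at h1
  by_cases hwu : w = u
  · subst hwu
    simp only [huv, if_true, if_false] at h1 ⊢
    refine ⟨dvd_of_dvd_eq h1 (by ring), ?_⟩
    rw [sub_zero]
    exact abs_add_one_le (b := I.b w) h2 (dvd_of_dvd_eq h1 (by ring)) (by omega)
  · by_cases hwv : w = v
    · subst hwv
      simp only [huv.symm, if_true, if_false] at h1 ⊢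
      refine ⟨dvd_of_dvd_eq h1 (by ring), ?_⟩
      rw [zero_sub, ← sub_eq_add_neg]
      exact abs_sub_one_le (b := I.b w) h2 (dvd_of_dvd_eq h1 (by ring)) (by omega)
    · simp only [hwu, hwv, if_false, add_zero, sub_zero] at h1 ⊢
      exact ⟨h1, h2⟩

end Rooted
-- Reductions that change arcs at the root.
namespace Rooted
variable {α ι : Type*} [DecidableEq α] {I J : Rooted α ι} {k : ℤ} {x y : Option α}

/-- Remove an arc from a vertex of small positive demand to the root. -/
lemma Adm.solvable_of_arc {n : ℤ} (hk : 2 ≤ k)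
    (IH : ∀ (J : Rooted α ι) y, J.Adm k y → J.size k < n → J.Solvable k)
    (hI : I.Adm k none) (hS : I.Slack k) (hn : I.size k < n + 1) {u : α} (huW : u ∈ I.W)
    (hq : 1 ≤ I.q u) (hu1 : 1 ≤ I.b u % (2 * k)) (hu2 : I.b u % (2 * k) ≤ k) : I.Solvable k := by
  let J : Rooted α ι := { I with
    q := fun w => I.q w + if w = u then -1 else 0
    b := fun w => I.b w + if w = u then -1 else 0 }
  have hsumq : ∀ A, ∑ w ∈ A, J.q w = ∑ w ∈ A, I.q w + if u ∈ A then -1 else 0 :=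
    fun A => sum_bump _ _ _ _
  have hdem : ∀ A, J.dem A = I.dem A + if u ∈ A then -1 else 0 := fun A => sum_bump _ _ _ _
  have hcut : ∀ A, J.cut A = I.cut A + if u ∈ A then -1 else 0 := by
    intro A
    rw [cut_eq, cut_eq, hsumq]
    change cutE I.E I.s I.t A + (∑ v ∈ A, I.p v + _) = _
    ring
  have hJ : J.Adm k none := by
    refine hI.modify hk hS rfl hI.ends hI.p_nonneg ?_ ?_ ?_ ?_ ?_ ?_ (by simp)
    · intro v hv
      have := hI.q_nonneg v hv
      simp only [J]
      by_cases h : v = u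
      · subst h; simp only [if_true]; omega
      · simpa [h] using this
    · intro A _
      rw [hcut, hdem]; simp
    · have := hI.total
      change 2 * k ∣ J.dem I.W + ∑ v ∈ I.W, I.p v - ∑ v ∈ I.W, J.q v
      rw [hdem, hsumq, if_pos huW]
      exact dvd_of_dvd_eq this (by ring)
    · have := hI.root
      change J.cut I.W ≤ 2 * (k - 1) + nrm k (J.dem I.W)
      rw [hdem, hcut, if_pos huW]
      -- The root loses one arc, and the norm of the total demand drops by at most one.
      have h1 := nrm_add_le_abs hk (I.dem I.W + -1) 1
      rw [neg_add_cancel_right, abs_one] at h1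
      linarith
    · intro A _ _ _
      rw [hcut, hdem]
      by_cases h1 : u ∈ A <;> simp [h1]
    · intro w hw hWw _
      have h1 := hI.cut_singleton_ge hw hWw (by simp)
      rw [hcut, hdem, dem_singleton]
      have h3 := nrm_sub_one hk hu1 hu2
      by_cases hwu : w = u
      · subst hwu
        simp only [Finset.mem_singleton, if_true]
        rw [← sub_eq_add_neg, h3]; linarith
      · simpa [Ne.symm hwu] using h1
  have hsz : J.size k < n := by
    have h1 := hsumq I.W
    rw [if_pos huW] at h1
    unfold size at hn ⊢
    rw [Finset.sum_add_distrib] at hn ⊢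
    change (k + 2) * ((I.W.card : ℤ) + I.E.card) + (∑ v ∈ I.W, I.p v + ∑ v ∈ I.W, J.q v) < n
    rw [h1]; linarith
  obtain ⟨σ, hσ, h⟩ := IH J none hJ hsz
  refine ⟨σ, hσ, fun w hw => ?_⟩
  have hex : I.excess σ w = J.excess σ w + if w = u then 1 else 0 := by
    simp only [excess, J]; split_ifs <;> ring
  obtain ⟨h1, h2⟩ := h w hw
  have hb : J.b w = I.b w + if w = u then -1 else 0 := rfl
  rw [hex]
  rw [hb] at h1
  by_cases hwu : w = u
  · subst hwu
    simp only [if_true] at h1 ⊢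
    refine ⟨dvd_of_dvd_eq h1 (by ring), ?_⟩
    exact abs_add_one_le (b := I.b w) h2 (dvd_of_dvd_eq h1 (by ring)) (by omega)
  · simpa only [hwu, if_false, add_zero] using And.intro h1 h2

/-- Direct an edge from a vertex `u` of small positive demand, and replace it by an arc from the
root to its other end. -/
lemma Adm.solvable_of_pull [DecidableEq ι] {n : ℤ} (hk : 2 ≤ k)
    (IH : ∀ (J : Rooted α ι) y, J.Adm k y → J.size k < n → J.Solvable k)
    (hI : I.Adm k none) (hS : I.Slack k) (hn : I.size k < n + 1) {e : ι} {u v : α}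
    (he : e ∈ I.E) (hj : Joins I.s I.t e u v) (huv : u ≠ v) (h0 : I.cut I.W = 0)
    (hu1 : 1 ≤ I.b u % (2 * k)) (hu2 : I.b u % (2 * k) ≤ k) : I.Solvable k := by
  have huW := (hj.mem hI.ends he).1
  have hvW := (hj.mem hI.ends he).2
  let J : Rooted α ι := { I with
    E := I.E.erase e
    p := fun w => I.p w + if w = v then 1 else 0
    b := fun w => I.b w + if w = u then -1 else 0 }
  have hsump : ∀ A, ∑ w ∈ A, J.p w = ∑ w ∈ A, I.p w + if v ∈ A then 1 else 0 :=
    fun A => sum_bump _ _ _ _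
  have hdem : ∀ A, J.dem A = I.dem A + if u ∈ A then -1 else 0 := fun A => sum_bump _ _ _ _
  have hcut : ∀ A, J.cut A = I.cut A - (if (u ∈ A ↔ v ∈ A) then 0 else 1) +
      if v ∈ A then 1 else 0 := by
    intro A
    rw [← hj.crosses_eq A]
    rw [cut_eq, cut_eq, hsump]
    change cutE (I.E.erase e) I.s I.t A + (_ + ∑ v ∈ A, I.q v) = _
    rw [cutE_erase he]; ring
  have hJ : J.Adm k none := by
    refine hI.modify hk hS rfl (fun f hf => hI.ends f (Finset.mem_of_mem_erase hf)) ?_ hI.q_nonneg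
      ?_ ?_ ?_ ?_ ?_ (by simp)
    · intro w hw
      have := hI.p_nonneg w hw
      simp only [J]
      split_ifs <;> omega
    · intro A _
      rw [hcut, hdem]
      by_cases h1 : u ∈ A <;> by_cases h2 : v ∈ A <;> simp [h1, h2]
    · have := hI.total
      change 2 * k ∣ J.dem I.W + ∑ v ∈ I.W, J.p v - ∑ v ∈ I.W, I.q v
      rw [hdem, hsump, if_pos huW, if_pos hvW]
      exact dvd_of_dvd_eq this (by ring)
    -- The root had no arcs and now has one.
    · change J.cut I.W ≤ 2 * (k - 1) + nrm k (J.dem I.W)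
      rw [hcut, h0]
      have := nrm_nonneg hk (J.dem I.W)
      simp only [huW, hvW, if_true]; omega
    · intro A _ _ _
      rw [hcut, hdem]
      by_cases h1 : u ∈ A <;> by_cases h2 : v ∈ A <;> simp [h1, h2]
    · intro w hw hWw _
      have h1 := hI.cut_singleton_ge hw hWw (by simp)
      rw [hcut, hdem, dem_singleton]
      have h3 := nrm_sub_one hk hu1 hu2
      by_cases hwu : w = u
      · subst hwu
        simp only [Finset.mem_singleton, huv.symm, if_true, if_false, iff_false,
          not_true_eq_false, add_zero]
        rw [← sub_eq_add_neg, h3]; linarith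
      · by_cases hwv : w = v
        · subst hwv
          simpa [huv] using h1
        · simpa [Ne.symm hwu, Ne.symm hwv] using h1
  -- An edge of weight `k + 2` is traded for an arc of weight one.
  have hsz : J.size k < n := by
    have h1 := hsump I.W
    rw [if_pos hvW] at h1
    have h2 : ((I.E.erase e).card : ℤ) + 1 = I.E.card := by
      exact_mod_cast Finset.card_erase_add_one he
    unfold size at hn ⊢
    rw [Finset.sum_add_distrib] at hn ⊢
    change (k + 2) * ((I.W.card : ℤ) + (I.E.erase e).card) +
      (∑ v ∈ I.W, J.p v + ∑ v ∈ I.W, I.q v) < n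
    rw [h1]; rw [← h2] at hn; nlinarith
  obtain ⟨σ, hσ, h⟩ := IH J none hJ hsz
  obtain ⟨ε, hε, hε'⟩ := hj.exists_sign
  refine ⟨Function.update σ e ε, hσ.update hε, fun w hw => ?_⟩
  have hex : I.excess (Function.update σ e ε) w = J.excess σ w + if w = u then 1 else 0 := by
    simp only [excess, J]; rw [net_update he, hε']; split_ifs <;> ring
  obtain ⟨h1, h2⟩ := h w hw
  have hb : J.b w = I.b w + if w = u then -1 else 0 := rfl
  rw [hex]
  rw [hb] at h1
  by_cases hwu : w = u
  · subst hwu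
    simp only [if_true] at h1 ⊢
    refine ⟨dvd_of_dvd_eq h1 (by ring), ?_⟩
    exact abs_add_one_le (b := I.b w) h2 (dvd_of_dvd_eq h1 (by ring)) (by omega)
  · simpa only [hwu, if_false, add_zero] using And.intro h1 h2

/-- The root condition when one of `δ` arcs leaving the root is traded for `c` arcs entering it. The
old condition forces `δ < 2 * k`, since otherwise `δ - 2 * k` would bound the norm; then the
residues can be computed. -/
lemma nrm_flip (hk : 2 ≤ k) {δ c : ℤ} (hδ : δ ≤ 2 * (k - 1) + nrm k (-δ)) (hδ1 : 1 ≤ δ)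
    (hc0 : 0 ≤ c) (hc : c ≤ k - 1) : δ - 1 + c ≤ 2 * (k - 1) + nrm k (-δ + 1 + c) := by
  rw [nrm_neg hk] at hδ
  have h1 : δ ≤ 2 * k - 1 := by
    by_contra h
    have := nrm_le_abs_of_dvd hk (x := δ) (r := δ - 2 * k) ⟨1, by ring⟩
    rw [abs_of_nonneg (by omega)] at this
    omega
  have h2 : nrm k (-δ + 1 + c) = nrm k (δ - 1 - c) := by
    rw [← nrm_neg hk]; congr 1; ring
  rw [h2]
  rcases lt_or_ge (δ - 1 - c) 0 with h | h
  · have h3 : (δ - 1 - c) % (2 * k) = δ - 1 - c + 2 * k :=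
      emod_of_dvd_sub ⟨-1, by ring⟩ (by omega) (by omega)
    unfold nrm; rw [h3]; omega
  · have h3 : (δ - 1 - c) % (2 * k) = δ - 1 - c := Int.emod_eq_of_lt h (by omega)
    unfold nrm; rw [h3]; omega

/-- All demands are small and positive, and the root sends an arc to `x`: replace that arc by
several arcs from `x` to the root. -/
lemma Adm.solvable_of_flip [DecidableEq ι] {n : ℤ} (hk : 2 ≤ k)
    (IH : ∀ (J : Rooted α ι) y, J.Adm k y → J.size k < n → J.Solvable k)
    (hI : I.Adm k none) (hS : I.Slack k) (hn : I.size k < n + 1) (h2W : 2 ≤ I.W.card)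
    (hq : ∀ v ∈ I.W, I.q v = 0) (hP : ∀ v ∈ I.W, 1 ≤ I.b v % (2 * k) ∧ I.b v % (2 * k) ≤ k)
    {x : α} (hx : x ∈ I.W) (hp : 1 ≤ I.p x) : I.Solvable k := by
  obtain ⟨hx1, hx2⟩ := hP x hx
  -- This `c` moves the demand at `x` to the residue `k + 1`, so that `x` becomes negative with norm
  -- `k - 1`. The norm and the degree of `x` both change by `c - 1`.
  set c : ℤ := k - I.b x % (2 * k) with hc
  let J : Rooted α ι := { I with
    p := fun w => I.p w + if w = x then -1 else 0
    q := fun w => I.q w + if w = x then c else 0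
    b := fun w => I.b w + if w = x then 1 + c else 0 }
  have hsump : ∀ A, ∑ w ∈ A, J.p w = ∑ w ∈ A, I.p w + if x ∈ A then -1 else 0 :=
    fun A => sum_bump _ _ _ _
  have hsumq : ∀ A, ∑ w ∈ A, J.q w = ∑ w ∈ A, I.q w + if x ∈ A then c else 0 :=
    fun A => sum_bump _ _ _ _
  have hdem : ∀ A, J.dem A = I.dem A + if x ∈ A then 1 + c else 0 := fun A => sum_bump _ _ _ _
  have hcut : ∀ A, J.cut A = I.cut A + if x ∈ A then -1 + c else 0 := by
    intro A
    rw [cut_eq, cut_eq, hsump, hsumq]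
    change cutE I.E I.s I.t A + _ = _
    split_ifs <;> ring
  have hbx : J.b x = I.b x + (1 + c) := by simp [J]
  have hbx' : J.b x % (2 * k) = k + 1 := by
    rw [hbx]
    exact emod_of_dvd_sub (dvd_of_dvd_eq (dvd_sub_emod k (I.b x)) (by rw [hc]; ring))
      (by omega) (by omega)
  have hWx : ∀ w, I.W ≠ {w} := fun w h => by rw [h, Finset.card_singleton] at h2W; omega
  have hJ : J.Adm k none := by
    refine hI.modify hk hS rfl hI.ends ?_ ?_ ?_ ?_ ?_ ?_ ?_ (by simp)
    · intro w hw
      have := hI.p_nonneg w hw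
      simp only [J]
      by_cases h : w = x
      · subst h; simp only [if_true]; omega
      · simpa [h] using this
    · intro w hw
      have := hI.q_nonneg w hw
      simp only [J]
      split_ifs <;> omega
    · intro A _
      rw [hcut, hdem]
      split_ifs
      · exact ⟨-1, by ring⟩
      · simp
    · have := hI.total
      change 2 * k ∣ J.dem I.W + ∑ v ∈ I.W, J.p v - ∑ v ∈ I.W, J.q v
      rw [hdem, hsump, hsumq, if_pos hx, if_pos hx, if_pos hx]
      exact dvd_of_dvd_eq this (by ring)
    · change J.cut I.W ≤ 2 * (k - 1) + nrm k (J.dem I.W)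
      rw [hcut, hdem, if_pos hx, if_pos hx]
      have h1 : I.cut I.W = ∑ v ∈ I.W, I.p v := by
        rw [hI.cut_univ]
        exact Finset.sum_congr rfl fun v hv => by rw [hq v hv, add_zero]
      have h2 : nrm k (I.dem I.W) = nrm k (-I.cut I.W) := by
        apply nrm_congr
        have := hI.total
        rw [Finset.sum_eq_zero hq] at this
        rw [h1]; exact dvd_of_dvd_eq this (by ring)
      have h3 : nrm k (I.dem I.W + (1 + c)) = nrm k (-I.cut I.W + 1 + c) := by
        apply nrm_congr
        have := hI.total
        rw [Finset.sum_eq_zero hq] at this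
        rw [h1]; exact dvd_of_dvd_eq this (by ring)
      have h4 := hI.root
      rw [h2] at h4
      rw [h3]
      have h5 : 1 ≤ I.cut I.W := by
        rw [h1]
        exact hp.trans (Finset.single_le_sum hI.p_nonneg hx)
      have := nrm_flip hk h4 h5 (by omega : 0 ≤ c) (by omega)
      linarith
    · intro A _ _ _
      rw [hcut, hdem]
      by_cases h1 : x ∈ A
      · simp only [h1, if_true]
        rw [abs_of_nonneg (by omega)]; omega
      · simp [h1]
    · intro w hw hWw _
      have h1 := hI.cut_singleton_ge hw hWw (by simp)
      rw [hcut, dem_singleton]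
      by_cases hwx : w = x
      · subst hwx
        simp only [Finset.mem_singleton, if_true]
        have h3 : nrm k (J.b w) = k - 1 := by unfold nrm; rw [hbx']; omega
        have h4 : nrm k (I.b w) = I.b w % (2 * k) := by unfold nrm; omega
        rw [h3]; omega
      · have : J.b w = I.b w := by simp [J, hwx]
        rw [this]; simpa [Ne.symm hwx] using h1
  -- The measure may grow here, but only by `c - 1 ≤ k - 2`. The weight `k + 2` of vertices and
  -- edges lets the next reduction bring it below `n`.
  have hJn : J.size k < n + (k + 2) := by
    have h1 := hsump I.W
    have h2 := hsumq I.W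
    rw [if_pos hx] at h1 h2
    unfold size at hn ⊢
    rw [Finset.sum_add_distrib] at hn ⊢
    change (k + 2) * ((I.W.card : ℤ) + I.E.card) + (∑ v ∈ I.W, J.p v + ∑ v ∈ I.W, J.q v) < _
    rw [h1, h2]; linarith
  have hsol : J.Solvable k := by
    -- The change can consume all slack, so tight sets have to be considered anew.
    by_cases ht : ∃ A ⊆ J.W, 2 ≤ A.card ∧ A ≠ J.W ∧ J.cut A ≤ 2 * (k - 1) + nrm k (J.dem A)
    · obtain ⟨A, h1, h2, h3, h4⟩ := ht
      exact hJ.solvable_of_tight hk IH hJn h1 h2 h3 h4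
    -- Now `x` is the only negative vertex, so any edge leaving it joins opposite signs.
    · obtain ⟨e, he, u, v, hj, hu, hv, hvx⟩ := hI.exists_edge hk
        (Finset.singleton_subset_iff.2 hx) (Finset.singleton_nonempty x) (fun h => hWx x h.symm)
      rw [Finset.mem_singleton] at hu hvx
      subst hu
      have hbv : J.b v = I.b v := by simp [J, hvx]
      refine hJ.solvable_of_edge (u := v) (v := u) hk IH (hJ.slack ht) hJn he hj.symm ?_ ?_ ?_
      · rw [hbv]; exact (hP v hv).1
      · rw [hbv]; exact (hP v hv).2
      · omega
  obtain ⟨σ, hσ, h⟩ := hsol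
  refine ⟨σ, hσ, fun w hw => ?_⟩
  have hex : I.excess σ w = J.excess σ w - if w = x then 1 + c else 0 := by
    simp only [excess, J]; split_ifs <;> ring
  obtain ⟨h1, h2⟩ := h w hw
  rw [hex]
  by_cases hwx : w = x
  · subst hwx
    rw [if_pos rfl]
    refine ⟨dvd_of_dvd_eq h1 (by rw [hbx]; ring), ?_⟩
    -- In `J` the excess at `x` is `k + 1` or `1 - k`; subtracting `1 + c ≤ k` keeps it within the
    -- bound.
    have h3 := eq_or_eq_of_abs_lt hk h1 h2
    rw [hbx'] at h3
    rw [abs_le] at h2 ⊢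
    omega
  · have hb : J.b w = I.b w := by simp [J, hwx]
    rw [hb] at h1
    simpa only [hwx, if_false, sub_zero] using And.intro h1 h2

end Rooted

/-! ### Splitting off pairs of edges. -/

section Lift
variable {α ι : Type*} [DecidableEq α] [DecidableEq ι] {E : Finset ι} {s t : ι → α} {e f : ι}
  {x y z : α} {A : Finset α}

/-- Splitting off the edges `zx` and `zy` to an edge `xy`: effect on cuts. -/
lemma cutE_lift (he : e ∈ E) (hf : f ∈ E) (hef : e ≠ f) (hex : Joins s t e z x)
    (hfy : Joins s t f z y) :
    cutE (E.erase f) (Function.update s e x) (Function.update t e y) A =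
      cutE E s t A - (if (z ∈ A ↔ x ∈ A) then 0 else 1) - (if (z ∈ A ↔ y ∈ A) then 0 else 1) +
        if (x ∈ A ↔ y ∈ A) then 0 else 1 := by
  have he' : e ∈ E.erase f := Finset.mem_erase.2 ⟨hef, he⟩
  rw [← hex.crosses_eq A, ← hfy.crosses_eq A]
  unfold cutE
  rw [← Finset.add_sum_erase E _ hf, ← Finset.add_sum_erase _ _ he',
    ← Finset.add_sum_erase _ (crosses s t A) he']
  have h1 : ∀ g ∈ (E.erase f).erase e,
      crosses (Function.update s e x) (Function.update t e y) A g = crosses s t A g := by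
    intro g hg
    have := Finset.ne_of_mem_erase hg
    unfold crosses
    rw [Function.update_of_ne this, Function.update_of_ne this]
  rw [Finset.sum_congr rfl h1]
  have h2 : crosses (Function.update s e x) (Function.update t e y) A e =
      if (x ∈ A ↔ y ∈ A) then 0 else 1 := by
    unfold crosses; rw [Function.update_self, Function.update_self]
  rw [h2]; ring

/-- Splitting off the edges `zx` and `zy` to an edge `xy`: orientations extend. -/
lemma exists_net_lift (he : e ∈ E) (hf : f ∈ E) (hef : e ≠ f) (hex : Joins s t e z x)
    (hfy : Joins s t f z y) {σ : ι → ℤ} (hσ : IsSign σ) :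
    ∃ τ, IsSign τ ∧ ∀ w, net E s t τ w =
      net (E.erase f) (Function.update s e x) (Function.update t e y) σ w := by
  have he' : e ∈ E.erase f := Finset.mem_erase.2 ⟨hef, he⟩
  obtain ⟨ε, hε, hε'⟩ := hex.symm.exists_sign
  obtain ⟨δ, hδ, hδ'⟩ := hfy.exists_sign
  have hmul : ∀ a b : ℤ, (a = 1 ∨ a = -1) → (b = 1 ∨ b = -1) → (a * b = 1 ∨ a * b = -1) := by
    rintro a b (rfl | rfl) (rfl | rfl) <;> simp
  refine ⟨Function.update (Function.update σ e (σ e * ε)) f (σ e * δ),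
    (hσ.update (hmul _ _ (hσ e) hε)).update (hmul _ _ (hσ e) hδ), fun w => ?_⟩
  rw [net_update hf, net_update he']
  have h1 : σ e * inc (Function.update s e x) (Function.update t e y) e w =
      σ e * ((if w = x then 1 else 0) - (if w = y then 1 else 0)) := by
    unfold inc
    rw [Function.update_self, Function.update_self]
    simp only [eq_comm]
  have h2 : net ((E.erase f).erase e) (Function.update s e x) (Function.update t e y) σ w =
      net ((E.erase f).erase e) s t σ w := by
    refine Finset.sum_congr rfl fun g hg => ?_
    have := Finset.ne_of_mem_erase hg
    unfold inc
    rw [Function.update_of_ne this, Function.update_of_ne this]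
  have h3 := net_erase (s := Function.update s e x) (t := Function.update t e y) (σ := σ)
    (v := w) he'
  rw [h1, h2] at h3
  rw [mul_assoc, mul_assoc, hε', hδ']
  linarith

lemma lift_ends {W : Finset α} (hE : ∀ g ∈ E, s g ∈ W ∧ t g ∈ W) (hx : x ∈ W) (hy : y ∈ W) :
    ∀ g ∈ E.erase f, Function.update s e x g ∈ W ∧ Function.update t e y g ∈ W := by
  intro g hg
  by_cases h : g = e
  · subst h; rw [Function.update_self, Function.update_self]; exact ⟨hx, hy⟩
  · rw [Function.update_of_ne h, Function.update_of_ne h]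
    exact hE g (Finset.mem_of_mem_erase hg)

/-- Signs on a finite set with a prescribed sum. -/
lemma exists_sign_sum (F : Finset ι) (c : ι → ℤ) (hc : ∀ e ∈ F, c e = 1 ∨ c e = -1) (r : ℤ)
    (hr : |r| ≤ F.card) (hpar : 2 ∣ (F.card : ℤ) - r) :
    ∃ σ, IsSign σ ∧ ∑ e ∈ F, σ e * c e = r := by
  rw [abs_le] at hr
  obtain ⟨j, hj⟩ := hpar
  -- With `F.card - r = 2 * j`, exactly `j` of the terms must be `-1`; `G` carries the others.
  obtain ⟨G, hGF, hG⟩ := Finset.exists_subset_card_eq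
    (show (F.card - j).toNat ≤ F.card by omega)
  have hsq : ∀ e ∈ F, c e * c e = 1 := fun e he => by rcases hc e he with h | h <;> rw [h] <;> rfl
  refine ⟨fun e => if e ∈ F then (if e ∈ G then c e else - c e) else 1, fun e => ?_, ?_⟩
  · by_cases h1 : e ∈ F
    · rcases hc e h1 with h | h <;> by_cases h2 : e ∈ G <;> simp [h1, h2, h]
    · simp [h1]
  · have h1 : ∀ e ∈ F, (if e ∈ F then (if e ∈ G then c e else - c e) else 1) * c e =
        2 * (if e ∈ G then 1 else 0) - 1 := by
      intro e he
      rw [if_pos he]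
      split_ifs
      · rw [hsq e he]; rfl
      · rw [neg_mul, hsq e he]; rfl
    rw [Finset.sum_congr rfl h1, Finset.sum_sub_distrib, ← Finset.mul_sum, Finset.sum_ite_mem,
      Finset.inter_eq_right.2 hGF]
    simp only [Finset.sum_const, nsmul_eq_mul, mul_one, hG]
    omega

end Lift

/-! ### Reversal, and reductions at the exempt vertex. -/

namespace Rooted
variable {α ι : Type*} [DecidableEq α] {I J : Rooted α ι} {k : ℤ} {x : Option α}

/-- Reverse all arcs and demands. -/
def neg (I : Rooted α ι) : Rooted α ι := { I with p := I.q, q := I.p, b := fun v => - I.b v }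

lemma cut_neg (A : Finset α) : I.neg.cut A = I.cut A := by
  unfold cut neg; simp only [add_comm]

lemma dem_neg (A : Finset α) : I.neg.dem A = - I.dem A := by
  unfold dem neg; simp

lemma Adm.neg (hk : 2 ≤ k) (hI : I.Adm k x) : I.neg.Adm k x where
  nonempty := hI.nonempty
  ends := hI.ends
  p_nonneg := hI.q_nonneg
  q_nonneg := hI.p_nonneg
  parity A hA := by
    have := hI.parity A hA
    rw [cut_neg, dem_neg]; omega
  total := by
    have := hI.total
    rw [dem_neg]
    rw [← dvd_neg] at this
    exact dvd_of_dvd_eq this (by simp only [Rooted.neg]; ring)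
  root := by
    have := hI.root
    rw [cut_neg, dem_neg, nrm_neg hk]; exact this
  cuts A hA h1 h2 h3 := by
    rw [cut_neg, dem_neg, nrm_neg hk]; exact hI.cuts A hA h1 h2 h3
  exempt z hz := by
    obtain ⟨h1, h2, h3⟩ := hI.exempt z hz
    exact ⟨h1, (dvd_neg).2 h2, by rw [abs_sub_comm]; exact h3⟩

lemma Slack.neg (hk : 2 ≤ k) (hS : I.Slack k) : I.neg.Slack k := by
  intro A hA h1 h2
  rw [cut_neg, dem_neg, nrm_neg hk]; exact hS A hA h1 h2

lemma size_neg : I.neg.size k = I.size k := by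
  unfold size neg; simp only [add_comm]

lemma Solvable.of_neg (h : I.neg.Solvable k) : I.Solvable k := by
  obtain ⟨σ, hσ, h⟩ := h
  refine ⟨fun e => - σ e, fun e => ?_, fun v hv => ?_⟩
  · rcases hσ e with h | h <;> simp [h]
  · have hex : I.excess (fun e => - σ e) v = - I.neg.excess σ v := by
      unfold excess net Rooted.neg
      simp only [neg_mul, Finset.sum_neg_distrib]; ring
    obtain ⟨h1, h2⟩ := h v hv
    rw [hex, abs_neg]
    refine ⟨?_, h2⟩
    rw [← dvd_neg]
    exact dvd_of_dvd_eq h1 (by simp only [Rooted.neg]; ring)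

variable {z : α}

/-- The exempt vertex both sends and receives an arc. -/
lemma Adm.solvable_of_exempt_both {n : ℤ} (hk : 2 ≤ k)
    (IH : ∀ (J : Rooted α ι) y, J.Adm k y → J.size k < n → J.Solvable k)
    (hI : I.Adm k (some z)) (hS : I.Slack k) (hn : I.size k < n + 1)
    (hp : 1 ≤ I.p z) (hq : 1 ≤ I.q z) : I.Solvable k := by
  obtain ⟨hz, hbz, hz3⟩ := hI.exempt z rfl
  -- Only `q - p` enters the excess, so opposite arcs cancel. Sets through `z` lose two from their
  -- cuts, which their slack covers; `{z}` itself is exempt.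
  let J : Rooted α ι := { I with
    p := fun w => I.p w + if w = z then -1 else 0
    q := fun w => I.q w + if w = z then -1 else 0 }
  have hsump : ∀ A, ∑ w ∈ A, J.p w = ∑ w ∈ A, I.p w + if z ∈ A then -1 else 0 :=
    fun A => sum_bump _ _ _ _
  have hsumq : ∀ A, ∑ w ∈ A, J.q w = ∑ w ∈ A, I.q w + if z ∈ A then -1 else 0 :=
    fun A => sum_bump _ _ _ _
  have hdem : ∀ A, J.dem A = I.dem A := fun A => rfl
  have hcut : ∀ A, J.cut A = I.cut A + if z ∈ A then -2 else 0 := by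
    intro A
    rw [cut_eq, cut_eq, hsump, hsumq]
    change cutE I.E I.s I.t A + _ = _
    split_ifs <;> ring
  have hJ : J.Adm k (some z) := by
    refine hI.modify hk hS rfl hI.ends ?_ ?_ ?_ ?_ ?_ ?_ ?_ ?_
    · intro w hw
      have := hI.p_nonneg w hw
      simp only [J]
      by_cases h : w = z
      · subst h; simp only [if_true]; omega
      · simpa [h] using this
    · intro w hw
      have := hI.q_nonneg w hw
      simp only [J]
      by_cases h : w = z
      · subst h; simp only [if_true]; omega
      · simpa [h] using this
    · intro A _
      rw [hcut, hdem]; split_ifs <;> omega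
    · have := hI.total
      change 2 * k ∣ I.dem I.W + ∑ v ∈ I.W, J.p v - ∑ v ∈ I.W, J.q v
      rw [hsump, hsumq]; exact dvd_of_dvd_eq this (by ring)
    · have := hI.root
      change J.cut I.W ≤ 2 * (k - 1) + nrm k (I.dem I.W)
      rw [hcut, if_pos hz]; omega
    · intro A _ _ _
      rw [hcut, hdem, sub_self, abs_zero]; split_ifs <;> omega
    · intro w hw hWw hwz
      have h1 := hI.cut_singleton_ge hw hWw hwz
      have hzw : z ∉ ({w} : Finset α) := by
        simp only [Finset.mem_singleton]; rintro rfl; exact hwz rfl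
      rw [hcut, hdem, if_neg hzw, dem_singleton]; omega
    · rintro w hw
      obtain rfl := Option.some_inj.1 hw
      refine ⟨hz, hbz, ?_⟩
      simpa [J] using hz3
  have hsz : J.size k < n := by
    have h1 := hsump I.W
    have h2 := hsumq I.W
    rw [if_pos hz] at h1 h2
    unfold size at hn ⊢
    rw [Finset.sum_add_distrib] at hn ⊢
    change (k + 2) * ((I.W.card : ℤ) + I.E.card) + (∑ v ∈ I.W, J.p v + ∑ v ∈ I.W, J.q v) < n
    rw [h1, h2]; linarith
  obtain ⟨σ, hσ, h⟩ := IH J _ hJ hsz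
  refine ⟨σ, hσ, fun w hw => ?_⟩
  have hex : I.excess σ w = J.excess σ w := by
    simp only [excess, J]; split_ifs <;> ring
  rw [hex]; exact h w hw

/-- The exempt vertex `z` receives an arc: move the arc along an edge. -/
lemma Adm.solvable_of_exempt_arc [DecidableEq ι] {n : ℤ} (hk : 2 ≤ k)
    (IH : ∀ (J : Rooted α ι) y, J.Adm k y → J.size k < n → J.Solvable k)
    (hI : I.Adm k (some z)) (hS : I.Slack k) (hn : I.size k < n + 1)
    (hp : 1 ≤ I.p z) (hq : I.q z = 0) : I.Solvable k := by
  obtain ⟨hz, hbz, hz3⟩ := hI.exempt z rfl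
  rw [hq, sub_zero, abs_of_nonneg (by omega)] at hz3
  obtain ⟨e, he, hcr⟩ := exists_crosses_of_cutE_pos (by omega : 0 < cutE I.E I.s I.t {z})
  obtain ⟨z', y, hj, hz', hy⟩ := joins_of_crosses hcr
  rw [Finset.mem_singleton] at hz' hy
  subst hz'
  have hyW := (hj.mem hI.ends he).2
  -- The path from the root through `z'` to `y` is replaced by an arc from the root to `y`.
  let J : Rooted α ι := { I with
    E := I.E.erase e
    p := fun w => (I.p w + if w = z' then -1 else 0) + if w = y then 1 else 0 }
  have hsump : ∀ A, ∑ w ∈ A, J.p w =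
      ∑ w ∈ A, I.p w + (if z' ∈ A then -1 else 0) + if y ∈ A then 1 else 0 := by
    intro A; simp only [J, sum_bump]
  have hdem : ∀ A, J.dem A = I.dem A := fun A => rfl
  have hcut : ∀ A, J.cut A = I.cut A - (if (z' ∈ A ↔ y ∈ A) then 0 else 1) +
      (if z' ∈ A then -1 else 0) + if y ∈ A then 1 else 0 := by
    intro A
    rw [← hj.crosses_eq A, cut_eq, cut_eq, hsump]
    change cutE (I.E.erase e) I.s I.t A + (_ + ∑ v ∈ A, I.q v) = _
    rw [cutE_erase he]; ring
  have hJ : J.Adm k (some z') := by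
    refine hI.modify hk hS rfl (fun f hf => hI.ends f (Finset.mem_of_mem_erase hf)) ?_ hI.q_nonneg
      ?_ ?_ ?_ ?_ ?_ ?_
    · intro w hw
      have := hI.p_nonneg w hw
      simp only [J]
      by_cases h : w = z'
      · subst h; simp only [if_true]; split_ifs <;> omega
      · simp only [h, if_false]; split_ifs <;> omega
    · intro A _
      rw [hcut, hdem]
      by_cases h1 : z' ∈ A <;> by_cases h2 : y ∈ A <;> simp [h1, h2] <;> omega
    · have := hI.total
      change 2 * k ∣ I.dem I.W + ∑ v ∈ I.W, J.p v - ∑ v ∈ I.W, I.q v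
      rw [hsump, if_pos hz, if_pos hyW]; exact dvd_of_dvd_eq this (by ring)
    · have := hI.root
      change J.cut I.W ≤ 2 * (k - 1) + nrm k (I.dem I.W)
      rw [hcut]; simpa [hz, hyW] using this
    · intro A _ _ _
      rw [hcut, hdem, sub_self, abs_zero]
      by_cases h1 : z' ∈ A <;> by_cases h2 : y ∈ A <;> simp [h1, h2] <;> omega
    · intro w hw hWw hwz
      have h1 := hI.cut_singleton_ge hw hWw hwz
      have hzw : z' ≠ w := by rintro rfl; exact hwz rfl
      rw [hcut, hdem, dem_singleton]
      by_cases hyw : y = w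
      · subst hyw; simpa [hzw] using h1
      · simpa [hzw, hyw] using h1
    · rintro w hw
      obtain rfl := Option.some_inj.1 hw
      refine ⟨hz, hbz, ?_⟩
      change |(I.p z' + (if z' = z' then -1 else 0) + if z' = y then 1 else 0) - I.q z'| ≤
        cutE (I.E.erase e) I.s I.t {z'}
      rw [cutE_erase he, hj.crosses_eq, if_pos rfl, if_neg (Ne.symm hy), hq, abs_of_nonneg (by omega)]
      simp only [Finset.mem_singleton, hy, iff_false, not_true_eq_false, if_false]
      omega
  have hsz : J.size k < n := by
    have h1 := hsump I.W
    rw [if_pos hz, if_pos hyW] at h1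
    have h2 : ((I.E.erase e).card : ℤ) + 1 = I.E.card := by
      exact_mod_cast Finset.card_erase_add_one he
    unfold size at hn ⊢
    rw [Finset.sum_add_distrib] at hn ⊢
    change (k + 2) * ((I.W.card : ℤ) + (I.E.erase e).card) +
      (∑ v ∈ I.W, J.p v + ∑ v ∈ I.W, I.q v) < n
    rw [h1]; rw [← h2] at hn; nlinarith
  obtain ⟨σ, hσ, h⟩ := IH J _ hJ hsz
  obtain ⟨ε, hε, hε'⟩ := hj.exists_sign
  refine ⟨Function.update σ e ε, hσ.update hε, fun w hw => ?_⟩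
  have hex : I.excess (Function.update σ e ε) w = J.excess σ w := by
    simp only [excess, J]; rw [net_update he, hε']; split_ifs <;> ring
  rw [hex]; exact h w hw

/-- Split off two edges with distinct ends at the exempt vertex. -/
lemma Adm.solvable_of_exempt_lift [DecidableEq ι] {n : ℤ} (hk : 2 ≤ k)
    (IH : ∀ (J : Rooted α ι) y, J.Adm k y → J.size k < n → J.Solvable k)
    (hI : I.Adm k (some z)) (hS : I.Slack k) (hn : I.size k < n + 1)
    (hp : I.p z = 0) (hq : I.q z = 0) {e f : ι} {u v : α} (he : e ∈ I.E) (hf : f ∈ I.E)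
    (hju : Joins I.s I.t e z u) (hjv : Joins I.s I.t f z v) (huz : u ≠ z) (hvz : v ≠ z)
    (huv : u ≠ v) : I.Solvable k := by
  obtain ⟨hz, hbz, hz3⟩ := hI.exempt z rfl
  have hef : e ≠ f := by
    rintro rfl
    rcases hju with ⟨h1, h2⟩ | ⟨h1, h2⟩ <;> rcases hjv with ⟨h3, h4⟩ | ⟨h3, h4⟩
    · exact huv (h2.symm.trans h4)
    · exact hvz (h3.symm.trans h1)
    · exact huz (h1.symm.trans h3)
    · exact huv (h1.symm.trans h3)
  have huW := (hju.mem hI.ends he).2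
  have hvW := (hjv.mem hI.ends hf).2
  -- The degrees of `u` and `v` do not change, as they are distinct, and larger cuts lose at most
  -- two.
  let J : Rooted α ι := { I with
    E := I.E.erase f
    s := Function.update I.s e u
    t := Function.update I.t e v }
  have hdem : ∀ A, J.dem A = I.dem A := fun A => rfl
  have hcut : ∀ A, J.cut A = I.cut A - (if (z ∈ A ↔ u ∈ A) then 0 else 1) -
      (if (z ∈ A ↔ v ∈ A) then 0 else 1) + if (u ∈ A ↔ v ∈ A) then 0 else 1 := by
    intro A
    have := cutE_lift (A := A) he hf hef hju hjv
    unfold cut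
    simp only [J]; rw [this]; ring
  have hJ : J.Adm k (some z) := by
    refine hI.modify hk hS rfl (lift_ends hI.ends huW hvW) hI.p_nonneg hI.q_nonneg
      ?_ hI.total ?_ ?_ ?_ ?_
    · intro A _
      rw [hcut, hdem]
      by_cases h1 : z ∈ A <;> by_cases h2 : u ∈ A <;> by_cases h3 : v ∈ A <;> simp [h1, h2, h3] <;>
        omega
    · have := hI.root
      change J.cut I.W ≤ 2 * (k - 1) + nrm k (I.dem I.W)
      rw [hcut]; simpa [hz, huW, hvW] using this
    · intro A _ _ _
      rw [hcut, hdem, sub_self, abs_zero]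
      by_cases h1 : z ∈ A <;> by_cases h2 : u ∈ A <;> by_cases h3 : v ∈ A <;> simp [h1, h2, h3] <;>
        omega
    · intro w hw hWw hwz
      have h1 := hI.cut_singleton_ge hw hWw hwz
      have hzw : z ≠ w := by rintro rfl; exact hwz rfl
      rw [hcut, hdem, dem_singleton]
      by_cases hyw : u = w
      · subst hyw; simpa [hzw, huv.symm] using h1
      · by_cases hyw' : v = w
        · subst hyw'; simpa [hzw, huv] using h1
        · simpa [hzw, hyw, hyw'] using h1
    · rintro w hw
      obtain rfl := Option.some_inj.1 hw
      refine ⟨hz, hbz, ?_⟩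
      change |I.p z - I.q z| ≤ _
      rw [hp, hq, sub_zero, abs_zero]; exact cutE_nonneg _ _ _ _
  have hsz : J.size k < n := by
    have h2 : ((I.E.erase f).card : ℤ) + 1 = I.E.card := by
      exact_mod_cast Finset.card_erase_add_one hf
    unfold size at hn ⊢
    change (k + 2) * ((I.W.card : ℤ) + (I.E.erase f).card) + ∑ v ∈ I.W, (I.p v + I.q v) < n
    rw [← h2] at hn; nlinarith
  obtain ⟨σ, hσ, h⟩ := IH J _ hJ hsz
  obtain ⟨τ, hτ, hτ'⟩ := exists_net_lift he hf hef hju hjv hσ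
  refine ⟨τ, hτ, fun w hw => ?_⟩
  have hex : I.excess τ w = J.excess σ w := by
    simp only [excess, J]; rw [hτ']
  rw [hex]; exact h w hw

end Rooted
-- Removal of the exempt vertex, and the main induction.
namespace Rooted
variable {α ι : Type*} [DecidableEq α] [DecidableEq ι] {I J : Rooted α ι} {k : ℤ}
  {x : Option α} {z : α}

/-- The edges at the exempt vertex `z` all go to the same vertex `y`: delete `z`. -/
lemma Adm.solvable_of_exempt_remove {n : ℤ} (hk : 2 ≤ k)
    (IH : ∀ (J : Rooted α ι) y, J.Adm k y → J.size k < n → J.Solvable k)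
    (hI : I.Adm k (some z)) (hn : I.size k < n + 1)
    (hp : I.p z = 0) (hq : I.q z = 0) {y : α} (hy : y ∈ I.W) (hyz : y ≠ z)
    (honly : ∀ e ∈ I.E, ∀ u, Joins I.s I.t e z u → u ≠ z → u = y) : I.Solvable k := by
  obtain ⟨hz, hbz, -⟩ := hI.exempt z rfl
  set G := I.E.filter fun e => I.s e ≠ z ∧ I.t e ≠ z with hG
  let J : Rooted α ι := { I with W := I.W.erase z, E := G }
  have hE : ∀ e ∈ I.E, e ∉ G → (I.s e = z ∧ I.t e = z) ∨ (I.s e = z ∧ I.t e = y) ∨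
      (I.s e = y ∧ I.t e = z) := by
    intro e he heG
    have : I.s e = z ∨ I.t e = z := by
      by_contra hc
      push Not at hc
      exact heG (Finset.mem_filter.2 ⟨he, hc⟩)
    rcases this with h | h
    · by_cases h' : I.t e = z
      · exact Or.inl ⟨h, h'⟩
      · exact Or.inr (Or.inl ⟨h, honly e he _ (Or.inl ⟨h, rfl⟩) h'⟩)
    · by_cases h' : I.s e = z
      · exact Or.inl ⟨h', h⟩
      · exact Or.inr (Or.inr ⟨honly e he _ (Or.inr ⟨rfl, h⟩) h', h⟩)
  -- With `z` put on the side of `y`, no edge at `z` crosses. So each cut of the smaller graph is a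
  -- cut of the original, with the same demand modulo `2 * k`.
  let ex : Finset α → Finset α := fun A => if y ∈ A then insert z A else A
  have hzA : ∀ {A}, A ⊆ I.W.erase z → z ∉ A := fun h h' => Finset.notMem_erase z _ (h h')
  have hcutE : ∀ A ⊆ I.W.erase z, cutE G I.s I.t A = cutE I.E I.s I.t (ex A) := by
    intro A hA
    have hzA := hzA hA
    unfold cutE
    rw [hG, Finset.sum_filter]
    refine Finset.sum_congr rfl fun e he => ?_
    split_ifs with h
    · unfold crosses
      simp only [ex]; split_ifs <;> simp_all
    · have h1 := hE e he (fun h' => h (Finset.mem_filter.1 h').2)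
      symm
      rw [crosses_eq_zero]
      simp only [ex]
      rcases h1 with h1 | h1 | h1 <;> rw [h1.1, h1.2] <;> split_ifs <;> simp_all
  have hsum : ∀ f : α → ℤ, f z = 0 → ∀ A ⊆ I.W.erase z, ∑ v ∈ ex A, f v = ∑ v ∈ A, f v := by
    intro f hf A hA
    simp only [ex]
    split_ifs
    · rw [Finset.sum_insert (hzA hA), hf, zero_add]
    · rfl
  have hcut : ∀ A ⊆ I.W.erase z, J.cut A = I.cut (ex A) := by
    intro A hA
    unfold cut
    rw [← hcutE A hA, hsum _ (by rw [hp, hq, add_zero]) A hA]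
  have hdem : ∀ A ⊆ I.W.erase z, 2 * k ∣ J.dem A - I.dem (ex A) := by
    intro A hA
    simp only [ex]
    split_ifs
    · unfold dem
      rw [Finset.sum_insert (hzA hA)]
      exact dvd_of_dvd_eq ((dvd_neg).2 hbz) (by simp only [J]; ring)
    · exact ⟨0, by simp only [dem, J]; ring⟩
  have hsub : ∀ A ⊆ I.W.erase z, ex A ⊆ I.W := by
    intro A hA
    have h1 := hA.trans (Finset.erase_subset z I.W)
    simp only [ex]
    split_ifs
    · exact Finset.insert_subset hz h1
    · exact h1
  have hyW : y ∈ I.W.erase z := Finset.mem_erase.2 ⟨hyz, hy⟩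
  have hexW : ex (I.W.erase z) = I.W := by
    simp only [ex]; rw [if_pos hyW, Finset.insert_erase hz]
  have hAex : ∀ A, A ⊆ ex A := by
    intro A; simp only [ex]; split_ifs
    · exact Finset.subset_insert _ _
    · exact Finset.Subset.refl _
  have hnrm : ∀ A ⊆ I.W.erase z, nrm k (J.dem A) = nrm k (I.dem (ex A)) :=
    fun A hA => nrm_congr (hdem A hA)
  have hJ : J.Adm k none := by
    refine ⟨⟨y, hyW⟩, ?_, fun v hv => hI.p_nonneg v (Finset.mem_of_mem_erase hv),
      fun v hv => hI.q_nonneg v (Finset.mem_of_mem_erase hv), ?_, ?_, ?_, ?_, by simp⟩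
    · intro e he
      obtain ⟨h1, h2, h3⟩ := Finset.mem_filter.1 he
      exact ⟨Finset.mem_erase.2 ⟨h2, (hI.ends e h1).1⟩, Finset.mem_erase.2 ⟨h3, (hI.ends e h1).2⟩⟩
    · intro A hA
      have h1 := hI.parity _ (hsub A hA)
      have h2 := (Dvd.intro k rfl : (2 : ℤ) ∣ 2 * k).trans (hdem A hA)
      rw [hcut A hA]
      omega
    · have h1 := hdem _ (Finset.Subset.refl _)
      have h2 := hI.total
      have h3 := hsum I.p hp _ (Finset.Subset.refl _)
      have h4 := hsum I.q hq _ (Finset.Subset.refl _)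
      rw [hexW] at h1 h3 h4
      change 2 * k ∣ J.dem (I.W.erase z) + ∑ v ∈ I.W.erase z, I.p v - ∑ v ∈ I.W.erase z, I.q v
      rw [← h3, ← h4]
      exact dvd_of_dvd_eq (dvd_add h1 h2) (by ring)
    · change J.cut (I.W.erase z) ≤ 2 * (k - 1) + nrm k (J.dem (I.W.erase z))
      rw [hcut _ (Finset.Subset.refl _), hnrm _ (Finset.Subset.refl _), hexW]
      exact hI.root
    · intro A hA hne hAW _
      replace hA : A ⊆ I.W.erase z := hA
      rw [hcut A hA, hnrm A hA]
      refine hI.cuts _ (hsub A hA) (hne.mono (hAex A)) ?_ ?_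
      · intro h
        simp only [ex] at h
        split_ifs at h
        · apply hAW
          change A = I.W.erase z
          rw [← h, Finset.erase_insert (hzA hA)]
        · exact hzA hA (h ▸ hz)
      · rintro w hw h
        obtain rfl := Option.some_inj.1 hw
        obtain ⟨a, ha⟩ := hne
        have := hAex A ha
        rw [h, Finset.mem_singleton] at this
        subst this
        exact hzA hA ha
  have hsz : J.size k < n := by
    have h1 : ((I.W.erase z).card : ℤ) + 1 = I.W.card := by
      exact_mod_cast Finset.card_erase_add_one hz
    have h2 : (G.card : ℤ) ≤ I.E.card := by exact_mod_cast Finset.card_filter_le _ _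
    have h3 := Finset.add_sum_erase I.W (fun v => I.p v + I.q v) hz
    unfold size at hn ⊢
    change (k + 2) * (((I.W.erase z).card : ℤ) + G.card) + ∑ v ∈ I.W.erase z, (I.p v + I.q v) < n
    rw [← h1, ← h3, hp, hq] at hn
    nlinarith
  obtain ⟨σ, hσ, h⟩ := IH J none hJ hsz
  set F := I.E.filter fun e => ¬ (I.s e = z ↔ I.t e = z) with hF
  have hFcard : (F.card : ℤ) = cutE I.E I.s I.t {z} := by
    unfold cutE crosses
    rw [hF, Finset.card_filter]
    push_cast
    exact Finset.sum_congr rfl fun e _ => by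
      simp only [Finset.mem_singleton]; split_ifs <;> simp_all
  -- By parity the number of edges between `z` and `y` is even. Directing half of them each way
  -- contributes nothing at either end.
  obtain ⟨τ, hτ, hτ0⟩ := exists_sign_sum F (fun e => inc I.s I.t e z) (by
    intro e he
    have := (Finset.mem_filter.1 he).2
    unfold inc
    by_cases h1 : I.s e = z <;> by_cases h2 : I.t e = z <;> simp_all) 0 (by simp) (by
    have h1 := hI.parity {z} (Finset.singleton_subset_iff.2 hz)
    have h2 := (Dvd.intro k rfl : (2 : ℤ) ∣ 2 * k).trans hbz
    rw [cut_singleton, dem_singleton, hp, hq] at h1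
    rw [hFcard]; omega)
  have hsplit : ∀ w, net I.E I.s I.t (fun e => if e ∈ F then τ e else σ e) w =
      net G I.s I.t σ w + ∑ e ∈ F, τ e * inc I.s I.t e w := by
    intro w
    unfold net
    rw [hG, hF, Finset.sum_filter, Finset.sum_filter, ← Finset.sum_add_distrib]
    refine Finset.sum_congr rfl fun e he => ?_
    have hmem : e ∈ F ↔ ¬ (I.s e = z ↔ I.t e = z) := by simp [hF, he]
    simp only [← hF, hmem]
    by_cases h1 : I.s e = z <;> by_cases h2 : I.t e = z <;> simp [h1, h2]
    exact Or.inr (by simp [inc, h1, h2])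
  refine ⟨fun e => if e ∈ F then τ e else σ e, fun e => ?_, fun w hw => ?_⟩
  · dsimp only; split_ifs
    · exact hτ e
    · exact hσ e
  · by_cases hwz : w = z
    · subst hwz
      have h0 : I.excess (fun e => if e ∈ F then τ e else σ e) w = 0 := by
        unfold excess
        rw [hsplit, hτ0, hp, hq]
        have : net G I.s I.t σ w = 0 := Finset.sum_eq_zero fun e he => by
          obtain ⟨-, h1, h2⟩ := Finset.mem_filter.1 he
          rw [inc_eq_zero h1 h2, mul_zero]
        rw [this]; rfl
      rw [h0, abs_zero]
      exact ⟨dvd_of_dvd_eq ((dvd_neg).2 hbz) (by ring), by omega⟩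
    · have h0 : ∑ e ∈ F, τ e * inc I.s I.t e w = 0 := by
        have hc : ∀ e ∈ F, τ e * inc I.s I.t e w =
            (if w = y then -1 else 0) * (τ e * inc I.s I.t e z) := by
          intro e he
          obtain ⟨h1, h2⟩ := Finset.mem_filter.1 he
          have heG : e ∉ G := by
            intro h'
            have := (Finset.mem_filter.1 h').2
            tauto
          rcases hE e h1 heG with h3 | h3 | h3
          · simp [h3.1, h3.2] at h2
          · unfold inc; rw [h3.1, h3.2]
            by_cases hwy : w = y
            · subst hwy; simp [hyz, hyz.symm]
            · simp [hwy, Ne.symm hwy, Ne.symm hwz]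
          · unfold inc; rw [h3.1, h3.2]
            by_cases hwy : w = y
            · subst hwy; simp [hyz, hyz.symm]
            · simp [hwy, Ne.symm hwy, Ne.symm hwz]
        rw [Finset.sum_congr rfl hc, ← Finset.mul_sum, hτ0, mul_zero]
      have hex : I.excess (fun e => if e ∈ F then τ e else σ e) w = J.excess σ w := by
        unfold excess
        rw [hsplit, h0, add_zero]
      rw [hex]
      exact h w (Finset.mem_erase.2 ⟨hwz, hw⟩)

lemma Adm.solvable_of_exempt {n : ℤ} (hk : 2 ≤ k)
    (IH : ∀ (J : Rooted α ι) y, J.Adm k y → J.size k < n → J.Solvable k)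
    (hI : I.Adm k (some z)) (hS : I.Slack k) (hn : I.size k < n + 1) (hW : I.W ≠ {z}) :
    I.Solvable k := by
  have hz := (hI.exempt z rfl).1
  have hp := hI.p_nonneg z hz
  have hq := hI.q_nonneg z hz
  by_cases hp1 : 1 ≤ I.p z
  · by_cases hq1 : 1 ≤ I.q z
    · exact hI.solvable_of_exempt_both hk IH hS hn hp1 hq1
    · exact hI.solvable_of_exempt_arc hk IH hS hn hp1 (by omega)
  · by_cases hq1 : 1 ≤ I.q z
    · exact ((hI.neg hk).solvable_of_exempt_arc hk IH (hS.neg hk) (by rwa [size_neg]) hq1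
        (show I.p z = 0 by omega)).of_neg
    · by_cases h : ∃ e ∈ I.E, ∃ u, Joins I.s I.t e z u ∧ u ≠ z
      · obtain ⟨e, he, y, hj, hy⟩ := h
        by_cases h' : ∃ f ∈ I.E, ∃ u, Joins I.s I.t f z u ∧ u ≠ z ∧ u ≠ y
        · obtain ⟨f, hf, u, hju, huz, huy⟩ := h'
          exact hI.solvable_of_exempt_lift hk IH hS hn (by omega) (by omega) he hf hj hju hy huz
            huy.symm
        · push Not at h'
          exact hI.solvable_of_exempt_remove hk IH hn (by omega) (by omega)
            (hj.mem hI.ends he).2 hy h'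
      · push Not at h
        obtain ⟨y, hy, hyz⟩ : ∃ y ∈ I.W, y ≠ z := by
          by_contra hc
          push Not at hc
          exact hW (Finset.eq_singleton_iff_unique_mem.2 ⟨hz, hc⟩)
        exact hI.solvable_of_exempt_remove hk IH hn (by omega) (by omega) hy hyz
          fun e he u hju huz => absurd (h e he u hju) huz

/-- A vertex of zero demand can be made exempt. -/
lemma Adm.exempt_of_dvd (hI : I.Adm k none) {v : α} (hv : v ∈ I.W)
    (hb : 2 * k ∣ I.b v) (h2 : 2 ≤ I.W.card) : I.Adm k (some v) := by
  refine ⟨hI.nonempty, hI.ends, hI.p_nonneg, hI.q_nonneg, hI.parity, hI.total, hI.root,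
    fun A h1 h2 h3 _ => hI.cuts A h1 h2 h3 (by simp), ?_⟩
  rintro z hz
  obtain rfl := Option.some_inj.1 hz
  refine ⟨hv, hb, ?_⟩
  -- Zero demand at `v` gives `W` and `W.erase v` the same norm. The cut condition for the latter
  -- against the root condition bounds the arcs at `v` by its edges.
  have h3 := hI.cuts (I.W.erase v) (Finset.erase_subset _ _) (by
    rw [← Finset.card_pos, Finset.card_erase_of_mem hv]; omega)
    (fun h => Finset.notMem_erase v I.W (by rw [h]; exact hv)) (by simp)
  have h4 := hI.root
  have h5 : I.dem I.W = I.b v + I.dem (I.W.erase v) := (Finset.add_sum_erase _ _ hv).symm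
  have h6 : nrm k (I.dem I.W) = nrm k (I.dem (I.W.erase v)) :=
    nrm_congr (dvd_of_dvd_eq hb (by rw [h5]; ring))
  have h7 := Finset.add_sum_erase I.W (fun v => I.p v + I.q v) hv
  rw [hI.cut_univ, ← h7, h6] at h4
  have h8 := cutE_compl hI.ends {v}
  rw [Finset.sdiff_singleton_eq_erase] at h8
  unfold cut at h3
  rw [h8] at h3
  have h9 := hI.p_nonneg v hv
  have h10 := hI.q_nonneg v hv
  rw [abs_le]; constructor <;> linarith

/-- With positive demands only, an arc into the root can be removed and an arc out of it flipped. If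
there are no arcs at all, an edge is turned into an arc. -/
lemma Adm.solvable_of_pos {n : ℤ} (hk : 2 ≤ k)
    (IH : ∀ (J : Rooted α ι) y, J.Adm k y → J.size k < n → J.Solvable k)
    (hI : I.Adm k none) (hS : I.Slack k) (hn : I.size k < n + 1) (h2 : 2 ≤ I.W.card)
    (hP : ∀ v ∈ I.W, 1 ≤ I.b v % (2 * k) ∧ I.b v % (2 * k) ≤ k) : I.Solvable k := by
  by_cases hq : ∃ v ∈ I.W, 1 ≤ I.q v
  · obtain ⟨v, hv, hq⟩ := hq
    exact hI.solvable_of_arc hk IH hS hn hv hq (hP v hv).1 (hP v hv).2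
  have hq0 : ∀ v ∈ I.W, I.q v = 0 := by
    push Not at hq
    intro v hv
    have := hq v hv
    have := hI.q_nonneg v hv
    omega
  by_cases hp : ∃ v ∈ I.W, 1 ≤ I.p v
  · obtain ⟨v, hv, hp⟩ := hp
    exact hI.solvable_of_flip hk IH hS hn h2 hq0 hP hv hp
  have hp0 : ∀ v ∈ I.W, I.p v = 0 := by
    push Not at hp
    intro v hv
    have := hp v hv
    have := hI.p_nonneg v hv
    omega
  obtain ⟨a, ha⟩ := hI.nonempty
  have hne : ({a} : Finset α) ≠ I.W := by
    intro h; rw [← h, Finset.card_singleton] at h2; omega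
  obtain ⟨e, he, u, v, hj, hu, -, hv⟩ :=
    hI.exists_edge hk (Finset.singleton_subset_iff.2 ha) (Finset.singleton_nonempty a) hne
  have huv : u ≠ v := by rintro rfl; exact hv hu
  have huW := (hj.mem hI.ends he).1
  refine hI.solvable_of_pull hk IH hS hn he hj huv ?_ (hP u huW).1 (hP u huW).2
  rw [hI.cut_univ]
  exact Finset.sum_eq_zero fun v hv => by rw [hp0 v hv, hq0 v hv, add_zero]

lemma emod_neg_of_pos {k b : ℤ} (hk : 2 ≤ k) (h : 1 ≤ b % (2 * k)) :
    (-b) % (2 * k) = 2 * k - b % (2 * k) := by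
  have h2 := Int.emod_lt_of_pos b (show 0 < 2 * k by omega)
  refine emod_of_dvd_sub ?_ (by omega) (by omega)
  exact dvd_of_dvd_eq (dvd_sub ((dvd_neg).2 (dvd_sub_emod k b)) (dvd_refl (2 * k))) (by ring)

/-- Admissible instances are solvable (Lovász, Thomassen, Wu and Zhang). -/
theorem Adm.solvable (hk : 2 ≤ k) (hI : I.Adm k x) : I.Solvable k := by
  have key : ∀ n : ℕ, ∀ (I : Rooted α ι) x, I.Adm k x → I.size k < n → I.Solvable k := by
    intro n
    induction n with
    | zero =>
      intro I x hI hn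
      exfalso
      have h1 : 0 ≤ ∑ v ∈ I.W, (I.p v + I.q v) :=
        Finset.sum_nonneg fun v hv => add_nonneg (hI.p_nonneg v hv) (hI.q_nonneg v hv)
      have h2 : 0 ≤ (k + 2) * ((I.W.card : ℤ) + I.E.card) := by positivity
      unfold size at hn
      push_cast at hn
      linarith
    | succ n IH =>
      intro I x hI hn
      push_cast at hn
      by_cases h1 : I.W.card = 1
      · obtain ⟨v, hv⟩ := Finset.card_eq_one.1 h1
        exact hI.solvable_of_card_one hk hv
      have h2 : 2 ≤ I.W.card := by have := hI.nonempty.card_pos; omega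
      by_cases ht : ∃ A ⊆ I.W, 2 ≤ A.card ∧ A ≠ I.W ∧ I.cut A ≤ 2 * (k - 1) + nrm k (I.dem A)
      · obtain ⟨A, hA, hA2, hne, hA'⟩ := ht
        exact hI.solvable_of_tight hk IH (by omega) hA hA2 hne hA'
      have hS := hI.slack ht
      have hWz : ∀ z, I.W ≠ {z} := fun z h => h1 (by rw [h, Finset.card_singleton])
      cases x with
      | some z => exact hI.solvable_of_exempt hk IH hS hn (hWz z)
      | none =>
      by_cases hv : ∃ v ∈ I.W, 2 * k ∣ I.b v
      · obtain ⟨v, hv, hb⟩ := hv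
        exact (hI.exempt_of_dvd hv hb h2).solvable_of_exempt hk IH hS hn (hWz v)
      have hpos : ∀ v ∈ I.W, 1 ≤ I.b v % (2 * k) := by
        intro v hvW
        have h3 := Int.emod_nonneg (I.b v) (show (2 * k) ≠ 0 by omega)
        by_contra hc
        exact hv ⟨v, hvW, Int.dvd_of_emod_eq_zero (by omega)⟩
      -- No demand is zero now. If all have the same sign, possibly after reversal, the positive
      -- case applies; otherwise connectedness yields an edge from a positive to a negative vertex.
      by_cases hP : ∀ v ∈ I.W, I.b v % (2 * k) ≤ k
      · exact hI.solvable_of_pos hk IH hS hn h2 fun v hv => ⟨hpos v hv, hP v hv⟩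
      by_cases hN : ∀ v ∈ I.W, k + 1 ≤ I.b v % (2 * k)
      · refine ((hI.neg hk).solvable_of_pos hk IH (hS.neg hk) (by rwa [size_neg]) h2 ?_).of_neg
        intro v hv
        have h3 := hN v hv
        have h4 := Int.emod_lt_of_pos (I.b v) (show 0 < 2 * k by omega)
        change 1 ≤ (-I.b v) % (2 * k) ∧ (-I.b v) % (2 * k) ≤ k
        rw [emod_neg_of_pos hk (hpos v hv)]
        omega
      push Not at hP hN
      obtain ⟨a, ha, ha'⟩ := hP
      obtain ⟨c, hc, hc'⟩ := hN
      obtain ⟨e, he, u, v, hj, hu, hvW, hv'⟩ := hI.exists_edge hk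
        (A := I.W.filter fun v => I.b v % (2 * k) ≤ k) (Finset.filter_subset _ _)
        ⟨c, Finset.mem_filter.2 ⟨hc, by omega⟩⟩ (fun h => by
          rw [← h] at ha; exact absurd (Finset.mem_filter.1 ha).2 (by omega))
      have hu' := Finset.mem_filter.1 hu
      refine hI.solvable_of_edge hk IH hS (by omega) he hj (hpos u hu'.1) hu'.2 ?_
      by_contra hc
      exact hv' (Finset.mem_filter.2 ⟨hvW, by omega⟩)
  exact key ((I.size k).toNat + 1) I x hI (by push_cast; omega)

end Rooted

/-! ### Removing a vertex of small degree while colour classes stay connected. -/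

section Colored
variable {α ι : Type*} [DecidableEq α] [DecidableEq ι] {W : Finset α} {E : Finset ι}
  {s t : ι → α} {c : ι → ℕ} {b : α → ℤ} {k : ℤ} {N : ℕ} {v : α} {T : Finset ℕ} {e f : ι}

/-- The edges of colour `i` cross every nontrivial cut of `W`. -/
def Connecting (W : Finset α) (E : Finset ι) (s t : ι → α) (c : ι → ℕ) (i : ℕ) : Prop :=
  ∀ A ⊆ W, A.Nonempty → A ≠ W → ∃ e ∈ E, c e = i ∧ ¬ (s e ∈ A ↔ t e ∈ A)

/-- The edge `e` is not a loop, and `v` is an end of it. -/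
def At (s t : ι → α) (v : α) (e : ι) : Prop := ¬ (s e = v ↔ t e = v)

instance : DecidablePred (At s t v) := fun _ => inferInstanceAs (Decidable (¬ _))

lemma At.exists_joins (h : At s t v e) : ∃ x, x ≠ v ∧ Joins s t e v x := by
  unfold At at h
  by_cases h1 : s e = v
  · exact ⟨t e, fun h2 => h (by simp [h1, h2]), Or.inl ⟨h1, rfl⟩⟩
  · exact ⟨s e, h1, Or.inr ⟨rfl, by_contra fun h2 => h (by simp [h1, h2])⟩⟩

lemma Joins.at {x : α} (h : Joins s t e v x) (hx : x ≠ v) : At s t v e := by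
  unfold At
  rcases h with ⟨h1, h2⟩ | ⟨h1, h2⟩ <;> simp [h1, h2, hx]

lemma cutE_singleton (E : Finset ι) (s t : ι → α) (v : α) :
    cutE E s t {v} = (E.filter (At s t v)).card := by
  unfold cutE crosses
  rw [Finset.card_filter]
  push_cast
  refine Finset.sum_congr rfl fun e _ => ?_
  unfold At
  simp only [Finset.mem_singleton]
  split_ifs <;> simp_all

lemma cutE_filter_not_at {A : Finset α} (hv : v ∉ A) :
    cutE E s t A = cutE (E.filter fun e => s e ≠ v ∧ t e ≠ v) s t A +
      cutE (E.filter (At s t v)) s t A := by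
  unfold cutE
  rw [Finset.sum_filter, Finset.sum_filter, ← Finset.sum_add_distrib]
  refine Finset.sum_congr rfl fun e _ => ?_
  unfold At
  by_cases h1 : s e = v <;> by_cases h2 : t e = v <;> simp [h1, h2]
  rw [crosses_eq_zero]; simp [h1, h2, hv]

lemma net_filter_not_at (σ τ : ι → ℤ) (w : α) :
    net E s t (fun e => if At s t v e then τ e else σ e) w =
      net (E.filter fun e => s e ≠ v ∧ t e ≠ v) s t σ w + net (E.filter (At s t v)) s t τ w := by
  unfold net
  rw [Finset.sum_filter, Finset.sum_filter, ← Finset.sum_add_distrib]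
  refine Finset.sum_congr rfl fun e _ => ?_
  unfold At
  by_cases h1 : s e = v <;> by_cases h2 : t e = v <;> simp [h1, h2]
  exact Or.inr (by simp [inc, h1, h2])

lemma cutE_parity (E : Finset ι) (s t : ι → α) {σ : ι → ℤ} (hσ : IsSign σ) (A : Finset α) :
    2 ∣ cutE E s t A - ∑ v ∈ A, net E s t σ v := by
  rw [sum_net]
  unfold cutE
  rw [← Finset.sum_sub_distrib]
  refine Finset.dvd_sum fun e _ => ?_
  unfold crosses
  rcases hσ e with h | h <;> by_cases h1 : s e ∈ A <;> by_cases h2 : t e ∈ A <;> simp [h, h1, h2]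

lemma Connecting.le_cutE (hN : ∀ i < N, Connecting W E s t c i) {A : Finset α} (hA : A ⊆ W)
    (hne : A.Nonempty) (hAW : A ≠ W) : (N : ℤ) ≤ cutE E s t A := by
  have h : cutE E s t A = (E.filter fun e => ¬ (s e ∈ A ↔ t e ∈ A)).card := by
    unfold cutE crosses
    rw [Finset.card_filter]
    push_cast
    exact Finset.sum_congr rfl fun e _ => by split_ifs <;> simp_all
  rw [h]
  have h2 := Finset.card_le_card_of_surjOn (s := E.filter fun e => ¬ (s e ∈ A ↔ t e ∈ A))
    (t := Finset.range N) c (by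
      intro i hi
      obtain ⟨e, he, hc, hcr⟩ := hN i (by simpa using hi) A hA hne hAW
      exact ⟨e, by simp [he, hcr], hc⟩)
  rw [Finset.card_range] at h2
  exact_mod_cast h2

/-- An orientation that meets the demand modulo `2 * k`, optimally at `v`, and in which no vertex
other than `v` is a source or sink. -/
def Good (k : ℤ) (W : Finset α) (E : Finset ι) (s t : ι → α) (b : α → ℤ) (v : α) : Prop :=
  ∃ σ, IsSign σ ∧ (∀ w ∈ W, 2 * k ∣ net E s t σ w - b w) ∧ |net E s t σ v| = nrm k (b v) ∧
    (2 ≤ (W.erase v).card → ∀ w ∈ W.erase v, |net E s t σ w| < cutE E s t {w})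

/-- The vertex `v` can be removed by lifting edges: the colours in `T` are those that occur
at `v`, apart from the free edges, whose colours are at least `N`. -/
structure Star (k : ℤ) (N : ℕ) (W : Finset α) (E : Finset ι) (s t : ι → α) (c : ι → ℕ)
    (b : α → ℤ) (v : α) (T : Finset ℕ) : Prop where
  mem : v ∈ W
  ends : ∀ e ∈ E, s e ∈ W ∧ t e ∈ W
  parity : ∀ A ⊆ W, 2 ∣ cutE E s t A - ∑ v ∈ A, b v
  total : 2 * k ∣ ∑ v ∈ W, b v
  lt : ∀ i ∈ T, i < N
  pos : ∀ i ∈ T, ∃ e ∈ E, c e = i ∧ At s t v e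
  colors : ∀ e ∈ E, At s t v e → c e < N → c e ∈ T
  conn : ∀ i < N, Connecting (W.erase v) E s t c i
  deg : cutE E s t {v} + nrm k (b v) ≤
    2 * ((E.filter fun e => At s t v e ∧ N ≤ c e).card + T.card)

/-- Undoing a lift keeps all net out-degrees and does not decrease the degree of any vertex other
than `v`, so no new source or sink appears. -/
lemma Good.of_lift {x y : α} (he : e ∈ E) (hf : f ∈ E) (hef : e ≠ f) (hex : Joins s t e v x)
    (hfy : Joins s t f v y)
    (h : Good k W (E.erase f) (Function.update s e x) (Function.update t e y) b v) :
    Good k W E s t b v := by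
  obtain ⟨σ, hσ, h1, h2, h3⟩ := h
  obtain ⟨τ, hτ, h⟩ := exists_net_lift he hf hef hex hfy hσ
  refine ⟨τ, hτ, fun w hw => by rw [h]; exact h1 w hw, by rw [h]; exact h2, fun hc w hw => ?_⟩
  rw [h]
  refine (h3 hc w hw).trans_le ?_
  have hwv : v ≠ w := (Finset.ne_of_mem_erase hw).symm
  rw [cutE_lift he hf hef hex hfy]
  simp only [Finset.mem_singleton, hwv, false_iff]
  by_cases hx : x = w <;> by_cases hy : y = w <;> simp [hx, hy] <;> omega

lemma crosses_compl_of_not_at (hE : ∀ e ∈ E, s e ∈ W ∧ t e ∈ W) {A : Finset α}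
    (he : e ∈ E) (hv : ¬ At s t v e) (h : ¬ (s e ∈ W.erase v \ A ↔ t e ∈ W.erase v \ A)) :
    ¬ (s e ∈ A ↔ t e ∈ A) := by
  unfold At at hv
  push Not at hv
  have := hE e he
  simp only [Finset.mem_sdiff, Finset.mem_erase, this.1, this.2, and_true] at h
  by_cases h1 : s e = v
  · simp [h1, hv.1 h1] at h
  · have h2 : t e ≠ v := fun h2 => h1 (hv.2 h2)
    simpa [h1, h2, not_iff_not] using h

/-- An edge of a colour that spans `W.erase v` can be found away from some edges at `v` that do not
cross the complement. -/
lemma Connecting.exists_not_at (hE : ∀ e ∈ E, s e ∈ W ∧ t e ∈ W) {i : ℕ}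
    (h : Connecting (W.erase v) E s t c i) {A : Finset α} (hA : A ⊆ W.erase v) (hne : A.Nonempty)
    (hAW : A ≠ W.erase v)
    (hin : ∀ e ∈ E, c e = i → ∀ x, x ≠ v → Joins s t e v x → x ∈ A) :
    ∃ e ∈ E, c e = i ∧ ¬ At s t v e ∧ ¬ (s e ∈ A ↔ t e ∈ A) := by
  obtain ⟨e, he, hce, hcr⟩ := h (W.erase v \ A) Finset.sdiff_subset
    (Finset.sdiff_nonempty.2 fun h => hAW (hA.antisymm h)) (by
      intro h'
      obtain ⟨a, ha⟩ := hne
      have : a ∈ W.erase v \ A := by rw [h']; exact hA ha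
      exact (Finset.mem_sdiff.1 this).2 ha)
  have hat : ¬ At s t v e := by
    intro hat
    obtain ⟨x, hx, hj⟩ := hat.exists_joins
    have hxA := hin e he hce x hx hj
    apply hcr
    rcases hj with ⟨h1, h2⟩ | ⟨h1, h2⟩ <;> rw [h1, h2] <;> simp [hxA]
  exact ⟨e, he, hce, hat, crosses_compl_of_not_at hE he hat hcr⟩

/-- Only colour `i` can be affected, since `f` is free or has colour `i` as well. The degree of `v`
drops by two, so the count of free edges and colours in `T` may drop by one. -/
lemma Star.lift (hS : Star k N W E s t c b v T) {x y : α} (he : e ∈ E) (hf : f ∈ E) (hef : e ≠ f)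
    (hex : Joins s t e v x) (hfy : Joins s t f v y) (hx : x ≠ v) (hy : y ≠ v) {i : ℕ}
    (hc : c e = i) (hi : i < N) (hcf : N ≤ c f ∨ c f = i) {T' : Finset ℕ}
    (hT : T' ⊆ T) (hT' : ∀ j ∈ T, j ∉ T' → j = i)
    (hpos : i ∈ T' → ∃ h ∈ E, h ≠ e ∧ h ≠ f ∧ c h = i ∧ At s t v h)
    (hnone : i ∉ T' → ∀ h ∈ E, c h = i → At s t v h → h = e ∨ h = f)
    (hdeg : (E.filter fun e => At s t v e ∧ N ≤ c e).card + T.card ≤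
      ((E.filter fun e => At s t v e ∧ N ≤ c e).erase f).card + T'.card + 1)
    (hconn : Connecting (W.erase v) (E.erase f) (Function.update s e x) (Function.update t e y) c i) :
    Star k N W (E.erase f) (Function.update s e x) (Function.update t e y) c b v T' := by
  have hxW := (hex.mem hS.ends he).2
  have hyW := (hfy.mem hS.ends hf).2
  have hat : ∀ h, At (Function.update s e x) (Function.update t e y) v h ↔ h ≠ e ∧ At s t v h := by
    intro h
    unfold At
    by_cases hh : h = e
    · subst hh; simp [hx, hy]
    · rw [Function.update_of_ne hh, Function.update_of_ne hh]; simp [hh]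
  refine ⟨hS.mem, lift_ends hS.ends hxW hyW, ?_, hS.total, fun j hj => hS.lt j (hT hj), ?_, ?_, ?_,
    ?_⟩
  · intro A hA
    have := hS.parity A hA
    rw [cutE_lift he hf hef hex hfy]
    by_cases h1 : v ∈ A <;> by_cases h2 : x ∈ A <;> by_cases h3 : y ∈ A <;>
      simp only [h1, h2, h3, if_true, if_false, iff_true, iff_false, not_true_eq_false] <;> omega
  · intro j hj
    by_cases hji : j = i
    · subst hji
      obtain ⟨h, hh, h1, h2, h3, h4⟩ := hpos hj
      exact ⟨h, Finset.mem_erase.2 ⟨h2, hh⟩, h3, (hat h).2 ⟨h1, h4⟩⟩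
    · obtain ⟨h, hh, h1, h2⟩ := hS.pos j (hT hj)
      have hj := hS.lt j (hT hj)
      refine ⟨h, Finset.mem_erase.2 ⟨?_, hh⟩, h1, (hat h).2 ⟨?_, h2⟩⟩
      · rintro rfl; omega
      · rintro rfl; omega
  · intro h hh h1 h2
    rw [hat] at h1
    obtain ⟨hhf, hh⟩ := Finset.mem_erase.1 hh
    by_contra hcon
    have h3 := hT' _ (hS.colors h hh h1.2 h2) hcon
    rcases hnone (h3 ▸ hcon) h hh h3 h1.2 with h4 | h4
    · exact h1.1 h4
    · exact hhf h4
  · intro j hj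
    by_cases hji : j = i
    · subst hji; exact hconn
    · intro A hA hne hAW
      obtain ⟨h, hh, h1, h2⟩ := hS.conn j hj A hA hne hAW
      refine ⟨h, Finset.mem_erase.2 ⟨?_, hh⟩, h1, ?_⟩
      · rintro rfl; omega
      · have : h ≠ e := by rintro rfl; omega
        rwa [Function.update_of_ne this, Function.update_of_ne this]
  · have h1 : ((E.erase f).filter fun h =>
        At (Function.update s e x) (Function.update t e y) v h ∧ N ≤ c h) =
        (E.filter fun e => At s t v e ∧ N ≤ c e).erase f := by
      ext h
      simp only [Finset.mem_filter, Finset.mem_erase, hat]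
      constructor
      · rintro ⟨⟨h1, h2⟩, ⟨h3, h4⟩, h5⟩; exact ⟨h1, h2, h4, h5⟩
      · rintro ⟨h1, h2, h3, h4⟩
        exact ⟨⟨h1, h2⟩, ⟨by rintro rfl; omega, h3⟩, h4⟩
    rw [h1, cutE_lift he hf hef hex hfy]
    have h2 := hS.deg
    simp only [Finset.mem_singleton, hx, hy, true_iff, if_false]
    simp only [if_true]
    have h3 : ((E.filter fun e => At s t v e ∧ N ≤ c e).card : ℤ) + T.card ≤
      ((E.filter fun e => At s t v e ∧ N ≤ c e).erase f).card + T'.card + 1 := by exact_mod_cast hdeg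
    linarith

/-- Here `v` is a leaf of colour `i`, so `e` is not needed to connect the remaining vertices. It
becomes free as `i` leaves `T`, and the degree bound is unaffected. -/
lemma Star.recolor (hS : Star k N W E s t c b v T) {i : ℕ} (hi : i ∈ T) (he : e ∈ E)
    (hc : c e = i) (hat : At s t v e) (huniq : ∀ h ∈ E, c h = i → At s t v h → h = e) :
    Star k N W E s t (Function.update c e N) b v (T.erase i) := by
  have hiN := hS.lt i hi
  refine ⟨hS.mem, hS.ends, hS.parity, hS.total, fun j hj => hS.lt j (Finset.mem_of_mem_erase hj),
    ?_, ?_, ?_, ?_⟩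
  · intro j hj
    obtain ⟨hji, hj⟩ := Finset.mem_erase.1 hj
    obtain ⟨h, hh, h1, h2⟩ := hS.pos j hj
    refine ⟨h, hh, ?_, h2⟩
    rw [Function.update_of_ne (by rintro rfl; omega)]; exact h1
  · intro h hh h1 h2
    have hhe : h ≠ e := by rintro rfl; rw [Function.update_self] at h2; omega
    rw [Function.update_of_ne hhe] at h2 ⊢
    exact Finset.mem_erase.2 ⟨fun h3 => hhe (huniq h hh h3 h1), hS.colors h hh h1 h2⟩
  · intro j hj A hA hne hAW
    suffices ∃ h ∈ E, h ≠ e ∧ c h = j ∧ ¬ (s h ∈ A ↔ t h ∈ A) by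
      obtain ⟨h, hh, h1, h2, h3⟩ := this
      exact ⟨h, hh, by rw [Function.update_of_ne h1]; exact h2, h3⟩
    obtain ⟨x, hx, hjx⟩ := hat.exists_joins
    -- If `e` leaves `A`, the complement of `A` in `W.erase v` supplies another edge of its colour.
    by_cases hxA : x ∈ A
    · by_cases hji : j = i
      · subst hji
        obtain ⟨h, hh, h1, h2, h3⟩ := (hS.conn j hj).exists_not_at hS.ends hA hne hAW (by
          intro h hh h1 y hy hjy
          obtain rfl := huniq h hh h1 (hjy.at hy)
          rcases hjy with ⟨h2, h3⟩ | ⟨h2, h3⟩ <;> rcases hjx with ⟨h4, h5⟩ | ⟨h4, h5⟩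
          · rw [← h3, h5]; exact hxA
          · exact absurd (h3.symm.trans h5) hy
          · exact absurd (h2.symm.trans h4) hy
          · rw [← h2, h4]; exact hxA)
        exact ⟨h, hh, by rintro rfl; exact h2 hat, h1, h3⟩
      · obtain ⟨h, hh, h1, h2⟩ := hS.conn j hj A hA hne hAW
        exact ⟨h, hh, by rintro rfl; omega, h1, h2⟩
    · obtain ⟨h, hh, h1, h2⟩ := hS.conn j hj A hA hne hAW
      refine ⟨h, hh, ?_, h1, h2⟩
      rintro rfl
      have hvA : v ∉ A := fun h' => Finset.notMem_erase v W (hA h')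
      apply h2
      rcases hjx with ⟨h4, h5⟩ | ⟨h4, h5⟩ <;> rw [h4, h5] <;> simp [hxA, hvA]
  · have h1 : (E.filter fun h => At s t v h ∧ N ≤ Function.update c e N h) =
        insert e (E.filter fun h => At s t v h ∧ N ≤ c h) := by
      ext h
      by_cases hh : h = e
      · subst hh; simp [he, hat]
      · simp [hh]
    have h2 : e ∉ E.filter fun h => At s t v h ∧ N ≤ c h := by
      simp only [Finset.mem_filter, not_and, not_le]; intros; omega
    have h3 : ((T.erase i).card : ℤ) + 1 = T.card := by exact_mod_cast Finset.card_erase_add_one hi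
    rw [h1, Finset.card_insert_of_notMem h2]
    have h4 := hS.deg
    push_cast
    linarith

/-- A set that the lifted class fails to leave was left by `e` alone, so it contains `x`; the new
edge `xy` does not leave it, so it contains `y`. -/
lemma exists_of_not_connecting_lift (hS : Star k N W E s t c b v T) {x y : α} {i : ℕ} (hi : i < N)
    (hex : Joins s t e v x) (he : e ∈ E) (hc : c e = i) (hcf : c f ≠ i)
    (h : ¬ Connecting (W.erase v) (E.erase f) (Function.update s e x) (Function.update t e y) c i) :
    ∃ A ⊆ W.erase v, A ≠ W.erase v ∧ x ∈ A ∧ y ∈ A ∧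
      ∀ h ∈ E, c h = i → h ≠ e → (s h ∈ A ↔ t h ∈ A) := by
  unfold Connecting at h
  push Not at h
  obtain ⟨A, hA, hne, hAW, h⟩ := h
  have h1 : ∀ h ∈ E, c h = i → h ≠ e → (s h ∈ A ↔ t h ∈ A) := by
    intro g hg hgc hge
    have := h g (Finset.mem_erase.2 ⟨by rintro rfl; exact hcf hgc, hg⟩) hgc
    rwa [Function.update_of_ne hge, Function.update_of_ne hge] at this
  have h2 := h e (Finset.mem_erase.2 ⟨by rintro rfl; exact hcf hc, he⟩) hc
  rw [Function.update_self, Function.update_self] at h2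
  obtain ⟨g, hg, hgc, hcr⟩ := hS.conn i hi A hA hne hAW
  have hge : g = e := by_contra fun hge => hcr (h1 g hg hgc hge)
  subst hge
  have hvA : v ∉ A := fun h' => Finset.notMem_erase v W (hA h')
  have hxA : x ∈ A := by
    by_contra hxA
    apply hcr
    rcases hex with ⟨h4, h5⟩ | ⟨h4, h5⟩ <;> rw [h4, h5] <;> simp [hxA, hvA]
  exact ⟨A, hA, hAW, hxA, h2.1 hxA, h1⟩

/-- A free edge can be lifted with one of two edges of the same colour. -/
lemma Star.connecting_lift (hS : Star k N W E s t c b v T) {x₁ x₂ y : α} {e₁ e₂ : ι} {i : ℕ}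
    (hi : i < N) (h1 : Joins s t e₁ v x₁) (h2 : Joins s t e₂ v x₂) (he₁ : e₁ ∈ E)
    (he₂ : e₂ ∈ E) (hc₁ : c e₁ = i) (hc₂ : c e₂ = i) (hne : e₁ ≠ e₂) (hcf : c f ≠ i) :
    Connecting (W.erase v) (E.erase f) (Function.update s e₁ x₁) (Function.update t e₁ y) c i ∨
    Connecting (W.erase v) (E.erase f) (Function.update s e₂ x₂) (Function.update t e₂ y) c i := by
  by_contra hcon
  push Not at hcon
  obtain ⟨A, hA, hAW, hxA, hyA, hA'⟩ :=
    exists_of_not_connecting_lift hS hi h1 he₁ hc₁ hcf hcon.1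
  obtain ⟨B, hB, hBW, hxB, hyB, hB'⟩ :=
    exists_of_not_connecting_lift hS hi h2 he₂ hc₂ hcf hcon.2
  have hvA : v ∉ A := fun h' => Finset.notMem_erase v W (hA h')
  have hvB : v ∉ B := fun h' => Finset.notMem_erase v W (hB h')
  -- Uncrossing: only `e₁` leaves `A` within its colour, only `e₂` leaves `B`, and neither leaves
  -- the other set. So nothing of this colour leaves `A ∩ B`, although it contains `y`.
  obtain ⟨g, hg, hgc, hcr⟩ := hS.conn i hi (A ∩ B) (Finset.inter_subset_left.trans hA)
    ⟨y, Finset.mem_inter.2 ⟨hyA, hyB⟩⟩ fun h => hAW (hA.antisymm (h ▸ Finset.inter_subset_left))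
  apply hcr
  simp only [Finset.mem_inter]
  by_cases hg1 : g = e₁
  · have h3 := hB' e₁ he₁ hc₁ hne
    subst hg1
    rcases h1 with ⟨h4, h5⟩ | ⟨h4, h5⟩ <;> rw [h4, h5] at h3 ⊢ <;> simp_all
  · by_cases hg2 : g = e₂
    · have h3 := hA' e₂ he₂ hc₂ hne.symm
      subst hg2
      rcases h2 with ⟨h4, h5⟩ | ⟨h4, h5⟩ <;> rw [h4, h5] at h3 ⊢ <;> simp_all
    · rw [hA' g hg hgc hg1, hB' g hg hgc hg2]

/-- A demand on a graph with `N` connected spanning colour classes. -/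
structure Colored (k : ℤ) (N : ℕ) (W : Finset α) (E : Finset ι) (s t : ι → α) (c : ι → ℕ)
    (b : α → ℤ) : Prop where
  ends : ∀ e ∈ E, s e ∈ W ∧ t e ∈ W
  parity : ∀ A ⊆ W, 2 ∣ cutE E s t A - ∑ v ∈ A, b v
  total : 2 * k ∣ ∑ v ∈ W, b v
  conn : ∀ i < N, Connecting W E s t c i

/-- There is an orientation that meets the demand modulo `2 * k` without sources and sinks. -/
def Orients (k : ℤ) (W : Finset α) (E : Finset ι) (s t : ι → α) (b : α → ℤ) : Prop :=
  ∃ σ, IsSign σ ∧ (∀ v ∈ W, 2 * k ∣ net E s t σ v - b v) ∧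
    (2 ≤ W.card → ∀ v ∈ W, |net E s t σ v| < cutE E s t {v})

/-- All edges at `v` are free, so the degree bound says that the degree is at least the norm. They
can then be directed with net out-degree the least residue of the demand, and the rest of the graph
takes over the corrected demands. -/
lemma Star.good_of_empty (hk : 2 ≤ k)
    (IH : ∀ E s t c b, Colored (ι := ι) k N (W.erase v) E s t c b → Orients k (W.erase v) E s t b)
    (hS : Star k N W E s t c b v ∅) : Good k W E s t b v := by
  set G := E.filter fun e => s e ≠ v ∧ t e ≠ v with hG
  set F := E.filter (At s t v) with hF
  obtain ⟨r, hr, hr'⟩ := exists_nrm hk (b v)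
  have hpar := hS.parity {v} (Finset.singleton_subset_iff.2 hS.mem)
  rw [Finset.sum_singleton, cutE_singleton, ← hF] at hpar
  obtain ⟨τ, hτ, hτr⟩ := exists_sign_sum F (fun e => inc s t e v) (by
    intro e he
    have := (Finset.mem_filter.1 he).2
    unfold At at this
    unfold inc
    by_cases h1 : s e = v <;> by_cases h2 : t e = v <;> simp_all) r (by
    have h1 := hS.deg
    rw [cutE_singleton, ← hF] at h1
    have h2 : ((E.filter fun e => At s t v e ∧ N ≤ c e).card : ℤ) ≤ F.card := by
      refine mod_cast Finset.card_le_card fun e he => ?_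
      obtain ⟨h3, h4, h5⟩ := Finset.mem_filter.1 he
      exact Finset.mem_filter.2 ⟨h3, h4⟩
    rw [Finset.card_empty] at h1
    push_cast at h1
    linarith) (by
    obtain ⟨j, hj⟩ := (Dvd.intro k rfl : (2 : ℤ) ∣ 2 * k).trans hr
    omega)
  have hnot : ∀ {A}, A ⊆ W.erase v → v ∉ A := fun h h' => Finset.notMem_erase v W (h h')
  have hC : Colored k N (W.erase v) G s t c (fun w => b w - net F s t τ w) := by
    refine ⟨?_, ?_, ?_, ?_⟩
    · intro e he
      obtain ⟨h1, h2, h3⟩ := Finset.mem_filter.1 he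
      exact ⟨Finset.mem_erase.2 ⟨h2, (hS.ends e h1).1⟩, Finset.mem_erase.2 ⟨h3, (hS.ends e h1).2⟩⟩
    · intro A hA
      have h1 := hS.parity A (hA.trans (Finset.erase_subset _ _))
      have h2 := cutE_parity F s t hτ A
      rw [cutE_filter_not_at (hnot hA), ← hG, ← hF] at h1
      rw [Finset.sum_sub_distrib]
      omega
    · have h1 := Finset.add_sum_erase W b hS.mem
      have h2 := sum_net_eq_zero (E := F) (fun e he => hS.ends e (Finset.mem_filter.1 he).1) τ
      have h3 := Finset.add_sum_erase W (net F s t τ) hS.mem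
      have h4 : net F s t τ v = r := hτr
      rw [Finset.sum_sub_distrib]
      exact dvd_of_dvd_eq (dvd_sub hS.total hr) (by linarith)
    · intro i hi A hA hne hAW
      obtain ⟨e, he, hce, hcr⟩ := hS.conn i hi A hA hne hAW
      refine ⟨e, Finset.mem_filter.2 ⟨he, ?_⟩, hce, hcr⟩
      have hat : ¬ At s t v e := fun hat =>
        absurd (hS.colors e he hat (hce ▸ hi)) (Finset.notMem_empty _)
      unfold At at hat
      push Not at hat
      have h1 : s e ≠ v := fun h => hcr (by rw [h, hat.1 h])
      exact ⟨h1, fun h => h1 (hat.2 h)⟩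
  obtain ⟨σ, hσ, h1, h2⟩ := IH _ _ _ _ _ hC
  have hnet := net_filter_not_at (E := E) (s := s) (t := t) (v := v) σ τ
  rw [← hG, ← hF] at hnet
  have hv : net E s t (fun e => if At s t v e then τ e else σ e) v = r := by
    rw [hnet]
    have : net G s t σ v = 0 := Finset.sum_eq_zero fun e he => by
      obtain ⟨-, h3, h4⟩ := Finset.mem_filter.1 he
      rw [inc_eq_zero h3 h4, mul_zero]
    rw [this, zero_add]; exact hτr
  refine ⟨fun e => if At s t v e then τ e else σ e, fun e => ?_, fun w hw => ?_, by rw [hv]; exact hr',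
    fun hc w hw => ?_⟩
  · dsimp only; split_ifs
    · exact hτ e
    · exact hσ e
  · by_cases hwv : w = v
    · subst hwv; rw [hv, ← dvd_neg]; exact dvd_of_dvd_eq hr (by ring)
    · rw [hnet]
      exact dvd_of_dvd_eq (h1 w (Finset.mem_erase.2 ⟨hwv, hw⟩)) (by ring)
  -- Strictness comes from the smaller graph; the edges to `v` add at most their number.
  · rw [hnet, cutE_filter_not_at (v := v) (by
      simpa using (Finset.ne_of_mem_erase hw).symm)]
    have h3 := h2 hc w hw
    have h4 := abs_net_le F s t hτ w
    have h5 := abs_add_le (net G s t σ w) (net F s t τ w)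
    linarith

/-- Removal of a vertex of small degree. -/
lemma Star.good (hk : 2 ≤ k)
    (IH : ∀ E s t c b, Colored (ι := ι) k N (W.erase v) E s t c b → Orients k (W.erase v) E s t b)
    (hS : Star k N W E s t c b v T) : Good k W E s t b v := by
  -- Recolouring shrinks `T` and lifting shrinks `E`.
  obtain ⟨n, hn⟩ : ∃ n, E.card + T.card ≤ n := ⟨_, le_rfl⟩
  induction n generalizing E s t c T with
  | zero =>
    obtain rfl : T = ∅ := Finset.card_eq_zero.1 (by omega)
    exact hS.good_of_empty hk IH
  | succ n ih =>
  rcases T.eq_empty_or_nonempty with rfl | hTne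
  · exact hS.good_of_empty hk IH
  by_cases h1 : ∃ i ∈ T, ∃ e ∈ E, c e = i ∧ At s t v e ∧ ∀ h ∈ E, c h = i → At s t v h → h = e
  · obtain ⟨i, hi, e, he, hc, hat, huniq⟩ := h1
    refine ih (hS.recolor hi he hc hat huniq) ?_
    have := Finset.card_erase_add_one hi
    omega
  push Not at h1
  have h2 : ∀ i ∈ T, ∃ e ∈ E, ∃ f ∈ E, e ≠ f ∧ c e = i ∧ c f = i ∧ At s t v e ∧ At s t v f := by
    intro i hi
    obtain ⟨e, he, hc, hat⟩ := hS.pos i hi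
    obtain ⟨f, hf, hcf, hatf, hfe⟩ := h1 i hi e he hc hat
    exact ⟨e, he, f, hf, hfe.symm, hc, hcf, hat, hatf⟩
  -- Every colour in `T` now has two edges at `v`, so a free edge can be lifted with one of them.
  by_cases hg : ∃ g ∈ E, At s t v g ∧ N ≤ c g
  · obtain ⟨g, hg, hgat, hgc⟩ := hg
    obtain ⟨i, hi⟩ := hTne
    have hiN := hS.lt i hi
    obtain ⟨e, he, f, hf, hef, hce, hcf, hate, hatf⟩ := h2 i hi
    obtain ⟨x, hx, hjx⟩ := hate.exists_joins
    obtain ⟨x', hx', hjx'⟩ := hatf.exists_joins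
    obtain ⟨y, hy, hjy⟩ := hgat.exists_joins
    have key : ∀ {e f : ι} {x : α}, e ∈ E → f ∈ E → e ≠ f → c e = i → c f = i → At s t v f →
        Joins s t e v x → x ≠ v → Connecting (W.erase v) (E.erase g) (Function.update s e x)
          (Function.update t e y) c i → Good k W E s t b v := by
      intro e f x he hf hef hce hcf hatf hjx hx hcon
      have heg : e ≠ g := by rintro rfl; omega
      have hmem : g ∈ E.filter fun e => At s t v e ∧ N ≤ c e :=
        Finset.mem_filter.2 ⟨hg, hgat, hgc⟩
      have hS' := hS.lift he hg heg hjx hjy hx hy hce hiN (Or.inl hgc) (Finset.Subset.refl T)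
        (fun j hj hj' => absurd hj hj')
        (fun _ => ⟨f, hf, hef.symm, by rintro rfl; omega, hcf, hatf⟩) (fun h => absurd hi h)
        (by have := Finset.card_erase_add_one hmem; omega) hcon
      exact Good.of_lift he hg heg hjx hjy (ih hS' (by
        have := Finset.card_erase_add_one hg; omega))
    rcases hS.connecting_lift (f := g) (y := y) hiN hjx hjx' he hf hce hcf hef (by omega) with h | h
    · exact key he hf hef hce hcf hatf hjx hx h
    · exact key hf he hef.symm hcf hce hate hjx' hx' h
  have hfree : (E.filter fun e => At s t v e ∧ N ≤ c e) = ∅ := by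
    push Not at hg
    rw [Finset.filter_eq_empty_iff]
    rintro e he ⟨h3, h4⟩
    exact absurd (hg e he h3) (by omega)
  -- Without free edges the degree is at most `2 * T.card`, so some colour has exactly two edges at
  -- `v`. Lifting them with each other removes the colour from `v`.
  obtain ⟨i, hi, hi2⟩ : ∃ i ∈ T, ((E.filter (At s t v)).filter fun e => c e = i).card ≤ 2 := by
    by_contra hcon
    push Not at hcon
    have h3 : T.card * 3 ≤ ∑ i ∈ T, ((E.filter (At s t v)).filter fun e => c e = i).card :=
      Finset.card_nsmul_le_sum T _ 3 fun i hi => hcon i hi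
    rw [Finset.sum_card_fiberwise_eq_card_filter] at h3
    have h4 := Finset.card_filter_le (E.filter (At s t v)) (fun e => c e ∈ T)
    have h5 := hS.deg
    rw [hfree, cutE_singleton, Finset.card_empty] at h5
    have h6 := nrm_nonneg hk (b v)
    have h7 := hTne.card_pos
    omega
  have hiN := hS.lt i hi
  obtain ⟨e, he, f, hf, hef, hce, hcf, hate, hatf⟩ := h2 i hi
  obtain ⟨x, hx, hjx⟩ := hate.exists_joins
  obtain ⟨y, hy, hjy⟩ := hatf.exists_joins
  have hnone : ∀ h ∈ E, c h = i → At s t v h → h = e ∨ h = f := by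
    intro h hh hc hat
    by_contra hcon
    push Not at hcon
    have h3 : ({h, e, f} : Finset ι) ⊆ (E.filter (At s t v)).filter fun e => c e = i := by
      intro g hg
      simp only [Finset.mem_insert, Finset.mem_singleton] at hg
      simp only [Finset.mem_filter]
      rcases hg with rfl | rfl | rfl <;> tauto
    have h4 := Finset.card_le_card h3
    rw [Finset.card_eq_three.2 ⟨h, e, f, hcon.1, hcon.2, hef, rfl⟩] at h4
    omega
  have hS' := hS.lift he hf hef hjx hjy hx hy hce hiN (Or.inr hcf) (Finset.erase_subset i T)
    (fun j hj hj' => by_contra fun h => hj' (Finset.mem_erase.2 ⟨h, hj⟩))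
    (fun h => absurd h (Finset.notMem_erase i T)) (fun _ => hnone)
    (by
      have := Finset.card_erase_add_one hi
      rw [hfree]; simp only [Finset.card_empty, Finset.erase_empty]; omega) (by
      intro A hA hne hAW
      have hvA : v ∉ A := fun h' => Finset.notMem_erase v W (hA h')
      have hupd : ∀ h, h ≠ e → Function.update s e x h = s h ∧ Function.update t e y h = t h :=
        fun h hh => ⟨Function.update_of_ne hh _ _, Function.update_of_ne hh _ _⟩
      by_cases hxy : x ∈ A ↔ y ∈ A
      · suffices ∃ h ∈ E, c h = i ∧ ¬ At s t v h ∧ ¬ (s h ∈ A ↔ t h ∈ A) by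
          obtain ⟨h, hh, h3, h4, h5⟩ := this
          refine ⟨h, Finset.mem_erase.2 ⟨by rintro rfl; exact h4 hatf, hh⟩, h3, ?_⟩
          obtain ⟨h6, h7⟩ := hupd h (by rintro rfl; exact h4 hate)
          rwa [h6, h7]
        -- If `x` and `y` lie in `A`, neither `e` nor `f` leaves the complement in `W.erase v`; if
        -- both lie outside, neither leaves `A`.
        by_cases hxA : x ∈ A
        · refine (hS.conn i hiN).exists_not_at hS.ends hA hne hAW ?_
          intro h hh hc z hz hj
          rcases hnone h hh hc (hj.at hz) with rfl | rfl
          · have := hj.crosses_eq A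
            rw [hjx.crosses_eq A] at this
            by_contra hzA
            simp [hvA, hzA, hxA] at this
          · have := hj.crosses_eq A
            rw [hjy.crosses_eq A] at this
            by_contra hzA
            simp [hvA, hzA, hxy.1 hxA] at this
        · obtain ⟨h, hh, h3, h4⟩ := hS.conn i hiN A hA hne hAW
          refine ⟨h, hh, h3, fun hat => ?_, h4⟩
          rw [← crosses_eq_one] at h4
          rcases hnone h hh h3 hat with rfl | rfl
          · rw [hjx.crosses_eq] at h4
            simp [hvA, hxA] at h4
          · rw [hjy.crosses_eq] at h4
            simp [hvA, mt hxy.2 hxA] at h4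
      · refine ⟨e, Finset.mem_erase.2 ⟨hef, he⟩, hce, ?_⟩
        rwa [Function.update_self, Function.update_self])
  refine Good.of_lift he hf hef hjx hjy (ih hS' ?_)
  have h3 := Finset.card_erase_add_one hi
  have h4 := Finset.card_erase_add_one hf
  omega

end Colored

/-! ### Orientations without sources and sinks. -/

section Colored
variable {α ι : Type*} [DecidableEq α] [DecidableEq ι] {W : Finset α} {E : Finset ι}
  {s t : ι → α} {c : ι → ℕ} {b : α → ℤ} {k : ℤ} {N : ℕ}

lemma Colored.le_cutE_singleton (hC : Colored k N W E s t c b) (h2 : 2 ≤ W.card) {v : α}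
    (hv : v ∈ W) : (N : ℤ) ≤ cutE E s t {v} :=
  Connecting.le_cutE hC.conn (Finset.singleton_subset_iff.2 hv) (Finset.singleton_nonempty v)
    (by rintro h; rw [← h, Finset.card_singleton] at h2; omega)

lemma Colored.parity_singleton (hC : Colored k N W E s t c b) {v : α} (hv : v ∈ W) :
    2 ∣ cutE E s t {v} - b v := by
  simpa using hC.parity {v} (Finset.singleton_subset_iff.2 hv)

/-- At first all `N` colours occur at `v`. The vertex `v` is no source or sink, because `nrm k (b v)
≤ k < 2 * (k - 1)` and the degree is at least `N`; this needs `k ≥ 3`. -/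
lemma Colored.orients_of_small (hk : 3 ≤ k) (hN : (N : ℤ) = 2 * (k - 1))
    (hC : Colored k N W E s t c b) (h2 : 2 ≤ W.card) {v : α} (hv : v ∈ W)
    (IH : ∀ E s t c b, Colored (ι := ι) k N (W.erase v) E s t c b → Orients k (W.erase v) E s t b)
    (hsmall : cutE E s t {v} + nrm k (b v) ≤ 2 * N) : Orients k W E s t b := by
  have hcard := Finset.card_erase_add_one hv
  have hne : ({v} : Finset α) ≠ W := by
    rintro h; rw [← h, Finset.card_singleton] at h2; omega
  have hS : Star k N W E s t c b v (Finset.range N) := by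
    refine ⟨hv, hC.ends, hC.parity, hC.total, fun i hi => Finset.mem_range.1 hi, ?_,
      fun e _ _ h => Finset.mem_range.2 h, ?_, ?_⟩
    · intro i hi
      obtain ⟨e, he, hc, hcr⟩ := hC.conn i (Finset.mem_range.1 hi) {v}
        (Finset.singleton_subset_iff.2 hv) (Finset.singleton_nonempty v) hne
      refine ⟨e, he, hc, ?_⟩
      unfold At; simpa using hcr
    · intro i hi A hA hne _
      exact hC.conn i hi A (hA.trans (Finset.erase_subset _ _)) hne
        fun h => Finset.notMem_erase v W (hA (h ▸ hv))
    · rw [Finset.card_range]; linarith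
  obtain ⟨σ, hσ, h1, h3, h4⟩ := hS.good (by omega) IH
  have hvlt : |net E s t σ v| < cutE E s t {v} := by
    have := hC.le_cutE_singleton h2 hv
    have := nrm_le (show 2 ≤ k by omega) (b v)
    omega
  refine ⟨σ, hσ, h1, fun _ w hw => ?_⟩
  by_cases hwv : w = v
  · rw [hwv]; exact hvlt
  have hwe : w ∈ W.erase v := Finset.mem_erase.2 ⟨hwv, hw⟩
  by_cases h5 : 2 ≤ (W.erase v).card
  · exact h4 h5 w hwe
  -- The only other vertex has the same cut as `v` and the opposite net out-degree.
  obtain ⟨u, hu⟩ := Finset.card_eq_one.1 (show (W.erase v).card = 1 by omega)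
  obtain rfl : w = u := by simpa [hu] using hwe
  have h6 := sum_net_eq_zero hC.ends σ
  rw [← Finset.add_sum_erase W _ hv, hu, Finset.sum_singleton] at h6
  have h7 := cutE_compl hC.ends {v}
  rw [Finset.sdiff_singleton_eq_erase, hu] at h7
  rw [h7, show net E s t σ w = - net E s t σ v by linarith, abs_neg]
  exact hvlt

lemma Colored.contract (hC : Colored k N W E s t c b) {A : Finset α} (hA : A ⊆ W) {a : α}
    (ha : a ∈ A) : Colored k N (insert a (W \ A)) E (collapse A a ∘ s) (collapse A a ∘ t) c
      (Function.update b a (∑ v ∈ A, b v)) := by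
  refine ⟨fun e he => ⟨collapse_mem_insert (hC.ends e he).1, collapse_mem_insert (hC.ends e he).2⟩,
    ?_, ?_, ?_⟩
  · intro B hB
    rw [cutE_collapse hB, sum_update_expand ha hB]
    exact hC.parity _ (expand_subset hA ha hB)
  · rw [sum_update_expand ha Finset.Subset.rfl, expand_insert hA ha]; exact hC.total
  · intro i hi B hB hne hBW
    obtain ⟨e, he, hc, hcr⟩ := hC.conn i hi _ (expand_subset hA ha hB) (expand_nonempty hne)
      (expand_ne hA ha hB hBW)
    refine ⟨e, he, hc, ?_⟩
    rw [← crosses_eq_one] at hcr ⊢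
    rwa [crosses_collapse hB]

/-- If the cut condition holds everywhere then the theorem of Lovász, Thomassen, Wu and Zhang
applies. -/
lemma Colored.orients_of_cut (hk : 3 ≤ k) (hC : Colored k N W E s t c b) (hne : W.Nonempty)
    (hbig : ∀ v ∈ W, 2 * k ≤ cutE E s t {v})
    (hcut : ∀ A ⊆ W, A.Nonempty → A ≠ W → 2 * (k - 1) + nrm k (∑ v ∈ A, b v) ≤ cutE E s t A) :
    Orients k W E s t b := by
  let I : Rooted α ι := ⟨W, E, s, t, 0, 0, b⟩
  have hcutI : ∀ A, I.cut A = cutE E s t A := fun A => by simp [I, Rooted.cut]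
  have hI : I.Adm k none := by
    refine ⟨hne, hC.ends, fun _ _ => le_rfl, fun _ _ => le_rfl, ?_, ?_, ?_, ?_, by simp⟩
    · intro A hA; rw [hcutI]; exact hC.parity A hA
    · simpa [I, Rooted.dem] using hC.total
    · rw [hcutI]
      change cutE E s t W ≤ _
      rw [cutE_univ hC.ends]
      have := nrm_nonneg (show 2 ≤ k by omega) (I.dem I.W)
      omega
    · intro A hA h1 h2 _
      rw [hcutI]; exact hcut A hA h1 h2
  obtain ⟨σ, hσ, h⟩ := hI.solvable (by omega)
  have hex : ∀ v, I.excess σ v = net E s t σ v := fun v => by simp [I, Rooted.excess]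
  refine ⟨σ, hσ, fun v hv => ?_, fun _ v hv => ?_⟩
  · have := (h v hv).1; rwa [hex] at this
  · have := (h v hv).2
    rw [hex] at this
    have := hbig v hv
    omega

/-- Contract a minimal set that violates the cut condition. -/
lemma Colored.orients_of_violated (hk : 3 ≤ k) (hC : Colored k N W E s t c b)
    (hbig : ∀ v ∈ W, 2 * k ≤ cutE E s t {v}) {A : Finset α} (hA : A ⊆ W) (hA2 : 2 ≤ A.card)
    (hAW : A ≠ W) (hviol : cutE E s t A < 2 * (k - 1) + nrm k (∑ v ∈ A, b v))
    (hmin : ∀ B ⊆ A, B.Nonempty → B ≠ A → 2 * (k - 1) + nrm k (∑ v ∈ B, b v) ≤ cutE E s t B)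
    (IH : ∀ W' : Finset α, W'.card < W.card → ∀ E s t c b, Colored (ι := ι) k N W' E s t c b →
      Orients k W' E s t b) : Orients k W E s t b := by
  obtain ⟨a, ha⟩ := Finset.card_pos.1 (show 0 < A.card by omega)
  let I : Rooted α ι := ⟨W, E, s, t, 0, 0, b⟩
  have hcutI : ∀ A, I.cut A = cutE E s t A := fun A => by simp [I, Rooted.cut]
  obtain ⟨σ, hσ, h1, h2⟩ := IH _ (Rooted.card_contract (I := I) (a := a) hA hA2) _ _ _ _ _
    (hC.contract hA ha)
  change ∀ v ∈ insert a (W \ A), _ at h1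
  have hW2 : 2 ≤ (insert a (W \ A)).card := by
    rw [Finset.card_insert_of_notMem (by simp [ha])]
    have : (W \ A).Nonempty := Finset.sdiff_nonempty.2 fun h => hAW (hA.antisymm h)
    have := this.card_pos
    omega
  replace h2 := h2 hW2
  have hexc : ∀ v, (I.contract A a).excess σ v =
      net E (collapse A a ∘ s) (collapse A a ∘ t) σ v := by
    intro v
    simp [Rooted.excess, Rooted.contract, I]
  -- The violation at `A` is the root condition, and minimality of `A` is the cut condition.
  have hR : (I.restrict A σ).Adm k none := by
    refine ⟨⟨a, ha⟩, fun e he => (Finset.mem_filter.1 he).2,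
      fun v _ => add_nonneg le_rfl (inArcs_nonneg _ _),
      fun v _ => add_nonneg le_rfl (outArcs_nonneg _ _), ?_, ?_, ?_, ?_, by simp⟩
    · intro B hB
      rw [Rooted.cut_restrict (I := I) (A := A) hB hσ, hcutI]
      exact hC.parity B (hB.trans hA)
    · have h3 := h1 a (Finset.mem_insert_self _ _)
      rw [Function.update_self, ← hexc, ← Rooted.sum_restrict ha, ← dvd_neg] at h3
      exact dvd_of_dvd_eq h3 (by change _ = ∑ v ∈ A, b v + ∑ v ∈ A, _ - ∑ v ∈ A, _; ring)
    · change (I.restrict A σ).cut A ≤ 2 * (k - 1) + nrm k (∑ v ∈ A, b v)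
      rw [Rooted.cut_restrict Finset.Subset.rfl hσ, hcutI]
      exact hviol.le
    · intro B hB hne hBA _
      rw [Rooted.cut_restrict (I := I) (A := A) hB hσ, hcutI]
      exact hmin B hB hne hBA
  obtain ⟨τ, hτ, h3⟩ := hR.solvable (by omega)
  have hex : ∀ ρ v, net E s t ρ v = I.excess ρ v := fun ρ v => by simp [I, Rooted.excess]
  refine ⟨glue s t A σ τ, hσ.glue hτ, fun v hv => ?_, fun _ v hv => ?_⟩
  · by_cases hvA : v ∈ A
    · rw [hex]
      change 2 * k ∣ I.excess (glue I.s I.t A σ τ) v - b v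
      rw [Rooted.excess_glue_of_mem hvA]
      exact (h3 v hvA).1
    · have hva : v ≠ a := by rintro rfl; exact hvA ha
      rw [net_glue_of_notMem ha hvA]
      have := h1 v (Finset.mem_insert_of_mem (Finset.mem_sdiff.2 ⟨hv, hvA⟩))
      rwa [Function.update_of_ne hva] at this
  · by_cases hvA : v ∈ A
    · rw [hex]
      change |I.excess (glue I.s I.t A σ τ) v| < _
      rw [Rooted.excess_glue_of_mem hvA]
      have := (h3 v hvA).2
      have := hbig v hv
      omega
    · have hva : v ≠ a := by rintro rfl; exact hvA ha
      have hvW : v ∈ insert a (W \ A) := Finset.mem_insert_of_mem (Finset.mem_sdiff.2 ⟨hv, hvA⟩)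
      rw [net_glue_of_notMem ha hvA]
      refine (h2 v hvW).trans_eq ?_
      rw [cutE_collapse (Finset.singleton_subset_iff.2 hvW)]
      unfold expand
      rw [if_neg (by simpa using hva.symm)]

/-- A graph with `2 * (k - 1)` edge-disjoint connected spanning subgraphs has an orientation that
meets a given demand modulo `2 * k` without sources and sinks. -/
theorem Colored.orients (hk : 3 ≤ k) (hN : (N : ℤ) = 2 * (k - 1))
    (hC : Colored k N W E s t c b) : Orients k W E s t b := by
  induction hn : W.card using Nat.strong_induction_on generalizing W E s t c b with
  | _ n ih =>
  subst hn
  replace ih : ∀ W' : Finset α, W'.card < W.card → ∀ E s t c b,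
      Colored (ι := ι) k N W' E s t c b → Orients k W' E s t b :=
    fun W' h E s t c b hC => ih _ h hC rfl
  by_cases h2 : 2 ≤ W.card
  swap
  · refine ⟨fun _ => 1, fun _ => Or.inl rfl, fun v hv => ?_, fun h => absurd h h2⟩
    have hWv : W = {v} := by
      have h3 : W.card = 1 := by have := Finset.card_pos.2 ⟨v, hv⟩; omega
      obtain ⟨u, rfl⟩ := Finset.card_eq_one.1 h3
      rw [Finset.mem_singleton.1 hv]
    have h3 := sum_net_eq_zero hC.ends (fun _ => 1)
    have h4 := hC.total
    rw [hWv, Finset.sum_singleton] at h3 h4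
    rw [h3, zero_sub]
    exact (dvd_neg).2 h4
  by_cases hs : ∃ v ∈ W, cutE E s t {v} + nrm k (b v) ≤ 2 * N
  · obtain ⟨v, hv, hs⟩ := hs
    exact hC.orients_of_small hk hN h2 hv (ih _ (Finset.card_erase_lt_of_mem hv)) hs
  push Not at hs
  -- The degree exceeds `4 * (k - 1) - k`, so it is at least `3 * k - 3`, and `k ≥ 3`.
  have hbig : ∀ v ∈ W, 2 * k ≤ cutE E s t {v} := by
    intro v hv
    have h3 := hs v hv
    have h4 := nrm_le (show 2 ≤ k by omega) (b v)
    omega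
  by_cases hcut : ∀ A ⊆ W, A.Nonempty → A ≠ W →
      2 * (k - 1) + nrm k (∑ v ∈ A, b v) ≤ cutE E s t A
  · exact hC.orients_of_cut hk (Finset.card_pos.1 (by omega)) hbig hcut
  push Not at hcut
  obtain ⟨A₀, hA₀, hne₀, hAW₀, hviol₀⟩ := hcut
  obtain ⟨A, hAmem, hAmin⟩ := Finset.exists_min_image (W.powerset.filter fun A => A.Nonempty ∧
    A ≠ W ∧ cutE E s t A < 2 * (k - 1) + nrm k (∑ v ∈ A, b v)) Finset.card
    ⟨A₀, by simp [hA₀, hne₀, hAW₀, hviol₀]⟩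
  simp only [Finset.mem_filter, Finset.mem_powerset] at hAmem hAmin
  obtain ⟨hA, hne, hAW, hviol⟩ := hAmem
  refine hC.orients_of_violated hk hbig hA ?_ hAW hviol ?_ ih
  -- A violating vertex has degree strictly between `4 * (k - 1)` minus its norm and `2 * (k - 1)`
  -- plus its norm. This forces norm `k` and degree `3 * k - 3`, of different parity.
  · by_contra hcon
    obtain ⟨v, rfl⟩ := Finset.card_eq_one.1 (show A.card = 1 by have := hne.card_pos; omega)
    rw [Finset.sum_singleton] at hviol
    have hv := Finset.singleton_subset_iff.1 hA
    have h3 := hs v hv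
    have h4 := nrm_le (show 2 ≤ k by omega) (b v)
    have h5 := nrm_parity k (b v)
    have h6 := hC.parity_singleton hv
    omega
  · intro B hB hBne hBA
    by_contra hcon
    have hlt := Finset.card_lt_card (hB.ssubset_of_ne hBA)
    have := hAmin B ⟨hB.trans hA, hBne, by
      rintro rfl; exact hBA (hB.antisymm hA), by omega⟩
    omega

end Colored

/-! ### From orientations to factors. -/

section Factor
variable {α ι : Type*} [DecidableEq α] [DecidableEq ι] {W X : Finset α} {E : Finset ι}
  {s t : ι → α} {c : ι → ℕ}

/-- The number of edges in `E`, apart from loops, that have `v` as an end. -/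
def valency (E : Finset ι) (s t : ι → α) (v : α) : ℕ := (E.filter (At s t v)).card

lemma exists_factor_of_three_le {k N : ℕ} (hk : 3 ≤ k) (hN : N = 2 * (k - 1))
    (hE : ∀ e ∈ E, s e ∈ W ∧ t e ∈ W) (hX : ∀ e ∈ E, ¬ (s e ∈ X ↔ t e ∈ X))
    (hconn : ∀ i < N, Connecting W E s t c i) (h2 : 2 ≤ W.card) :
    ∃ H ⊆ E, ∀ v ∈ W, 0 < valency H s t v ∧ k ∣ valency H s t v := by
  -- Every edge is directed into `X`, so net out-degrees are minus the degree on `X` and the degree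
  -- elsewhere.
  let ρ : ι → ℤ := fun e => if s e ∈ X then -1 else 1
  have hρ : IsSign ρ := fun e => by simp only [ρ]; split_ifs <;> simp
  have hC : Colored (k : ℤ) N W E s t c (net E s t ρ) :=
    ⟨hE, fun A _ => cutE_parity E s t hρ A, by rw [sum_net_eq_zero hE]; exact dvd_zero _, hconn⟩
  obtain ⟨σ, hσ, h1, h3⟩ := hC.orients (by omega) (by omega)
  let ε : α → ℤ := fun v => if v ∈ X then -1 else 1
  have hε : ∀ v, ε v = 1 ∨ ε v = -1 := fun v => by simp only [ε]; split_ifs <;> simp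
  have hinc : ∀ e ∈ E, ∀ v, ρ e * inc s t e v = ε v * if At s t v e then 1 else 0 := by
    intro e he v
    have := hX e he
    by_cases hs : s e = v
    · subst hs
      by_cases ht : t e = s e
      · simp [inc, At, ht]
      · by_cases hsX : s e ∈ X <;> simp [ρ, ε, inc, At, hsX, ht]
    · by_cases ht : t e = v
      · subst ht
        by_cases hsX : s e ∈ X <;> simp_all [ρ, ε, inc, At]
      · simp [inc, At, hs, ht]
  have hcard : ∀ F ⊆ E, ∀ v, ∑ e ∈ F, ρ e * inc s t e v = ε v * valency F s t v := by
    intro F hF v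
    rw [Finset.sum_congr rfl fun e he => hinc e (hF he) v, ← Finset.mul_sum]
    unfold valency
    rw [Finset.card_filter]; push_cast; rfl
  set H := E.filter fun e => σ e ≠ ρ e with hH
  have hnet : ∀ v, net E s t σ v = net E s t ρ v - 2 * (ε v * valency H s t v) := by
    intro v
    rw [← hcard H (Finset.filter_subset _ _) v, hH, Finset.sum_filter, Finset.mul_sum]
    unfold net
    rw [← Finset.sum_sub_distrib]
    refine Finset.sum_congr rfl fun e _ => ?_
    rcases hσ e with h | h <;> rcases hρ e with h' | h' <;> simp [h, h'] <;> ring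
  refine ⟨H, Finset.filter_subset _ _, fun v hv => ⟨?_, ?_⟩⟩
  -- If no edge at `v` were reversed, `v` would be a source or a sink of `σ`.
  · rw [Nat.pos_iff_ne_zero]
    intro h0
    have h4 := h3 h2 v hv
    have h5 : net E s t ρ v = ε v * valency E s t v := hcard E Finset.Subset.rfl v
    rw [hnet, h0, h5, cutE_singleton] at h4
    unfold valency at h4
    rcases hε v with h | h <;> rw [h] at h4 <;> simp at h4
  · have h4 := h1 v hv
    rw [hnet] at h4
    have h5 : 2 * (k : ℤ) ∣ 2 * (valency H s t v : ℤ) := by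
      rcases hε v with h | h <;> rw [h] at h4
      · rw [← dvd_neg]; exact dvd_of_dvd_eq h4 (by ring)
      · exact dvd_of_dvd_eq h4 (by ring)
    exact_mod_cast Int.dvd_of_mul_dvd_mul_left (by norm_num) h5

/-- In a connected graph every demand of sum zero is a boundary. -/
lemma exists_boundary {R : Type*} [CommRing R]
    (hconn : ∀ A ⊆ W, A.Nonempty → A ≠ W → ∃ e ∈ E, ¬ (s e ∈ A ↔ t e ∈ A))
    (hE : ∀ e ∈ E, s e ∈ W ∧ t e ∈ W) (g : α → R) (hg : ∑ v ∈ W, g v = 0) :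
    ∃ j : ι → R, ∀ w ∈ W, ∑ e ∈ E, j e * (inc s t e w : R) = g w := by
  rcases W.eq_empty_or_nonempty with rfl | ⟨r, hr⟩
  · exact ⟨0, by simp⟩
  have key : ∀ v ∈ W, ∃ j : ι → R, ∀ w, ∑ e ∈ E, j e * (inc s t e w : R) =
      (if w = v then 1 else 0) - (if w = r then 1 else 0) := by
    classical
    by_contra hcon
    -- The vertices joined to `r` by a unit flow: an edge leaving this set would extend a flow.
    set A := W.filter fun v => ∃ j : ι → R, ∀ w, ∑ e ∈ E, j e * (inc s t e w : R) =
      (if w = v then 1 else 0) - (if w = r then 1 else 0) with hA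
    obtain ⟨e, he, hcr⟩ := hconn A (Finset.filter_subset _ _)
      ⟨r, Finset.mem_filter.2 ⟨hr, 0, by simp⟩⟩ (fun h => hcon fun v hv => by
        rw [← h] at hv; exact (Finset.mem_filter.1 hv).2)
    obtain ⟨u, v, hj, hu, hv⟩ := joins_of_crosses hcr
    obtain ⟨-, j, hju⟩ := Finset.mem_filter.1 hu
    obtain ⟨δ, -, hδ⟩ := hj.exists_sign
    refine hv (Finset.mem_filter.2 ⟨(hj.mem hE he).2, fun f => j f - if f = e then (δ : R) else 0,
      fun w => ?_⟩)
    simp only [sub_mul, Finset.sum_sub_distrib, hju, ite_mul, zero_mul]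
    rw [Finset.sum_ite_eq' E e, if_pos he, ← Int.cast_mul, hδ]
    push_cast
    ring
  choose! j hj using key
  refine ⟨fun e => ∑ v ∈ W, g v * j v e, fun w hw => ?_⟩
  simp only [Finset.sum_mul, mul_assoc]
  rw [Finset.sum_comm]
  simp only [← Finset.mul_sum]
  rw [Finset.sum_congr rfl fun v hv => by rw [hj v hv w]]
  simp only [mul_sub, Finset.sum_sub_distrib]
  rw [← Finset.sum_mul W g, hg, zero_mul, sub_zero]
  simp only [mul_ite, mul_one, mul_zero]
  rw [Finset.sum_ite_eq, if_pos hw]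

lemma valency_cast (E : Finset ι) (s t : ι → α) (v : α) :
    (valency E s t v : ZMod 2) = ∑ e ∈ E, (inc s t e v : ZMod 2) := by
  unfold valency
  rw [Finset.card_filter]
  push_cast
  refine Finset.sum_congr rfl fun e _ => ?_
  unfold At inc
  by_cases h1 : s e = v <;> by_cases h2 : t e = v <;> simp [h1, h2]

/-- Colour 0 makes all degrees positive. Its odd vertices are then corrected by edges of colour 1,
which is possible since the valencies of colour 0 have even sum. -/
lemma exists_factor_two (hE : ∀ e ∈ E, s e ∈ W ∧ t e ∈ W)
    (hconn : ∀ i < 2, Connecting W E s t c i) (h2 : 2 ≤ W.card) :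
    ∃ H ⊆ E, ∀ v ∈ W, 0 < valency H s t v ∧ 2 ∣ valency H s t v := by
  set E₀ := E.filter fun e => c e = 0 with hE₀
  set E₁ := E.filter fun e => c e = 1 with hE₁
  obtain ⟨j, hj⟩ := exists_boundary (R := ZMod 2) (W := W) (E := E₁) (s := s) (t := t) (by
    intro A hA hne hAW
    obtain ⟨e, he, hc, hcr⟩ := hconn 1 (by norm_num) A hA hne hAW
    exact ⟨e, Finset.mem_filter.2 ⟨he, hc⟩, hcr⟩) (fun e he => hE e (Finset.mem_filter.1 he).1)
    (fun v => - (valency E₀ s t v : ZMod 2)) (by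
      rw [Finset.sum_neg_distrib, neg_eq_zero]
      simp only [valency_cast]
      rw [Finset.sum_comm]
      refine Finset.sum_eq_zero fun e he => ?_
      rw [← Int.cast_sum, sum_inc]
      have := hE e (Finset.mem_filter.1 he).1
      simp [this.1, this.2])
  set J := E₁.filter fun e => j e = 1 with hJ
  have hdisj : Disjoint E₀ J := by
    rw [Finset.disjoint_left]
    intro e h0 h1
    have h3 := (Finset.mem_filter.1 h0).2
    have h4 := (Finset.mem_filter.1 (Finset.mem_filter.1 h1).1).2
    omega
  have hval : ∀ v, valency (E₀ ∪ J) s t v = valency E₀ s t v + valency J s t v := by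
    intro v
    unfold valency
    rw [Finset.filter_union, Finset.card_union_of_disjoint
      (Finset.disjoint_filter_filter hdisj)]
  refine ⟨E₀ ∪ J, Finset.union_subset (Finset.filter_subset _ _)
    ((Finset.filter_subset _ _).trans (Finset.filter_subset _ _)), fun v hv => ⟨?_, ?_⟩⟩
  · obtain ⟨e, he, hc, hcr⟩ := hconn 0 (by norm_num) {v} (Finset.singleton_subset_iff.2 hv)
      (Finset.singleton_nonempty v) (by rintro h; rw [← h, Finset.card_singleton] at h2; omega)
    rw [hval]
    refine Nat.add_pos_left (Finset.card_pos.2 ⟨e, Finset.mem_filter.2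
      ⟨Finset.mem_filter.2 ⟨he, hc⟩, ?_⟩⟩) _
    unfold At; simpa using hcr
  · rw [← ZMod.natCast_eq_zero_iff, hval]
    push_cast
    have h3 : (valency J s t v : ZMod 2) = ∑ e ∈ E₁, j e * (inc s t e v : ZMod 2) := by
      rw [valency_cast, hJ, Finset.sum_filter]
      refine Finset.sum_congr rfl fun e _ => ?_
      have : j e = 0 ∨ j e = 1 := by generalize j e = a; revert a; decide
      rcases this with h | h <;> simp [h]
    rw [h3, hj v hv]; ring

/-- A bipartite graph with `2 * k - 2` edge-disjoint connected spanning subgraphs has a modulo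
`k`-regular factor. -/
theorem exists_factor {k : ℕ} (hk : 2 ≤ k) (hE : ∀ e ∈ E, s e ∈ W ∧ t e ∈ W)
    (hX : ∀ e ∈ E, ¬ (s e ∈ X ↔ t e ∈ X))
    (hconn : ∀ i < 2 * k - 2, Connecting W E s t c i) (h2 : 2 ≤ W.card) :
    ∃ H ⊆ E, ∀ v ∈ W, 0 < valency H s t v ∧ k ∣ valency H s t v := by
  by_cases h3 : 3 ≤ k
  · exact exists_factor_of_three_le h3 (by omega) hE hX hconn h2
  · obtain rfl : k = 2 := by omega
    exact exists_factor_two hE hconn h2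

end Factor

/-! ### Matroid union for vectors. -/

section Union
variable {ι K V : Type*} [DecidableEq ι] [Field K] [AddCommGroup V] [Module K V]
  [FiniteDimensional K V] {E : Finset ι} {χ : ι → V} {N : ℕ} {c c' c₀ : ι → ℕ} {e : ι}

/-- The span of the vectors with labels in `S`. -/
def spn (K : Type*) {ι V : Type*} [Field K] [AddCommGroup V] [Module K V] (χ : ι → V) (S : Set ι) :
    Submodule K V := Submodule.span K (χ '' S)

lemma spn_mono {S T : Set ι} (h : S ⊆ T) : spn K χ S ≤ spn K χ T :=
  Submodule.span_mono (Set.image_mono h)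

lemma mem_spn {S : Set ι} (h : e ∈ S) : χ e ∈ spn K χ S :=
  Submodule.subset_span ⟨e, h, rfl⟩

lemma spn_le {S : Set ι} {U : Submodule K V} (h : ∀ e ∈ S, χ e ∈ U) : spn K χ S ≤ U := by
  refine Submodule.span_le.2 ?_
  rintro _ ⟨e, he, rfl⟩
  exact h e he

lemma spn_eq_of_mem {S : Set ι} (h : χ e ∈ spn K χ (S \ {e})) : spn K χ S = spn K χ (S \ {e}) := by
  refine le_antisymm (spn_le fun f hf => ?_) (spn_mono Set.sdiff_subset)
  by_cases hfe : f = e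
  · rw [hfe]; exact h
  · exact mem_spn ⟨hf, hfe⟩

/-- The edges of colour `i`. -/
def colorClass (E : Finset ι) (c : ι → ℕ) (i : ℕ) : Set ι := {e | e ∈ E ∧ c e = i}

/-- The total rank of the colour classes. -/
noncomputable def totalRank (K : Type*) {ι V : Type*} [Field K] [AddCommGroup V] [Module K V]
    (χ : ι → V) (E : Finset ι) (N : ℕ) (c : ι → ℕ) : ℕ :=
  ∑ i ∈ Finset.range N, Module.finrank K (spn K χ (colorClass E c i))

/-- A colouring with colours less than `N` and the greatest total rank. -/
def MaxRank (K : Type*) {ι V : Type*} [Field K] [AddCommGroup V] [Module K V]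
    (χ : ι → V) (E : Finset ι) (N : ℕ) (c : ι → ℕ) : Prop :=
  (∀ e ∈ E, c e < N) ∧
    ∀ c' : ι → ℕ, (∀ e ∈ E, c' e < N) → totalRank K χ E N c' ≤ totalRank K χ E N c

/-- The vector of `e` is spanned by the other vectors of its colour. -/
def Redundant (K : Type*) {ι V : Type*} [Field K] [AddCommGroup V] [Module K V]
    (χ : ι → V) (E : Finset ι) (c : ι → ℕ) (e : ι) : Prop :=
  e ∈ E ∧ χ e ∈ spn K χ (colorClass E c (c e) \ {e})

/-- Change the colour of a redundant vector. -/
def Recolor (K : Type*) {ι V : Type*} [DecidableEq ι] [Field K] [AddCommGroup V] [Module K V]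
    (χ : ι → V) (E : Finset ι) (N : ℕ) (c c' : ι → ℕ) : Prop :=
  ∃ e j, j < N ∧ Redundant K χ E c e ∧ c' = Function.update c e j

lemma colorClass_update_diff (c : ι → ℕ) (e : ι) (j i : ℕ) :
    colorClass E (Function.update c e j) i \ {e} = colorClass E c i \ {e} := by
  ext f
  simp only [colorClass, Set.mem_sdiff, Set.mem_ofPred_eq, Set.mem_singleton_iff]
  by_cases h : f = e
  · simp [h]
  · rw [Function.update_of_ne h]

/-- A redundant vector leaves its class at no cost; if class `j` did not span it, moving it there
would raise the total rank. -/
lemma MaxRank.mem_spn (hc : MaxRank K χ E N c) (he : Redundant K χ E c e) {j : ℕ} (hj : j < N) :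
    χ e ∈ spn K χ (colorClass E c j \ {e}) := by
  by_cases hje : j = c e
  · rw [hje]; exact he.2
  have heN := hc.1 e he.1
  by_contra hcon
  have hdiff : ∀ i, i ≠ c e → colorClass E c i \ {e} = colorClass E c i := by
    intro i hi
    refine Set.sdiff_singleton_eq_self ?_
    rintro ⟨-, h⟩
    exact hi h.symm
  have hle : ∀ i, spn K χ (colorClass E c i) ≤
      spn K χ (colorClass E (Function.update c e j) i) := by
    intro i
    refine le_trans ?_ (spn_mono (Set.sdiff_subset (t := {e})))
    rw [colorClass_update_diff]
    by_cases hi : i = c e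
    · subst hi; rw [spn_eq_of_mem he.2]
    · rw [hdiff i hi]
  have hlt : totalRank K χ E N c < totalRank K χ E N (Function.update c e j) := by
    refine Finset.sum_lt_sum (fun i _ => Submodule.finrank_mono (hle i))
      ⟨j, Finset.mem_range.2 hj, Submodule.finrank_lt_finrank_of_lt ((hle j).lt_of_ne ?_)⟩
    intro h
    rw [hdiff j hje, h] at hcon
    exact hcon (ModOrient.mem_spn ⟨he.1, Function.update_self _ _ _⟩)
  refine absurd (hc.2 (Function.update c e j) fun f hf => ?_) (not_le.2 hlt)
  by_cases hfe : f = e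
  · rw [hfe, Function.update_self]; exact hj
  · rw [Function.update_of_ne hfe]; exact hc.1 f hf

lemma MaxRank.recolor (hc : MaxRank K χ E N c) (h : Recolor K χ E N c c') : MaxRank K χ E N c' := by
  obtain ⟨e, j, hj, he, rfl⟩ := h
  have h1 : totalRank K χ E N (Function.update c e j) = totalRank K χ E N c := by
    refine Finset.sum_congr rfl fun i hi => ?_
    have h2 := hc.mem_spn he (Finset.mem_range.1 hi)
    rw [spn_eq_of_mem h2, spn_eq_of_mem (by rw [colorClass_update_diff]; exact h2),
      colorClass_update_diff]
  refine ⟨fun f hf => ?_, fun c' hc' => by rw [h1]; exact hc.2 c' hc'⟩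
  by_cases hfe : f = e
  · rw [hfe, Function.update_self]; exact hj
  · rw [Function.update_of_ne hfe]; exact hc.1 f hf

/-- The edges that become redundant after some sequence of recolourings. -/
def reachable (K : Type*) {ι V : Type*} [DecidableEq ι] [Field K] [AddCommGroup V] [Module K V]
    (χ : ι → V) (E : Finset ι) (N : ℕ) (c₀ : ι → ℕ) : Set ι :=
  {e | ∃ c, Relation.ReflTransGen (Recolor K χ E N) c₀ c ∧ Redundant K χ E c e}

lemma MaxRank.of_reach (h₀ : MaxRank K χ E N c₀)
    (h : Relation.ReflTransGen (Recolor K χ E N) c₀ c) : MaxRank K χ E N c := by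
  induction h with
  | refl => exact h₀
  | tail _ h ih => exact ih.recolor h

/-- Take a minimal subset of class `j` that spans `χ e`. Once `e` has colour `j`, the exchange
property makes each member redundant, so the subset is reachable. -/
lemma MaxRank.mem_spn_reachable (h₀ : MaxRank K χ E N c₀)
    (h : Relation.ReflTransGen (Recolor K χ E N) c₀ c) (he : Redundant K χ E c e) {j : ℕ}
    (hj : j < N) : χ e ∈ spn K χ ((reachable K χ E N c₀ ∩ colorClass E c j) \ {e}) := by
  classical
  have h1 := (h₀.of_reach h).mem_spn he hj
  set F := (E.filter fun f => c f = j).erase e with hF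
  have hFset : (F : Set ι) = colorClass E c j \ {e} := by
    ext f
    simp only [hF, Finset.coe_erase, Finset.coe_filter, colorClass]
  rw [← hFset] at h1
  obtain ⟨T, hT, hTmin⟩ := Finset.exists_min_image
    (F.powerset.filter fun T : Finset ι => χ e ∈ spn K χ (T : Set ι)) Finset.card
    ⟨F, Finset.mem_filter.2 ⟨Finset.mem_powerset_self F, h1⟩⟩
  obtain ⟨hTF, hT⟩ := Finset.mem_filter.1 hT
  rw [Finset.mem_powerset] at hTF
  refine spn_mono ?_ hT
  intro f hf
  have hfF : f ∈ colorClass E c j \ {e} := by rw [← hFset]; exact hTF hf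
  refine ⟨⟨⟨Function.update c e j, h.tail ⟨e, j, hj, he, rfl⟩, hfF.1.1, ?_⟩, hfF.1⟩, hfF.2⟩
  have hfe : f ≠ e := hfF.2
  rw [Function.update_of_ne hfe, hfF.1.2]
  have h2 : χ e ∉ spn K χ ((T.erase f : Finset ι) : Set ι) := by
    intro hcon
    have := hTmin (T.erase f) (Finset.mem_filter.2
      ⟨Finset.mem_powerset.2 ((Finset.erase_subset _ _).trans hTF), hcon⟩)
    have := Finset.card_erase_lt_of_mem hf
    omega
  have h3 : χ e ∈ Submodule.span K (insert (χ f) (χ '' ((T.erase f : Finset ι) : Set ι))) := by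
    rw [← Set.image_insert_eq, ← Finset.coe_insert, Finset.insert_erase hf]; exact hT
  have h4 := _root_.mem_span_insert_exchange h3 h2
  rw [← Set.image_insert_eq] at h4
  refine spn_mono ?_ h4
  rintro g (rfl | hg)
  · exact ⟨⟨he.1, Function.update_self _ _ _⟩, hfe.symm⟩
  · obtain ⟨hgf, hg⟩ := Finset.mem_erase.1 hg
    have hgF : g ∈ colorClass E c j \ {e} := by rw [← hFset]; exact hTF hg
    refine ⟨⟨hgF.1.1, ?_⟩, hgf⟩
    rw [Function.update_of_ne hgF.2]; exact hgF.1.2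

/-- A recoloured vector lies in the span of the other reachable vectors of every class, so adding or
removing it changes no such span. -/
lemma MaxRank.spn_reachable_eq (h₀ : MaxRank K χ E N c₀)
    (h : Relation.ReflTransGen (Recolor K χ E N) c₀ c) {j : ℕ} (hj : j < N) :
    spn K χ (reachable K χ E N c₀ ∩ colorClass E c j) =
      spn K χ (reachable K χ E N c₀ ∩ colorClass E c₀ j) := by
  induction h with
  | refl => rfl
  | @tail c c' h h' ih =>
    rw [← ih]
    obtain ⟨e, i, hi, he, rfl⟩ := h'
    have h1 := h₀.mem_spn_reachable h he hj
    have h2 : (reachable K χ E N c₀ ∩ colorClass E (Function.update c e i) j) \ {e} =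
        (reachable K χ E N c₀ ∩ colorClass E c j) \ {e} := by
      rw [Set.inter_sdiff_assoc, Set.inter_sdiff_assoc, colorClass_update_diff]
    rw [spn_eq_of_mem h1, spn_eq_of_mem (by rw [h2]; exact h1), h2]

lemma MaxRank.spn_reachable_le (h₀ : MaxRank K χ E N c₀) {j : ℕ} (hj : j < N) :
    spn K χ (reachable K χ E N c₀) ≤ spn K χ (reachable K χ E N c₀ ∩ colorClass E c₀ j) := by
  refine spn_le ?_
  rintro e ⟨c, h, he⟩
  rw [← h₀.spn_reachable_eq h hj]
  exact spn_mono Set.sdiff_subset (h₀.mem_spn_reachable h he hj)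

/-- Vectors independent modulo `U` each raise the rank by one. -/
lemma finrank_add_card_le (U : Submodule K V) (S : Finset ι)
    (h : ∀ e ∈ S, χ e ∉ U ⊔ spn K χ ((S.erase e : Finset ι) : Set ι)) :
    Module.finrank K U + S.card ≤ Module.finrank K (U ⊔ spn K χ (S : Set ι) : Submodule K V) := by
  induction S using Finset.induction_on with
  | empty => simpa using Submodule.finrank_mono (le_sup_left (a := U) (b := spn K χ _))
  | insert a S ha ih =>
    have h1 := ih fun e he hcon => h e (Finset.mem_insert_of_mem he) (by
      refine (sup_le_sup_left (spn_mono ?_) U) hcon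
      exact_mod_cast Finset.erase_subset_erase e (Finset.subset_insert a S))
    have h2 := h a (Finset.mem_insert_self a S)
    rw [Finset.erase_insert ha] at h2
    rw [Finset.card_insert_of_notMem ha]
    refine Nat.lt_of_le_of_lt h1 (Submodule.finrank_lt_finrank_of_lt ?_)
    refine lt_of_le_of_ne (sup_le_sup_left (spn_mono (by simp)) U) fun heq => h2 ?_
    rw [heq]
    exact (le_sup_right : _ ≤ U ⊔ _) (mem_spn (by simp))

variable (K χ E) in
/-- The matroid union theorem for vectors. -/
theorem exists_coloring_rank (hN : 0 < N) : ∃ (c : ι → ℕ) (D : Finset ι), D ⊆ E ∧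
    N * Module.finrank K (spn K χ (D : Set ι)) + (E \ D).card ≤ totalRank K χ E N c := by
  classical
  obtain ⟨c₀, h₀⟩ : ∃ c₀, MaxRank K χ E N c₀ := by
    -- A maximum exists because the total rank is at most `N` times the dimension.
    obtain ⟨c₀, h1, h2⟩ := (measure fun c : ι → ℕ =>
      N * Module.finrank K V - totalRank K χ E N c).wf.has_min
        {c | ∀ e ∈ E, c e < N} ⟨fun _ => 0, fun _ _ => hN⟩
    refine ⟨c₀, h1, fun c' hc' => ?_⟩
    have h3 := h2 c' hc'
    have h4 : totalRank K χ E N c' ≤ N * Module.finrank K V := by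
      unfold totalRank
      refine (Finset.sum_le_card_nsmul _ _ _ fun i _ => Submodule.finrank_le _).trans ?_
      simp
    change ¬ (N * Module.finrank K V - totalRank K χ E N c' <
      N * Module.finrank K V - totalRank K χ E N c₀) at h3
    omega
  set D := E.filter fun e => e ∈ reachable K χ E N c₀ with hD
  have hDset : (D : Set ι) = reachable K χ E N c₀ := by
    ext e
    simp only [hD, Finset.coe_filter, Set.mem_ofPred_eq, and_iff_right_iff_imp]
    rintro ⟨c, -, he⟩
    exact he.1
  refine ⟨c₀, D, Finset.filter_subset _ _, ?_⟩
  -- Each class spans all of `D` by its part in `D`. Its other vectors are not redundant, so they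
  -- are independent modulo that span.
  have key : ∀ j ∈ Finset.range N, Module.finrank K (spn K χ (D : Set ι)) +
      ((E \ D).filter fun e => c₀ e = j).card ≤
        Module.finrank K (spn K χ (colorClass E c₀ j)) := by
    intro j hj
    have hU := h₀.spn_reachable_le (Finset.mem_range.1 hj)
    rw [← hDset] at hU
    refine (finrank_add_card_le (χ := χ) _ _ ?_).trans (Submodule.finrank_mono (sup_le ?_ ?_))
    · intro e he hcon
      obtain ⟨he, hce⟩ := Finset.mem_filter.1 he
      obtain ⟨heE, heD⟩ := Finset.mem_sdiff.1 he
      have heD' : e ∉ (D : Set ι) := heD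
      rw [hDset] at heD'
      refine heD' ⟨c₀, Relation.ReflTransGen.refl, heE, ?_⟩
      refine (sup_le (hU.trans (spn_mono ?_)) (spn_mono ?_)) hcon
      · rw [hce]
        rintro f ⟨hf, hf'⟩
        exact ⟨hf', fun h => heD (by rw [← show f = e from h]; exact hf)⟩
      · intro f hf
        rw [Finset.mem_coe, Finset.mem_erase, Finset.mem_filter, Finset.mem_sdiff] at hf
        exact ⟨⟨hf.2.1.1, by rw [hf.2.2, hce]⟩, hf.1⟩
    · exact hU.trans (spn_mono Set.inter_subset_right)
    · refine spn_mono fun f hf => ?_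
      rw [Finset.mem_coe, Finset.mem_filter, Finset.mem_sdiff] at hf
      exact ⟨hf.1.1, hf.2⟩
  have h1 := Finset.sum_le_sum key
  rw [Finset.sum_add_distrib, Finset.sum_const, Finset.card_range, smul_eq_mul,
    Finset.sum_card_fiberwise_eq_card_filter, Finset.filter_true_of_mem (fun e he =>
      Finset.mem_range.2 (h₀.1 e (Finset.mem_sdiff.1 he).1))] at h1
  exact h1

end Union

/-! ### Tree packing and maximum cuts. -/

section Packing
variable {α ι : Type*} [DecidableEq α] [DecidableEq ι] {E : Finset ι} {s t : ι → α} {c : ι → ℕ}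
  {N : ℕ}

/-- The incidence vector of an edge. -/
def incVec (s t : ι → α) (e : ι) (v : α) : ℚ := inc s t e v

/-- The sum of the coordinates in `A`. -/
noncomputable def sumOn (A : Finset α) : (α → ℚ) →ₗ[ℚ] ℚ := ∑ v ∈ A, LinearMap.proj v

lemma sumOn_apply (A : Finset α) (f : α → ℚ) : sumOn A f = ∑ v ∈ A, f v := by
  simp [sumOn]

lemma incVec_eq (s t : ι → α) (e : ι) :
    incVec s t e = Pi.single (s e) 1 - Pi.single (t e) 1 := by
  ext v
  simp [incVec, inc, Pi.single_apply, eq_comm]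

lemma sumOn_incVec (A : Finset α) (e : ι) :
    sumOn A (incVec s t e) = (if s e ∈ A then 1 else 0) - (if t e ∈ A then 1 else 0) := by
  rw [sumOn_apply]
  unfold incVec
  rw [← Int.cast_sum, sum_inc]
  push_cast; rfl

variable [Fintype α]

lemma spn_incVec_le (S : Set ι) : spn ℚ (incVec s t) S ≤ LinearMap.ker (sumOn Finset.univ) :=
  spn_le fun e _ => by rw [LinearMap.mem_ker, sumOn_incVec]; simp

lemma finrank_ker_sumOn [Nonempty α] :
    Module.finrank ℚ (LinearMap.ker (sumOn (Finset.univ : Finset α))) + 1 = Fintype.card α := by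
  have h : sumOn (Finset.univ : Finset α) ≠ 0 := by
    intro h
    obtain ⟨a⟩ := ‹Nonempty α›
    have h1 := LinearMap.congr_fun h (Pi.single a 1)
    rw [sumOn_apply] at h1
    simp at h1
  rw [← Module.finrank_fintype_fun_eq_card ℚ]
  exact Module.Dual.finrank_ker_add_one_of_ne_zero h

/-- If no edge of the class leaves `A`, the coordinate sum over `A` vanishes on its span, but not on
the difference of unit vectors inside and outside `A`. -/
lemma finrank_lt_of_not_connecting [Nonempty α] {i : ℕ}
    (h : ¬ Connecting Finset.univ E s t c i) :
    Module.finrank ℚ (spn ℚ (incVec s t) (colorClass E c i)) <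
      Module.finrank ℚ (LinearMap.ker (sumOn (Finset.univ : Finset α))) := by
  unfold Connecting at h
  push Not at h
  obtain ⟨A, -, ⟨a, ha⟩, hA, h⟩ := h
  obtain ⟨b, hb⟩ : ∃ b, b ∉ A := by
    by_contra hcon
    push Not at hcon
    exact hA (Finset.eq_univ_of_forall hcon)
  refine Submodule.finrank_lt_finrank_of_lt ((spn_incVec_le _).lt_of_ne fun heq => ?_)
  have h1 : (Pi.single a 1 - Pi.single b 1 : α → ℚ) ∈
      LinearMap.ker (sumOn (Finset.univ : Finset α)) := by
    rw [LinearMap.mem_ker, sumOn_apply]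
    simp [Finset.sum_sub_distrib]
  have h2 : spn ℚ (incVec s t) (colorClass E c i) ≤ LinearMap.ker (sumOn A) :=
    spn_le fun e he => by
      rw [LinearMap.mem_ker, sumOn_incVec]
      simp only [h e he.1 he.2, sub_self]
  rw [← heq] at h1
  have h3 := h2 h1
  rw [LinearMap.mem_ker, sumOn_apply] at h3
  simp [Finset.sum_sub_distrib, Pi.single_apply, ha, hb] at h3

/-- Vertices are identified when the difference of their unit vectors lies in `U`. A vector whose
sums over all classes vanish is a combination of such differences, so the kernel of `q` lies in `U`;
rank-nullity gives the count. -/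
lemma exists_labelling (U : Submodule ℚ (α → ℚ)) : ∃ π : α → α,
    (∀ v w, (Pi.single v 1 - Pi.single w 1 : α → ℚ) ∈ U → π v = π w) ∧
    Fintype.card α ≤ Module.finrank ℚ U + (Finset.univ.image π).card := by
  let S : Setoid α :=
    { r := fun v w => (Pi.single v 1 - Pi.single w 1 : α → ℚ) ∈ U
      iseqv := ⟨fun v => by simp, fun {v w} h => by simpa using U.neg_mem h,
        fun {u v w} h h' => by simpa using U.add_mem h h'⟩ }
  let π : α → α := fun v => (Quotient.mk S v).out
  have hπ : ∀ v, (Pi.single v 1 - Pi.single (π v) 1 : α → ℚ) ∈ U :=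
    fun v => S.symm (Quotient.mk_out (s := S) v)
  refine ⟨π, fun v w h => congrArg Quotient.out (Quotient.sound (s := S) h), ?_⟩
  let q : (α → ℚ) →ₗ[ℚ] (↥(Finset.univ.image π) → ℚ) :=
    LinearMap.pi fun l => sumOn (Finset.univ.filter fun v => π v = l)
  have hker : LinearMap.ker q ≤ U := by
    intro f hf
    have h1 : ∑ v, f v • (Pi.single (π v) 1 : α → ℚ) = 0 := by
      ext l
      simp only [Finset.sum_apply, Pi.smul_apply, Pi.single_apply, smul_eq_mul, mul_ite, mul_one,
        mul_zero, Pi.zero_apply]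
      by_cases hl : l ∈ Finset.univ.image π
      · have h2 := congrFun (LinearMap.mem_ker.1 hf) ⟨l, hl⟩
        simp only [q, LinearMap.pi_apply, sumOn_apply, Pi.zero_apply, Finset.sum_filter] at h2
        refine Eq.trans ?_ h2
        exact Finset.sum_congr rfl fun v _ => by simp only [eq_comm]
      · refine Finset.sum_eq_zero fun v _ => if_neg ?_
        rintro rfl
        exact hl (Finset.mem_image_of_mem _ (Finset.mem_univ v))
    have h2 : f = ∑ v, f v • (Pi.single v 1 - Pi.single (π v) 1 : α → ℚ) := by
      simp only [smul_sub, Finset.sum_sub_distrib, h1, sub_zero]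
      ext w
      simp [Finset.sum_apply, Pi.single_apply]
    rw [h2]
    exact U.sum_mem fun v _ => U.smul_mem _ (hπ v)
  have h1 := LinearMap.finrank_range_add_finrank_ker q
  have h2 := Submodule.finrank_le (LinearMap.range q)
  have h3 := Submodule.finrank_mono hker
  rw [Module.finrank_fintype_fun_eq_card] at h1 h2
  rw [Fintype.card_coe] at h2
  omega

/-- The tree packing theorem of Nash-Williams and Tutte. -/
theorem exists_connecting [Nonempty α] (hN : 0 < N)
    (h : ∀ π : α → α, N * (Finset.univ.image π).card ≤
      (E.filter fun e => π (s e) ≠ π (t e)).card + N) :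
    ∃ c : ι → ℕ, ∀ i < N, Connecting Finset.univ E s t c i := by
  obtain ⟨c, D, -, hrank⟩ := exists_coloring_rank ℚ E (incVec s t) hN
  refine ⟨c, ?_⟩
  obtain ⟨π, hπ, hcard⟩ := exists_labelling (spn ℚ (incVec s t) (D : Set ι))
  have h1 : (E.filter fun e => π (s e) ≠ π (t e)).card ≤ (E \ D).card := by
    refine Finset.card_le_card fun e he => ?_
    obtain ⟨he, hne⟩ := Finset.mem_filter.1 he
    refine Finset.mem_sdiff.2 ⟨he, fun heD => hne (hπ _ _ ?_)⟩
    rw [← incVec_eq]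
    exact mem_spn heD
  have h2 := h π
  have h3 := finrank_ker_sumOn (α := α)
  by_contra hcon
  push Not at hcon
  obtain ⟨i, hi, hcon⟩ := hcon
  -- A disconnected colour makes the total rank less than `N` times `Fintype.card α - 1`. But edges
  -- between different labels lie outside `D`, and the hypothesis for `π` supplies enough of them.
  have h4 : totalRank ℚ (incVec s t) E N c <
      N * Module.finrank ℚ (LinearMap.ker (sumOn (Finset.univ : Finset α))) := by
    have : N * Module.finrank ℚ (LinearMap.ker (sumOn (Finset.univ : Finset α))) =
        ∑ j ∈ Finset.range N,
          Module.finrank ℚ (LinearMap.ker (sumOn (Finset.univ : Finset α))) := by simp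
    rw [this]
    exact Finset.sum_lt_sum (fun j _ => Submodule.finrank_mono (spn_incVec_le _))
      ⟨i, Finset.mem_range.2 hi, finrank_lt_of_not_connecting hcon⟩
  have h5 := Nat.mul_le_mul_left N hcard
  rw [← h3, mul_add, mul_add] at h5
  omega

/-- Grow a set of labels: as long as one is missing, connectedness gives an edge to a new label, and
that edge was not counted before. -/
lemma card_image_le_of_connecting [Nonempty α]
    (h : ∀ A : Finset α, A.Nonempty → A ≠ Finset.univ → ∃ e ∈ E, ¬ (s e ∈ A ↔ t e ∈ A))
    (π : α → α) :
    (Finset.univ.image π).card ≤ (E.filter fun e => π (s e) ≠ π (t e)).card + 1 := by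
  have key : ∀ m, m + 1 ≤ (Finset.univ.image π).card → ∃ A ⊆ Finset.univ.image π, A.card = m + 1 ∧
      m ≤ (E.filter fun e => π (s e) ≠ π (t e) ∧ π (s e) ∈ A ∧ π (t e) ∈ A).card := by
    intro m
    induction m with
    | zero =>
      intro _
      obtain ⟨a⟩ := ‹Nonempty α›
      exact ⟨{π a}, by simp, rfl, Nat.zero_le _⟩
    | succ m ih =>
      intro hm
      obtain ⟨A, hA, hcard, hle⟩ := ih (by omega)
      obtain ⟨e, he, hcr⟩ := h (Finset.univ.filter fun v => π v ∈ A) (by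
          obtain ⟨l, hl⟩ := Finset.card_pos.1 (show 0 < A.card by omega)
          obtain ⟨v, -, rfl⟩ := Finset.mem_image.1 (hA hl)
          exact ⟨v, by simp [hl]⟩) (by
          intro heq
          have : Finset.univ.image π ⊆ A := by
            intro l hl
            obtain ⟨v, -, rfl⟩ := Finset.mem_image.1 hl
            have := Finset.mem_univ v
            rw [← heq] at this
            exact (Finset.mem_filter.1 this).2
          have := Finset.card_le_card this
          omega)
      obtain ⟨u, v, hj, hu, hv⟩ := joins_of_crosses hcr
      simp only [Finset.mem_filter, Finset.mem_univ, true_and] at hu hv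
      refine ⟨insert (π v) A, Finset.insert_subset (by simp) hA, by
        rw [Finset.card_insert_of_notMem hv, hcard], ?_⟩
      refine Nat.lt_of_le_of_lt hle (Finset.card_lt_card ?_)
      rw [Finset.ssubset_iff_of_subset]
      · refine ⟨e, ?_, ?_⟩
        · have hne : π u ≠ π v := fun heq => hv (heq ▸ hu)
          rcases hj with ⟨h1, h2⟩ | ⟨h1, h2⟩ <;> simp [h1, h2, he, hu, hne, hne.symm]
        · rcases hj with ⟨h1, h2⟩ | ⟨h1, h2⟩ <;> simp [h1, h2, hv]
      · intro f hf
        simp only [Finset.mem_filter, Finset.mem_insert] at hf ⊢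
        tauto
  by_contra hcon
  obtain ⟨A, -, -, hle⟩ := key ((Finset.univ.image π).card - 1) (by omega)
  have : (E.filter fun e => π (s e) ≠ π (t e) ∧ π (s e) ∈ A ∧ π (t e) ∈ A).card ≤
      (E.filter fun e => π (s e) ≠ π (t e)).card := by
    refine Finset.card_le_card fun e he => ?_
    simp only [Finset.mem_filter] at he ⊢
    tauto
  omega

lemma card_image_le_of_connecting_classes [Nonempty α] {M : ℕ}
    (h : ∀ i < M, Connecting Finset.univ E s t c i) (π : α → α) :
    M * (Finset.univ.image π).card ≤ (E.filter fun e => π (s e) ≠ π (t e)).card + M := by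
  have h1 : ∀ i ∈ Finset.range M, (Finset.univ.image π).card ≤
      ((E.filter fun e => π (s e) ≠ π (t e)).filter fun e => c e = i).card + 1 := by
    intro i hi
    have := card_image_le_of_connecting (E := E.filter fun e => c e = i) (s := s) (t := t) (by
      intro A hne hA
      obtain ⟨e, he, hc, hcr⟩ := h i (Finset.mem_range.1 hi) A (Finset.subset_univ A) hne hA
      exact ⟨e, Finset.mem_filter.2 ⟨he, hc⟩, hcr⟩) π
    rwa [Finset.filter_comm] at this
  have h2 := Finset.sum_le_sum h1
  rw [Finset.sum_add_distrib, Finset.sum_card_fiberwise_eq_card_filter] at h2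
  simp only [Finset.sum_const, Finset.card_range, smul_eq_mul, mul_one] at h2
  have h3 := Finset.card_filter_le (E.filter fun e => π (s e) ≠ π (t e))
    (fun e => c e ∈ Finset.range M)
  omega

/-- An edge crosses the symmetric difference exactly when it crosses one of the two sets but not
both. -/
lemma cutE_symmDiff (E : Finset ι) (s t : ι → α) (X B : Finset α) :
    cutE E s t (symmDiff X B) = cutE E s t X + cutE E s t B -
      2 * cutE (E.filter fun e => ¬ (s e ∈ X ↔ t e ∈ X)) s t B := by
  unfold cutE
  rw [Finset.sum_filter, Finset.mul_sum, ← Finset.sum_add_distrib, ← Finset.sum_sub_distrib]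
  refine Finset.sum_congr rfl fun e _ => ?_
  unfold crosses
  simp only [Finset.mem_symmDiff]
  by_cases h1 : s e ∈ X <;> by_cases h2 : t e ∈ X <;> by_cases h3 : s e ∈ B <;>
    by_cases h4 : t e ∈ B <;> simp [h1, h2, h3, h4]

lemma sum_cutE_fibers (E : Finset ι) (s t : ι → α) (π : α → α) :
    ∑ l ∈ Finset.univ.image π, cutE E s t (Finset.univ.filter fun v => π v = l) =
      2 * (E.filter fun e => π (s e) ≠ π (t e)).card := by
  unfold cutE
  rw [Finset.sum_comm, Finset.card_filter]
  push_cast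
  rw [Finset.mul_sum]
  refine Finset.sum_congr rfl fun e _ => ?_
  unfold crosses
  simp only [Finset.mem_filter, Finset.mem_univ, true_and]
  by_cases h : π (s e) = π (t e)
  · simp [h]
  · have h1 : ∀ l, (if (π (s e) = l ↔ π (t e) = l) then (0 : ℤ) else 1) =
        (if π (s e) = l then 1 else 0) + if π (t e) = l then 1 else 0 := by
      intro l
      by_cases h1 : π (s e) = l
      · by_cases h2 : π (t e) = l
        · exact absurd (h1.trans h2.symm) h
        · simp [h1, h2]
      · by_cases h2 : π (t e) = l <;> simp [h1, h2]
    simp only [h1, Finset.sum_add_distrib, Finset.sum_ite_eq]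
    simp [h]

/-- The edges of a maximum cut of a graph with `2 * N` edge-disjoint connected spanning subgraphs
contain `N` such subgraphs. -/
theorem exists_bipartite_connecting [Nonempty α] (hN : 0 < N)
    (h : ∀ i < 2 * N, Connecting Finset.univ E s t c i) : ∃ (X : Finset α) (c' : ι → ℕ), ∀ i < N,
      Connecting Finset.univ (E.filter fun e => ¬ (s e ∈ X ↔ t e ∈ X)) s t c' i := by
  obtain ⟨X, -, hX⟩ := Finset.exists_max_image (Finset.univ : Finset (Finset α)) (cutE E s t)
    ⟨∅, Finset.mem_univ _⟩
  refine ⟨X, exists_connecting hN fun π => ?_⟩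
  have h1 := card_image_le_of_connecting_classes h π
  -- Switching the vertices of `B` to the other side cannot enlarge a maximum cut.
  have h2 : ∀ B, cutE E s t B ≤ 2 * cutE (E.filter fun e => ¬ (s e ∈ X ↔ t e ∈ X)) s t B := by
    intro B
    have := hX (symmDiff X B) (Finset.mem_univ _)
    rw [cutE_symmDiff] at this
    linarith
  -- Summed over the fibres of `π`, each edge between two fibres is counted twice on either side.
  have h3 := Finset.sum_le_sum fun l (_ : l ∈ Finset.univ.image π) =>
    h2 (Finset.univ.filter fun v => π v = l)
  rw [← Finset.mul_sum, sum_cutE_fibers, sum_cutE_fibers] at h3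
  rw [mul_assoc] at h1
  omega

end Packing

/-! ### Translation from and to `Graph`. -/

section Graph
open Classical in
lemma exists_connecting_of_treeConnected {α β : Type*} {G : Graph α β} {m : ℕ}
    (h : G.TreeConnected m) [Fintype G.vertexSet] (hE : G.edgeSet.Finite)
    {s t : β → G.vertexSet} (hst : ∀ e ∈ G.edgeSet, G.IsLink e (s e) (t e)) :
    ∃ c : β → ℕ, ∀ i < m, Connecting Finset.univ hE.toFinset s t c i := by
  obtain ⟨T, hT, hdisj⟩ := h
  -- An edge in no tree gets colour 0; extra edges do no harm to a connecting class.
  refine ⟨fun e => if h : ∃ i, e ∈ (T i).edgeSet then (h.choose : ℕ) else 0, fun i hi A _ hne hA => ?_⟩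
  obtain ⟨hspan, -, htree⟩ := hT ⟨i, hi⟩
  obtain ⟨a, ha⟩ := hne
  obtain ⟨b, hb⟩ : ∃ b, b ∉ A := by
    by_contra hcon
    push Not at hcon
    exact hA (Finset.eq_univ_of_forall hcon)
  have hV : ∀ {v}, v ∈ (T ⟨i, hi⟩).vertexSet → v ∈ G.vertexSet :=
    fun h => hspan.vertexSet_eq ▸ h
  have hV' : ∀ {v}, v ∈ G.vertexSet → v ∈ (T ⟨i, hi⟩).vertexSet :=
    fun h => hspan.vertexSet_eq.symm ▸ h
  obtain ⟨p⟩ := htree.connected.preconnected ⟨a.1, hV' a.2⟩ ⟨b.1, hV' b.2⟩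
  -- A walk in the tree from inside `A` to outside must leave `A` along some edge.
  obtain ⟨d, -, h1, h2⟩ := p.exists_boundary_dart {v | (⟨v.1, hV v.2⟩ : G.vertexSet) ∈ A} ha hb
  obtain ⟨-, e, he⟩ := d.adj
  have hlink := he.mono hspan.le
  refine ⟨e, hE.mem_toFinset.2 hlink.edge_mem, ?_, ?_⟩
  · have hex : ∃ i, e ∈ (T i).edgeSet := ⟨⟨i, hi⟩, he.edge_mem⟩
    dsimp only
    rw [dif_pos hex]
    by_contra hcon
    have hne : hex.choose ≠ ⟨i, hi⟩ := fun h => hcon (by rw [h])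
    exact Set.disjoint_left.1 (hdisj _ _ hne) hex.choose_spec he.edge_mem
  · intro hiff
    rcases (hst e hlink.edge_mem).eq_and_eq_or_eq_and_eq hlink with ⟨h3, h4⟩ | ⟨h3, h4⟩
    · rw [show s e = ⟨d.fst.1, hV d.fst.2⟩ from Subtype.ext h3,
        show t e = ⟨d.snd.1, hV d.snd.2⟩ from Subtype.ext h4] at hiff
      exact h2 (hiff.1 h1)
    · rw [show s e = ⟨d.snd.1, hV d.snd.2⟩ from Subtype.ext h3,
        show t e = ⟨d.fst.1, hV d.fst.2⟩ from Subtype.ext h4] at hiff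
      exact h2 (hiff.2 h1)

open Classical in
lemma hasBipartiteModuloRegularFactor_of_valency {α β : Type*} {G : Graph α β} {k : ℕ}
    {s t : β → G.vertexSet} (hst : ∀ e ∈ G.edgeSet, G.IsLink e (s e) (t e))
    {H : Finset β} (hH : ∀ e ∈ H, e ∈ G.edgeSet) {X : Finset G.vertexSet}
    (hX : ∀ e ∈ H, ¬ (s e ∈ X ↔ t e ∈ X))
    (hval : ∀ v, 0 < valency H s t v ∧ k ∣ valency H s t v) :
    G.HasBipartiteModuloRegularFactor k := by
  refine ⟨G.restrict H, ⟨Graph.restrict_le, rfl⟩, ⟨{v | ∃ h, (⟨v, h⟩ : G.vertexSet) ∈ X},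
    {v | ∃ h, (⟨v, h⟩ : G.vertexSet) ∉ X}, ?_, ?_, ?_⟩, fun v hv => ?_⟩
  · ext v
    simp only [Set.mem_union, Set.mem_ofPred_eq, Graph.vertexSet_restrict]
    constructor
    · rintro (⟨h, -⟩ | ⟨h, -⟩) <;> exact h
    · intro h
      by_cases h' : (⟨v, h⟩ : G.vertexSet) ∈ X
      · exact Or.inl ⟨h, h'⟩
      · exact Or.inr ⟨h, h'⟩
  · rw [Set.disjoint_left]
    rintro v ⟨h, h1⟩ ⟨_, h2⟩
    exact h2 h1
  · intro e x y hl
    obtain ⟨he, hl⟩ := hl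
    have h1 := hX e he
    have h2 : ∀ v : G.vertexSet, v ∈ X → (v : α) ∈ {v | ∃ h, (⟨v, h⟩ : G.vertexSet) ∈ X} :=
      fun v hv => ⟨v.2, hv⟩
    have h3 : ∀ v : G.vertexSet, v ∉ X → (v : α) ∈ {v | ∃ h, (⟨v, h⟩ : G.vertexSet) ∉ X} :=
      fun v hv => ⟨v.2, hv⟩
    rcases hl.eq_and_eq_or_eq_and_eq (hst e hl.edge_mem) with ⟨rfl, rfl⟩ | ⟨rfl, rfl⟩
    · by_cases h4 : s e ∈ X
      · exact Or.inl ⟨h2 _ h4, h3 _ fun h5 => h1 (by simp [h4, h5])⟩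
      · exact Or.inr ⟨h3 _ h4, h2 _ (by_contra fun h5 => h1 (by simp [h4, h5]))⟩
    · by_cases h4 : s e ∈ X
      · exact Or.inr ⟨h3 _ fun h5 => h1 (by simp [h4, h5]), h2 _ h4⟩
      · exact Or.inl ⟨h2 _ (by_contra fun h5 => h1 (by simp [h4, h5])), h3 _ h4⟩
  -- All edges of `H` cross `X`, so there are no loops and degree equals valency.
  · have hne : ∀ e ∈ H, s e ≠ t e := fun e he h => hX e he (by rw [h])
    have h1 : (G.restrict H).loopSet v = ∅ := by
      ext e
      simp only [Graph.mem_loopSet, Set.mem_empty_iff_false, iff_false]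
      intro hl
      obtain ⟨he, hl⟩ := hl
      rcases hl.eq_and_eq_or_eq_and_eq (hst e hl.edge_mem) with ⟨h2, h3⟩ | ⟨h2, h3⟩
      · exact hne e he (Subtype.ext (h2.symm.trans h3))
      · exact hne e he (Subtype.ext (h3.symm.trans h2))
    have h2 : (G.restrict H).incidenceSet v = (H.filter (At s t ⟨v, hv⟩) : Finset β) := by
      ext e
      simp only [Graph.mem_incidenceSet, Graph.restrict_inc, Finset.coe_filter, Set.mem_ofPred_eq]
      constructor
      · rintro ⟨hinc, he⟩
        refine ⟨he, ?_⟩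
        have h3 := hne e he
        unfold At
        rcases hinc.eq_or_eq_of_isLink (hst e (hH e he)) with h4 | h4
        · have h5 : s e = ⟨v, hv⟩ := Subtype.ext h4.symm
          rw [h5] at h3 ⊢
          simp [h3.symm]
        · have h5 : t e = ⟨v, hv⟩ := Subtype.ext h4.symm
          rw [h5] at h3 ⊢
          simp [h3]
      · rintro ⟨he, hat⟩
        refine ⟨?_, he⟩
        obtain ⟨x, -, hj⟩ := hat.exists_joins
        have hl := hst e (hH e he)
        rcases hj with ⟨h3, -⟩ | ⟨-, h3⟩
        · rw [h3] at hl; exact hl.inc_left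
        · rw [h3] at hl; exact hl.inc_right
    have h3 : (G.restrict H).deg v = valency H s t ⟨v, hv⟩ := by
      unfold Graph.deg valency
      rw [h1, h2, Set.ncard_empty, Set.ncard_coe_finset, add_zero]
    rw [h3]
    exact hval ⟨v, hv⟩

end Graph
end ModOrient

/-! ### The main theorem. -/

theorem mainTheorem12 {α β : Type*} (G : Graph α β) (hV : G.vertexSet.Finite)
    (hE : G.edgeSet.Finite) (hnt : G.vertexSet.Nontrivial) (k : ℕ) (hk : 2 ≤ k) :
    (G.TreeConnected (4 * k - 4) → G.HasBipartiteModuloRegularFactor k) ∧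
    (G.IsBipartiteGraph → G.TreeConnected (2 * k - 2) →
      G.HasBipartiteModuloRegularFactor k) := by
  classical
  have : Fintype G.vertexSet := hV.fintype
  have : Nontrivial G.vertexSet := hnt.coe_sort
  obtain ⟨s, t, hst⟩ : ∃ s t : β → G.vertexSet, ∀ e ∈ G.edgeSet, G.IsLink e (s e) (t e) := by
    have h : ∀ e, ∃ x y : G.vertexSet, e ∈ G.edgeSet → G.IsLink e x y := by
      intro e
      by_cases he : e ∈ G.edgeSet
      · obtain ⟨x, y, h⟩ := G.exists_isLink_of_mem_edgeSet he
        exact ⟨⟨x, h.left_mem⟩, ⟨y, h.right_mem⟩, fun _ => h⟩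
      · obtain ⟨a⟩ := (inferInstance : Nonempty G.vertexSet)
        -- Labels that are not edges get arbitrary ends.
        exact ⟨a, a, fun h => absurd h he⟩
    choose s t hst using h
    exact ⟨s, t, hst⟩
  have h2 : 2 ≤ (Finset.univ : Finset G.vertexSet).card := Fintype.one_lt_card
  refine ⟨fun hT => ?_, fun hB hT => ?_⟩
  · obtain ⟨c, hc⟩ := ModOrient.exists_connecting_of_treeConnected hT hE hst
    -- Passing to a maximum cut halves the number of connected classes.
    rw [show 4 * k - 4 = 2 * (2 * k - 2) by omega] at hc
    obtain ⟨X, c', hc'⟩ := ModOrient.exists_bipartite_connecting (by omega) hc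
    obtain ⟨H, hHE, hval⟩ := ModOrient.exists_factor hk (fun e _ => by simp)
      (fun e he => (Finset.mem_filter.1 he).2) hc' h2
    exact ModOrient.hasBipartiteModuloRegularFactor_of_valency hst
      (fun e he => hE.mem_toFinset.1 (Finset.mem_filter.1 (hHE he)).1)
      (fun e he => (Finset.mem_filter.1 (hHE he)).2) fun v => hval v (Finset.mem_univ v)
  · obtain ⟨c, hc⟩ := ModOrient.exists_connecting_of_treeConnected hT hE hst
    obtain ⟨X, Y, -, hXY, hlink⟩ := hB
    have hX : ∀ e ∈ hE.toFinset, ¬ (s e ∈ Finset.univ.filter (fun v : G.vertexSet => (v : α) ∈ X) ↔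
        t e ∈ Finset.univ.filter (fun v : G.vertexSet => (v : α) ∈ X)) := by
      intro e he
      have h := hlink e _ _ (hst e (hE.mem_toFinset.1 he))
      have h1 : ∀ v ∈ Y, v ∉ X := fun v hv hv' => Set.disjoint_left.1 hXY hv' hv
      simp only [Finset.mem_filter, Finset.mem_univ, true_and]
      rcases h with ⟨h3, h4⟩ | ⟨h3, h4⟩
      · simp [h3, h1 _ h4]
      · simp [h4, h1 _ h3]
    obtain ⟨H, hHE, hval⟩ := ModOrient.exists_factor hk (fun e _ => by simp) hX hc h2
    exact ModOrient.hasBipartiteModuloRegularFactor_of_valency hst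
      (fun e he => hE.mem_toFinset.1 (hHE he)) (fun e he => hX e (hHE he))
      fun v => hval v (Finset.mem_univ v)
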